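/- Let $B_n$ be the braid group on $n$ strands with standard generators $\sigma_1,\dots,\sigma_{n-1}$, and regard $B_a\subseteq B_n$ for $a\le n$ via $\sigma_i\mapsto\sigma_i$. Write $[1,r]=\sigma_1\sigma_2\cdots\sigma_{r-1}$ (so $[1,1]=1$), let $\widehat\beta$ be the oriented link in $\mathbb{R}^3$ obtained as the standard closure of a braid $\beta$, and let equality of links mean ambient isotopy of oriented links. For integers $2\le r_1\le\dots\le r_k$ and $s_1,\dots,s_k>0$, the T-link $T((r_1,s_1),\dots,(r_k,s_k))$ is the closure of the braid $[1,r_1]^{s_1}\cdots[1,r_k]^{s_k}\in B_{r_k}$. 1. Let $1\le m$ and $a\le m\le n_1,n_2$, let $\gamma\in B_a$, and let $y_1,y_2\in\mathbb{Z}$ with $n_1+y_1=n_2+y_2$ and $n_1\equiv n_2 \pmod m$. Then $$\widehat{\gamma\,[1,m]^{y_1}[1,n_1]^m}=\widehat{\gamma\,[1,m]^{y_2}[1,n_2]^m},$$ where the braid on the left lies in $B_{n_1}$ and the braid on the right lies in $B_{n_2}$. 2. Consequently, let $j\ge 0$, $2\le r_1\le\dots\le r_j\le m\le n_1,n_2$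 with $m\ge2$, let $s_1,\dots,s_j,y_1,y_2>0$, and suppose $n_1+y_1=n_2+y_2$ and $n_1\equiv n_2\pmod m$. Then $$T((r_1,s_1),\dots,(r_j,s_j),(m,y_1),(n_1,m))=T((r_1,s_1),\dots,(r_j,s_j),(m,y_2),(n_2,m)).$$ In particular $T((m,y_1),(n_1,m))=T((m,y_2),(n_2,m))$. 3. Let $2\le m\le n_1,n_2$ and $y_1,y_2>0$ with $n_1+y_1=n_2+y_2$, and suppose that instead $n_1\equiv y_2\pmod m$. Then also $T((m,y_1),(n_1,m))=T((m,y_2),(n_2,m))$. 4. In particular, $T((m,y),(n,m))=T((m,n),(y,m))$ whenever $2\le m\le n$ and $m\le y$. -/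

import Mathlib

noncomputable section

/-! ### Braid groups -/

/-- The indices `1, …, n - 1` of the standard generators of the braid group on `n` strands. -/
abbrev BraidGen (n : ℕ) : Type := {i : ℕ // 1 ≤ i ∧ i < n}

/-- The Artin relations: `σ_i σ_j = σ_j σ_i` for `|i - j| ≥ 2` and
`σ_i σ_{i+1} σ_i = σ_{i+1} σ_i σ_{i+1}`. -/
def artinRels (n : ℕ) : Set (FreeGroup (BraidGen n)) :=
  {r | ∃ i j : BraidGen n, i.1 + 2 ≤ j.1 ∧
      r = (FreeGroup.of i * FreeGroup.of j) * (FreeGroup.of j * FreeGroup.of i)⁻¹} ∪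
  {r | ∃ i j : BraidGen n, i.1 + 1 = j.1 ∧
      r = (FreeGroup.of i * FreeGroup.of j * FreeGroup.of i) *
        (FreeGroup.of j * FreeGroup.of i * FreeGroup.of j)⁻¹}

/-- The braid group `B_n`. -/
abbrev BraidGroup (n : ℕ) : Type := PresentedGroup (artinRels n)

/-- The standard generator `σ_i` of `B_n` for `1 ≤ i < n` (and `1` for other `i`). -/
def braidSigma (n i : ℕ) : BraidGroup n :=
  if h : 1 ≤ i ∧ i < n then PresentedGroup.of (rels := artinRels n) ⟨i, h⟩ else 1

/-- The braid `[1,r] = σ_1 σ_2 ⋯ σ_{r-1}` in `B_n`, where `r ≤ n`; `[1,1] = 1`. -/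
def braidRun (n r : ℕ) : BraidGroup n :=
  ((List.range' 1 (r - 1)).map (braidSigma n)).prod

theorem braidIncl_aux {a n : ℕ} (h : a ≤ n) : ∀ r ∈ artinRels a,
    FreeGroup.lift (fun i : BraidGen a =>
      PresentedGroup.of (rels := artinRels n) ⟨i.1, i.2.1, i.2.2.trans_le h⟩) r = 1 := by
  rintro r (⟨i, j, hij, rfl⟩ | ⟨i, j, hij, rfl⟩)
  · have := PresentedGroup.one_of_mem (rels := artinRels n)
      (Or.inl ⟨⟨i.1, i.2.1, i.2.2.trans_le h⟩, ⟨j.1, j.2.1, j.2.2.trans_le h⟩, hij, rfl⟩)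
    simpa [PresentedGroup.of] using this
  · have := PresentedGroup.one_of_mem (rels := artinRels n)
      (Or.inr ⟨⟨i.1, i.2.1, i.2.2.trans_le h⟩, ⟨j.1, j.2.1, j.2.2.trans_le h⟩, hij, rfl⟩)
    simpa [PresentedGroup.of] using this

/-- The standard homomorphism `B_a → B_n`, `σ_i ↦ σ_i`, for `a ≤ n`. -/
def braidIncl {a n : ℕ} (h : a ≤ n) : BraidGroup a →* BraidGroup n :=
  PresentedGroup.toGroup (braidIncl_aux h)

/-- A letter of a braid word: `(i, true)` is `σ_i` and `(i, false)` is `σ_i⁻¹`. -/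
abbrev BraidLetter (n : ℕ) : Type := BraidGen n × Bool

/-- A braid word on `n` strands. -/
abbrev BraidWord (n : ℕ) : Type := List (BraidLetter n)

/-- The braid that a braid word represents. -/
def BraidWord.toBraid {n : ℕ} (w : BraidWord n) : BraidGroup n :=
  PresentedGroup.mk (artinRels n) (FreeGroup.mk w)

/-! ### Oriented links in Euclidean 3-space and ambient isotopy -/

/-- Euclidean 3-space, as the product of the horizontal plane and the vertical axis. -/
abbrev Space3 : Type := ℂ × ℝ

/-- An oriented link: an embedding of a finite disjoint union of (oriented) circles `ℝ/ℤ`. -/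
structure OrientedLink where
  ι : Type
  finite : Finite ι
  curve : ι → UnitAddCircle → Space3
  continuous : ∀ i, Continuous (curve i)
  injective : Function.Injective fun p : ι × UnitAddCircle => curve p.1 p.2

/-- Two oriented links are the same link: an ambient isotopy carries the one to the other, mapping
components to components and preserving their orientations (the components correspond up to
orientation preserving changes of parameter, which are given by their increasing lifts to `ℝ`). -/
def OrientedLink.Isotopic (K L : OrientedLink) : Prop :=
  ∃ H : unitInterval → (Space3 ≃ₜ Space3),
    Continuous (fun p : unitInterval × Space3 => H p.1 p.2) ∧
    H 0 = Homeomorph.refl Space3 ∧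
    ∃ e : K.ι ≃ L.ι, ∀ i, ∃ φ : ℝ ≃o ℝ, ∀ t : ℝ,
      H 1 (K.curve i (t : UnitAddCircle)) = L.curve (e i) ((φ t : ℝ) : UnitAddCircle)

/-! ### Closed braids

A braid is a motion of `n` points of the half-plane with coordinates `(r, z)`, `r > 0`, that starts
and ends in the positions `(1, 0), …, (n, 0)`. Its closure is obtained by turning this half-plane
once around the axis `{0} × ℝ` of `ℂ × ℝ` during the motion. -/

/-- The motion of the point that starts in position `j` under one letter, `0 ≤ s ≤ 1`:
for `σ_i`, the points in positions `i` and `i + 1` are exchanged linearly in `r`, the one that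
starts in position `i` passing above; for `σ_i⁻¹` it passes below. -/
def letterMotion {n : ℕ} (g : BraidLetter n) (j : ℕ) (s : ℝ) : ℝ × ℝ :=
  if j = g.1.1 then (g.1.1 + s, (if g.2 then 1 else -1) * min s (1 - s))
  else if j = g.1.1 + 1 then (g.1.1 + 1 - s, (if g.2 then -1 else 1) * min s (1 - s))
  else (j, 0)

/-- The permutation of the positions caused by one letter. -/
def letterPerm {n : ℕ} (g : BraidLetter n) : Equiv.Perm ℕ := Equiv.swap g.1.1 (g.1.1 + 1)

/-- The permutation of the positions caused by a word (its letters act from left to right). -/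
def wordPerm {n : ℕ} : BraidWord n → Equiv.Perm ℕ
  | [] => 1
  | g :: w => wordPerm w * letterPerm g

/-- The motion under a word of the point that starts in position `j`: the letters act one after
the other, each for one unit of time; afterwards the point rests. -/
def wordMotion {n : ℕ} : BraidWord n → ℕ → ℝ → ℝ × ℝ
  | [], j, _ => (j, 0)
  | g :: w, j, s => if s ≤ 1 then letterMotion g j s else wordMotion w (letterPerm g j) (s - 1)

/-- The point with polar coordinates `r`, `2πt` in the plane and height `z`. -/
def cylPoint (p : ℝ × ℝ) (t : ℝ) : Space3 :=
  ((p.1 : ℂ) * Complex.exp (2 * Real.pi * t * Complex.I), p.2)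

/-- The strand of the closed braid that starts in position `j`, followed forwards and backwards
for ever; `t` counts the turns around the axis. Each turn has one unit of time for every letter
of the word and one unit of rest. -/
def closedStrand {n : ℕ} (w : BraidWord n) (j : ℕ) (t : ℝ) : Space3 :=
  cylPoint (wordMotion w ((wordPerm w ^ ⌊t⌋) j) ((w.length + 1) * Int.fract t)) t

/-- The number of turns after which the strand that starts in position `j` closes up. -/
def strandPeriod {n : ℕ} (w : BraidWord n) (j : ℕ) : ℕ := Function.minimalPeriod (wordPerm w) j

/-- The components of the closed braid, each given by the least position on it. -/
def ClosedBraidComponent {n : ℕ} (w : BraidWord n) : Type :=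
  {j : ℕ // 1 ≤ j ∧ j ≤ n ∧ ∀ q : ℤ, j ≤ (wordPerm w ^ q) j}

theorem letterMotion_zero {n : ℕ} (g : BraidLetter n) (j : ℕ) : letterMotion g j 0 = ((j : ℝ), 0) := by
  unfold letterMotion
  split_ifs with h1 h2 h3 <;> simp_all

theorem letterMotion_one {n : ℕ} (g : BraidLetter n) (j : ℕ) :
    letterMotion g j 1 = (((letterPerm g j : ℕ) : ℝ), 0) := by
  unfold letterMotion letterPerm
  split_ifs with h1 h2 h3 <;> simp_all [Equiv.swap_apply_of_ne_of_ne]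

theorem continuous_letterMotion {n : ℕ} (g : BraidLetter n) (j : ℕ) :
    Continuous (letterMotion g j) := by
  unfold letterMotion
  split_ifs <;> fun_prop

theorem wordMotion_zero {n : ℕ} (w : BraidWord n) (j : ℕ) : wordMotion w j 0 = ((j : ℝ), 0) := by
  cases w with
  | nil => rfl
  | cons g w => simp [wordMotion, letterMotion_zero]

theorem continuous_wordMotion {n : ℕ} (w : BraidWord n) (j : ℕ) :
    Continuous (wordMotion w j) := by
  induction w generalizing j with
  | nil => exact continuous_const
  | cons g w ih =>
    refine Continuous.if_le (continuous_letterMotion g j)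
      ((ih _).comp (continuous_id.sub continuous_const)) continuous_id continuous_const ?_
    rintro s rfl
    simp [letterMotion_one, wordMotion_zero]

theorem wordMotion_end {n : ℕ} (w : BraidWord n) (j : ℕ) :
    wordMotion w j (w.length + 1) = (((wordPerm w j : ℕ) : ℝ), 0) := by
  induction w generalizing j with
  | nil => rfl
  | cons g w ih =>
    have h : ¬ ((w.length : ℝ) + 1 + 1 ≤ 1) := by have := Nat.cast_nonneg (α := ℝ) w.length; linarith
    simp [wordMotion, wordPerm, h, ih]

theorem letterMotion_injective {n : ℕ} (g : BraidLetter n) {s : ℝ} (h0 : 0 ≤ s) (h1 : s ≤ 1)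
    {j k : ℕ} (h : letterMotion g j s = letterMotion g k s) : j = k := by
  have key : ∀ a b : ℕ, (a : ℝ) + s = b → b = a ∨ b = a + 1 := by
    intro a b hab
    have h2 : a ≤ b := by exact_mod_cast (by linarith : (a : ℝ) ≤ b)
    have h3 : b ≤ a + 1 := by exact_mod_cast (by linarith : (b : ℝ) ≤ a + 1)
    omega
  have key' : ∀ a b : ℕ, (a : ℝ) + 1 - s = b → b = a ∨ b = a + 1 := by
    intro a b hab
    have h2 : a ≤ b := by exact_mod_cast (by linarith : (a : ℝ) ≤ b)
    have h3 : b ≤ a + 1 := by exact_mod_cast (by linarith : (b : ℝ) ≤ a + 1)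
    omega
  have half : ∀ a : ℝ, a + s = a + 1 - s → s = 1 / 2 := fun a ha => by linarith
  obtain ⟨⟨i, hi⟩, b⟩ := g
  simp only [letterMotion] at h
  by_cases j1 : j = i <;> by_cases k1 : k = i
  · omega
  · by_cases k2 : k = i + 1
    · exfalso
      simp only [j1, k2, if_true, Nat.succ_ne_self, if_false, Prod.mk.injEq] at h
      have hs := half _ h.1
      subst hs
      have h2 := h.2
      cases b <;> norm_num at h2
    · simp only [j1, k1, k2, if_true, if_false, Prod.mk.injEq] at h
      rcases key i k h.1 with h | h <;> omega
  · by_cases j2 : j = i + 1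
    · exfalso
      simp only [k1, j2, if_true, Nat.succ_ne_self, if_false, Prod.mk.injEq] at h
      have hs := half _ h.1.symm
      subst hs
      have h2 := h.2
      cases b <;> norm_num at h2
    · simp only [k1, j1, j2, if_true, if_false, Prod.mk.injEq] at h
      rcases key i j h.1.symm with h | h <;> omega
  · by_cases j2 : j = i + 1 <;> by_cases k2 : k = i + 1
    · omega
    · simp only [k1, j2, k2, if_true, Nat.succ_ne_self, if_false, Prod.mk.injEq] at h
      rcases key' i k h.1 with h | h <;> omega
    · simp only [j1, j2, k2, if_true, Nat.succ_ne_self, if_false, Prod.mk.injEq] at h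
      rcases key' i j h.1.symm with h | h <;> omega
    · simp only [j1, k1, j2, k2, if_false, Prod.mk.injEq] at h
      exact_mod_cast h.1

theorem wordMotion_injective {n : ℕ} (w : BraidWord n) {s : ℝ} (h0 : 0 ≤ s)
    {j k : ℕ} (h : wordMotion w j s = wordMotion w k s) : j = k := by
  induction w generalizing j k s with
  | nil => simpa [wordMotion] using h
  | cons g w ih =>
    by_cases hs : s ≤ 1
    · simp only [wordMotion, hs, if_true] at h
      exact letterMotion_injective g h0 hs h
    · simp only [wordMotion, hs, if_false] at h
      exact (letterPerm g).injective (ih (by linarith) h)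

theorem letterPerm_mem {n : ℕ} (g : BraidLetter n) {j : ℕ} (hj : j ∈ Set.Icc 1 n) :
    letterPerm g j ∈ Set.Icc 1 n := by
  obtain ⟨⟨i, hi⟩, b⟩ := g
  simp only [letterPerm, Equiv.swap_apply_def, Set.mem_Icc] at *
  split_ifs <;> omega

theorem wordPerm_mem {n : ℕ} (w : BraidWord n) {j : ℕ} (hj : j ∈ Set.Icc 1 n) :
    wordPerm w j ∈ Set.Icc 1 n := by
  induction w generalizing j with
  | nil => exact hj
  | cons g w ih => exact ih (letterPerm_mem g hj)

theorem wordMotion_pos {n : ℕ} (w : BraidWord n) {s : ℝ} (h0 : 0 ≤ s) {j : ℕ}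
    (hj : j ∈ Set.Icc 1 n) : 0 < (wordMotion w j s).1 := by
  have pos : ∀ k : ℕ, 1 ≤ k → (0 : ℝ) < k := fun k hk => by exact_mod_cast hk
  induction w generalizing j s with
  | nil => exact pos j hj.1
  | cons g w ih =>
    by_cases hs : s ≤ 1
    · have hi := pos _ g.1.2.1
      simp only [wordMotion, hs, if_true, letterMotion]
      by_cases h1 : j = g.1.1
      · simp only [h1, if_true]; linarith
      · by_cases h2 : j = g.1.1 + 1
        · simp only [h2, Nat.succ_ne_self, if_true, if_false]; linarith
        · simp only [h1, h2, if_false]; exact pos j hj.1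
    · simp only [wordMotion, hs, if_false]
      exact ih (by linarith) (letterPerm_mem g hj)

theorem wordPerm_pow_mem {n : ℕ} (w : BraidWord n) {j : ℕ} (hj : j ∈ Set.Icc 1 n) (q : ℕ) :
    (wordPerm w ^ q) j ∈ Set.Icc 1 n := by
  induction q with
  | zero => exact hj
  | succ q ih => rw [pow_succ']; exact wordPerm_mem w ih

theorem strandPeriod_pos {n : ℕ} (w : BraidWord n) {j : ℕ} (hj : j ∈ Set.Icc 1 n) :
    0 < strandPeriod w j := by
  obtain ⟨a, b, hab, h⟩ := Set.Finite.exists_lt_map_eq_of_forall_mem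
    (f := fun q : ℕ => (wordPerm w ^ q) j) (wordPerm_pow_mem w hj) (Set.finite_Icc 1 n)
  refine Function.IsPeriodicPt.minimalPeriod_pos (n := b - a) (by omega) ?_
  have h' : (wordPerm w ^ a) j = (wordPerm w ^ a) ((wordPerm w ^ (b - a)) j) := by
    rw [← Equiv.Perm.mul_apply, ← pow_add, Nat.add_sub_cancel' hab.le]; exact h
  have h2 := (wordPerm w ^ a).injective h'
  rw [Function.IsPeriodicPt, Function.IsFixedPt, Equiv.Perm.iterate_eq_pow]
  exact h2.symm

theorem wordPerm_pow_strandPeriod {n : ℕ} (w : BraidWord n) (j : ℕ) :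
    (wordPerm w ^ strandPeriod w j) j = j := by
  have := Function.isPeriodicPt_minimalPeriod (wordPerm w) j
  rwa [Function.IsPeriodicPt, Function.IsFixedPt, Equiv.Perm.iterate_eq_pow] at this

theorem strandPeriod_dvd {n : ℕ} (w : BraidWord n) (j : ℕ) (m : ℤ)
    (h : (wordPerm w ^ m) j = j) : (strandPeriod w j : ℤ) ∣ m := by
  have key : ∀ q : ℕ, (wordPerm w ^ q) j = j → strandPeriod w j ∣ q := fun q hq => by
    apply Function.IsPeriodicPt.minimalPeriod_dvd
    rwa [Function.IsPeriodicPt, Function.IsFixedPt, Equiv.Perm.iterate_eq_pow]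
  obtain ⟨q, rfl | rfl⟩ := m.eq_nat_or_neg
  · exact Int.natCast_dvd_natCast.2 (key q (by simpa using h))
  · rw [dvd_neg]
    refine Int.natCast_dvd_natCast.2 (key q ?_)
    rw [zpow_neg, Equiv.Perm.inv_eq_iff_eq] at h
    simpa using h.symm

theorem wordPerm_zpow_mem {n : ℕ} (w : BraidWord n) {j : ℕ} (hj : j ∈ Set.Icc 1 n) (q : ℤ) :
    (wordPerm w ^ q) j ∈ Set.Icc 1 n := by
  have hd := strandPeriod_pos w hj
  have h1 : (wordPerm w ^ (q % (strandPeriod w j : ℤ))) j = (wordPerm w ^ q) j := by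
    have h2 : (wordPerm w ^ (strandPeriod w j : ℤ)) j = j := by
      rw [zpow_natCast]; exact wordPerm_pow_strandPeriod w j
    conv_rhs => rw [← Int.emod_add_mul_ediv q (strandPeriod w j), zpow_add, zpow_mul,
      Equiv.Perm.mul_apply, Equiv.Perm.zpow_apply_eq_self_of_apply_eq_self h2]
  rw [← h1, ← Int.toNat_of_nonneg (Int.emod_nonneg q (by omega : (strandPeriod w j : ℤ) ≠ 0)),
    zpow_natCast]
  exact wordPerm_pow_mem w hj _

theorem continuous_closedStrand {n : ℕ} (w : BraidWord n) (j : ℕ) :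
    Continuous (closedStrand w j) := by
  let G : ℤ → ℝ → Space3 := fun k t =>
    cylPoint (wordMotion w ((wordPerm w ^ k) j) ((w.length + 1) * (t - k))) t
  have hG : ∀ k, Continuous (G k) := by
    intro k
    have h1 : Continuous fun t : ℝ =>
        wordMotion w ((wordPerm w ^ k) j) ((w.length + 1) * (t - k)) :=
      (continuous_wordMotion w _).comp (by fun_prop)
    simp only [G, cylPoint]
    fun_prop
  have hglue : ∀ k : ℤ, G k k = G (k - 1) k := by
    intro k
    have h2 : (wordPerm w) ((wordPerm w ^ (k - 1)) j) = (wordPerm w ^ k) j := by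
      rw [← Equiv.Perm.mul_apply, ← zpow_one_add]; congr 2; ring
    simp [G, wordMotion_zero, wordMotion_end, h2]
  have hI : ∀ (k : ℤ) (t : ℝ), (k : ℝ) ≤ t → t < k + 1 → closedStrand w j t = G k t := by
    intro k t h1 h2
    have : ⌊t⌋ = k := Int.floor_eq_iff.2 ⟨h1, h2⟩
    simp [G, closedStrand, this, Int.fract]
  rw [continuous_iff_continuousAt]
  intro t
  have hk1 := Int.floor_le t
  have hk2 := Int.lt_floor_add_one t
  rw [continuousAt_iff_continuous_left'_right']
  constructor
  · rcases hk1.eq_or_lt with h | h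
    · refine ((hG (⌊t⌋ - 1)).continuousWithinAt).congr_of_eventuallyEq ?_ ?_
      · filter_upwards [Ioo_mem_nhdsLT (show t - 1 < t by linarith)] with s hs
        refine hI _ _ ?_ ?_ <;> push_cast <;> linarith [hs.1, hs.2]
      · rw [hI _ _ hk1 hk2]
        have := hglue ⌊t⌋
        rwa [h] at this
    · refine ((hG ⌊t⌋).continuousWithinAt).congr_of_eventuallyEq ?_ (hI _ _ hk1 hk2)
      filter_upwards [Ioo_mem_nhdsLT h] with s hs
      exact hI _ _ hs.1.le (hs.2.trans hk2)
  · refine ((hG ⌊t⌋).continuousWithinAt).congr_of_eventuallyEq ?_ (hI _ _ hk1 hk2)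
    filter_upwards [Ioo_mem_nhdsGT hk2] with s hs
    exact hI _ _ (hk1.trans hs.1.le) hs.2

theorem closedStrand_eq {n : ℕ} (w : BraidWord n) {j k : ℕ} (hj : j ∈ Set.Icc 1 n)
    (hk : k ∈ Set.Icc 1 n) {s t : ℝ} (h : closedStrand w j s = closedStrand w k t) :
    ∃ m : ℤ, s = t + m ∧ (wordPerm w ^ m) j = k := by
  have hl : (0 : ℝ) ≤ w.length + 1 := by positivity
  have hp1 := wordMotion_pos w (mul_nonneg hl (Int.fract_nonneg s)) (wordPerm_zpow_mem w hj ⌊s⌋)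
  have hp2 := wordMotion_pos w (mul_nonneg hl (Int.fract_nonneg t)) (wordPerm_zpow_mem w hk ⌊t⌋)
  simp only [closedStrand, cylPoint, Prod.mk.injEq] at h
  obtain ⟨h1, h2⟩ := h
  have e1 : ∀ x : ℝ, ‖Complex.exp (2 * Real.pi * x * Complex.I)‖ = 1 := fun x => by
    have := Complex.norm_exp_ofReal_mul_I (2 * Real.pi * x)
    push_cast at this
    exact this
  have hr : (wordMotion w ((wordPerm w ^ ⌊s⌋) j) ((w.length + 1) * Int.fract s)).1 =
      (wordMotion w ((wordPerm w ^ ⌊t⌋) k) ((w.length + 1) * Int.fract t)).1 := by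
    have := congrArg norm h1
    rwa [norm_mul, norm_mul, e1, e1, mul_one, mul_one, Complex.norm_real, Complex.norm_real,
      Real.norm_of_nonneg hp1.le, Real.norm_of_nonneg hp2.le] at this
  rw [hr] at h1
  have h3 := mul_left_cancel₀ (Complex.ofReal_ne_zero.2 hp2.ne') h1
  obtain ⟨m, hm⟩ := Complex.exp_eq_exp_iff_exists_int.1 h3
  have hm' : s = t + m := by
    have h4 : (s : ℂ) = t + m := by
      have h5 : (2 * Real.pi * Complex.I : ℂ) ≠ 0 := Complex.two_pi_I_ne_zero
      apply mul_left_cancel₀ h5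
      linear_combination hm
    exact_mod_cast h4
  have hf : Int.fract s = Int.fract t := by rw [hm', Int.fract_add_intCast]
  have hfl : ⌊s⌋ = ⌊t⌋ + m := by rw [hm', Int.floor_add_intCast]
  refine ⟨m, hm', ?_⟩
  rw [hf] at hr h2
  have := wordMotion_injective w (mul_nonneg hl (Int.fract_nonneg t)) (Prod.ext hr h2)
  rw [hfl, zpow_add, Equiv.Perm.mul_apply] at this
  exact (wordPerm w ^ ⌊t⌋).injective this

theorem closedStrand_periodic {n : ℕ} (w : BraidWord n) (j : ℕ) :
    Function.Periodic (fun t : ℝ => closedStrand w j (strandPeriod w j * t)) 1 := by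
  intro t
  have h : (strandPeriod w j : ℝ) * (t + 1) =
      strandPeriod w j * t + ((strandPeriod w j : ℤ) : ℝ) := by push_cast; ring
  have hexp : ∀ x : ℝ, Complex.exp (2 * Real.pi * ((x + ((strandPeriod w j : ℤ) : ℝ) : ℝ) : ℂ) *
      Complex.I) = Complex.exp (2 * Real.pi * x * Complex.I) := by
    intro x
    rw [Complex.exp_eq_exp_iff_exists_int]
    exact ⟨strandPeriod w j, by push_cast; ring⟩
  simp only [h, closedStrand, cylPoint, Int.floor_add_intCast, Int.fract_add_intCast, hexp,
    zpow_add, Equiv.Perm.mul_apply, zpow_natCast, wordPerm_pow_strandPeriod]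

/-- The closure of a braid word on `n` strands, oriented in the direction of the strands. -/
def closedBraid {n : ℕ} (w : BraidWord n) : OrientedLink where
  ι := ClosedBraidComponent w
  finite := Set.Finite.to_subtype ((Set.finite_Icc 1 n).subset fun _ hj => ⟨hj.1, hj.2.1⟩)
  curve j := (closedStrand_periodic w j.1).lift
  continuous j := by
    have h : Continuous fun t : ℝ => closedStrand w j.1 (strandPeriod w j.1 * t) :=
      (continuous_closedStrand w j.1).comp (by fun_prop)
    exact continuous_coinduced_dom.2 h
  injective := by
    rintro ⟨⟨j, hj⟩, x⟩ ⟨⟨k, hk⟩, y⟩ h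
    induction x using QuotientAddGroup.induction_on with | _ s => ?_
    induction y using QuotientAddGroup.induction_on with | _ t => ?_
    have hj' : j ∈ Set.Icc 1 n := ⟨hj.1, hj.2.1⟩
    have hk' : k ∈ Set.Icc 1 n := ⟨hk.1, hk.2.1⟩
    have h' : closedStrand w j (strandPeriod w j * s) =
      closedStrand w k (strandPeriod w k * t) := h
    obtain ⟨m, hm, hp⟩ := closedStrand_eq w hj' hk' h'
    have hjk : j = k := by
      apply le_antisymm
      · exact hp ▸ hj.2.2 m
      · have := hk.2.2 (-m)
        rwa [zpow_neg, Equiv.Perm.inv_eq_iff_eq.2 hp.symm] at this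
    subst hjk
    obtain ⟨q, rfl⟩ := strandPeriod_dvd w j m hp
    have hd : (0 : ℝ) < strandPeriod w j := by exact_mod_cast strandPeriod_pos w hj'
    have hst : s = t + q := by
      push_cast at hm
      apply mul_left_cancel₀ hd.ne'
      linarith
    have hc : ((s : ℝ) : UnitAddCircle) = ((t : ℝ) : UnitAddCircle) := by
      rw [hst, AddCircle.coe_add]
      have : ((q : ℝ) : UnitAddCircle) = 0 := (AddCircle.coe_eq_zero_iff 1).2 ⟨q, by simp⟩
      rw [this, add_zero]
    exact Prod.ext rfl hc

/-- Two braids, possibly with different numbers of strands, have the same closure: the closures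
of any two words that represent them are the same oriented link. -/
def SameClosure {n₁ n₂ : ℕ} (β₁ : BraidGroup n₁) (β₂ : BraidGroup n₂) : Prop :=
  ∀ (w₁ : BraidWord n₁) (w₂ : BraidWord n₂), w₁.toBraid = β₁ → w₂.toBraid = β₂ →
    (closedBraid w₁).Isotopic (closedBraid w₂)

/-! ### T-links -/

/-- The number `r_k` of strands of `T((r_1,s_1),…,(r_k,s_k))`, where `r_1 ≤ ⋯ ≤ r_k`. -/
def tStrands (l : List (ℕ × ℕ)) : ℕ := (l.map Prod.fst).foldr max 0

/-- The braid `[1,r_1]^{s_1} ⋯ [1,r_k]^{s_k}` on `r_k` strands. -/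
def tBraid (l : List (ℕ × ℕ)) : BraidGroup (tStrands l) :=
  (l.map fun p => braidRun (tStrands l) p.1 ^ p.2).prod

/-- The parameters `((r_1,s_1),…,(r_k,s_k))` of a T-link:
`2 ≤ r_1 ≤ ⋯ ≤ r_k` and all `s_i` are positive. -/
def IsTLinkParam (l : List (ℕ × ℕ)) : Prop :=
  (∀ p ∈ l, 2 ≤ p.1 ∧ 0 < p.2) ∧ l.Pairwise fun p q => p.1 ≤ q.1

/-- The T-links `T(l)` and `T(l')` are the same link. -/
def SameTLink (l l' : List (ℕ × ℕ)) : Prop := SameClosure (tBraid l) (tBraid l')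

end

noncomputable section

/-! ### Ambient isotopies -/

/-! Write `A = σ₁⋯σ_{m-1}`, `D = σ_{m-1}⋯σ₁` and `Δ` for the half twist, in the braid group on `m`
strands. The heart of the proof is that `γ [1,m]^y [1,n]^m` has the same closure as `γ A^(y+m)
D^(n-m)`, a braid on `m` strands only. Indeed `[1,n]^m = [1,n-1]^m σ_{n-1}⋯σ_{n-m}`
(`IsBraidSeq.ascending_pow`), so `σ_{n-1}` occurs once and a Markov move removes it together with
the last strand. A descending product of `m - 1` generators is left over at each such step, and
after `n - m` steps these have accumulated to `D^(n-m)` (`closureIso_twist`, `closureIso_run`).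

The rest is algebra on `m` strands. Since `Δ² = A^m = D^m`, the braid `A^x D^y` depends only on `x +
y` and on `y` modulo `m` (`IsBraidSeq.zpow_mul_pow_eq`), which gives the statements with `n₁ ≡ n₂`.
Conjugation by `Δ` exchanges `A` and `D`, so for trivial `γ` the closures of `A^x D^y` and `A^y D^x`
agree (`closureIso_zpow_mul_pow`); this gives the statements with `n₁ ≡ y₂`.

Most of the work is topological: the closure must be shown to be invariant under the braid
relations, conjugation and stabilization, by actual ambient isotopies. The tool is
`exists_isAmbient_of_linear`: a linear homotopy of curves without collisions is cut into steps whose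
displacements have a small Lipschitz constant; these extend to all of space, and the identity plus
such a map is a homeomorphism. For closed braids this is promoted to arbitrary homotopies in the
half-plane (`exists_isAmbient_braid_homotopy`). The braid relations become such homotopies, the
universal property of the presentation passes from relations to braids (`exchangeHom`), and
conjugation is a half turn about the axis. For stabilization the last two strands are deformed into
one loop of two turns, whose ascending part, a spiral, is contracted along straight lines
(`spiralArc_famIso`). -/

/-- A homeomorphism of space that is the end of an ambient isotopy with continuous inverses. -/
def IsAmbient (h : Space3 ≃ₜ Space3) : Prop :=
  ∃ H : unitInterval → (Space3 ≃ₜ Space3),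
    Continuous (fun p : unitInterval × Space3 => H p.1 p.2) ∧
    Continuous (fun p : unitInterval × Space3 => (H p.1).symm p.2) ∧
    H 0 = Homeomorph.refl Space3 ∧ H 1 = h

theorem isAmbient_refl : IsAmbient (Homeomorph.refl Space3) :=
  ⟨fun _ => Homeomorph.refl _, continuous_snd, continuous_snd, rfl, rfl⟩

/-- Here the joint continuity of the inverses is needed, which `OrientedLink.Isotopic` does not ask
for. -/
theorem IsAmbient.symm {h : Space3 ≃ₜ Space3} (hh : IsAmbient h) : IsAmbient h.symm := by
  obtain ⟨H, h1, h2, h3, h4⟩ := hh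
  exact ⟨fun t => (H t).symm, h2, h1, by simp only [h3]; rfl, by simp only [h4]⟩

theorem IsAmbient.trans {h k : Space3 ≃ₜ Space3} (hh : IsAmbient h) (hk : IsAmbient k) :
    IsAmbient (h.trans k) := by
  obtain ⟨H, h1, h2, h3, h4⟩ := hh
  obtain ⟨K, k1, k2, k3, k4⟩ := hk
  refine ⟨fun t => (H t).trans (K t), ?_, ?_, ?_, ?_⟩
  · exact k1.comp (continuous_fst.prodMk h1)
  · exact h2.comp (continuous_fst.prodMk k2)
  · simp only [h3, k3]; rfl
  · simp only [h4, k4]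

/-- A displacement of Lipschitz constant less than `1` is the end of an ambient isotopy. -/
theorem exists_isAmbient_of_lipschitz {v : Space3 → Space3} {c : NNReal} (hv : LipschitzWith c v)
    (hc : c < 1) : ∃ h : Space3 ≃ₜ Space3, IsAmbient h ∧ ∀ x, h x = x + v x := by
  have key : ∀ s : unitInterval, ∀ x y : Space3,
      ‖(s.1 • v x - s.1 • v y)‖ ≤ c * ‖x - y‖ := by
    intro s x y
    rw [← smul_sub, norm_smul, Real.norm_of_nonneg s.2.1]
    have := hv.norm_sub_le x y
    calc s.1 * ‖v x - v y‖ ≤ 1 * ‖v x - v y‖ := by gcongr; exact s.2.2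
      _ ≤ _ := by rw [one_mul]; exact this
  -- A perturbation of the identity with Lipschitz constant `c < 1` is a homeomorphism; this applies
  -- at every stage `s`.
  have happ : ∀ s : unitInterval, ApproximatesLinearOn (fun x => x + s.1 • v x)
      ((ContinuousLinearEquiv.refl ℝ Space3 : Space3 ≃L[ℝ] Space3) : Space3 →L[ℝ] Space3)
      Set.univ c := by
    intro s x _ y _
    have := key s x y
    have h2 : x + s.1 • v x - (y + s.1 • v y) - (x - y) = s.1 • v x - s.1 • v y := by abel
    rw [← h2] at this
    exact this
  have hc' : Subsingleton Space3 ∨ c < ‖((ContinuousLinearEquiv.refl ℝ Space3).symm :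
      Space3 →L[ℝ] Space3)‖₊⁻¹ := by
    right
    simpa using hc
  let H : unitInterval → (Space3 ≃ₜ Space3) := fun s => (happ s).toHomeomorph _ hc'
  have hH : ∀ s x, H s x = x + s.1 • v x := fun s x => rfl
  have hvc := hv.continuous
  have hcont : Continuous (fun p : unitInterval × Space3 => H p.1 p.2) := by
    simp only [hH]
    fun_prop
  have hc0 : (0 : ℝ) < 1 - c := by
    have : (c : ℝ) < 1 := by exact_mod_cast hc
    linarith
  -- Each stage shrinks distances at most by the factor `1 - c`. This bound is uniform in `s` and
  -- makes the inverses jointly continuous.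
  have hexp : ∀ s x y, (1 - c) * ‖x - y‖ ≤ ‖H s x - H s y‖ := by
    intro s x y
    have h1 := key s x y
    have h2 : x - y = (H s x - H s y) - (s.1 • v x - s.1 • v y) := by rw [hH, hH]; abel
    have h3 : ‖x - y‖ ≤ ‖H s x - H s y‖ + ‖s.1 • v x - s.1 • v y‖ := by
      conv_lhs => rw [h2]
      exact norm_sub_le _ _
    linarith
  refine ⟨H 1, ⟨H, hcont, ?_, ?_, rfl⟩, fun x => by simp [hH]⟩
  · rw [continuous_iff_continuousAt]
    rintro ⟨s₀, y₀⟩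
    rw [ContinuousAt, tendsto_iff_norm_sub_tendsto_zero]
    have h1 : Filter.Tendsto (fun p : unitInterval × Space3 =>
        (1 - (c : ℝ))⁻¹ * ‖p.2 - H p.1 ((H s₀).symm y₀)‖) (nhds (s₀, y₀)) (nhds 0) := by
      have : Continuous (fun p : unitInterval × Space3 =>
          (1 - (c : ℝ))⁻¹ * ‖p.2 - H p.1 ((H s₀).symm y₀)‖) := by
        have := hcont.comp (continuous_fst.prodMk
          (continuous_const (y := (H s₀).symm y₀)) : Continuous fun p : unitInterval × Space3 =>
            (p.1, (H s₀).symm y₀))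
        exact continuous_const.mul (continuous_snd.sub this).norm
      have h2 := this.tendsto (s₀, y₀)
      simpa using h2
    refine squeeze_zero (fun _ => norm_nonneg _) (fun p => ?_) h1
    rw [← div_eq_inv_mul, le_div_iff₀ hc0, mul_comm]
    have := hexp p.1 ((H p.1).symm p.2) ((H s₀).symm y₀)
    rwa [Homeomorph.apply_symm_apply] at this
  · ext1 x
    simp [hH]

/-! ### Families of strands -/

/-- An ambient isotopy carries the strands of one family onto the strands of the other one. -/
def FamIso {I J : Type} (c : I → ℝ → Space3) (d : J → ℝ → Space3) : Prop :=
  ∃ h : Space3 ≃ₜ Space3, IsAmbient h ∧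
    (∀ i, ∃ j, ∃ φ : ℝ ≃o ℝ, ∀ t, h (c i t) = d j (φ t)) ∧
    (∀ j, ∃ i, ∃ φ : ℝ ≃o ℝ, ∀ t, h (c i t) = d j (φ t))

theorem FamIso.of_eq {I : Type} {c d : I → ℝ → Space3} {h : Space3 ≃ₜ Space3} (hh : IsAmbient h)
    (H : ∀ i t, h (c i t) = d i t) : FamIso c d :=
  ⟨h, hh, fun i => ⟨i, OrderIso.refl ℝ, H i⟩, fun i => ⟨i, OrderIso.refl ℝ, H i⟩⟩

theorem FamIso.refl {I : Type} (c : I → ℝ → Space3) : FamIso c c :=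
  FamIso.of_eq isAmbient_refl fun _ _ => rfl

theorem FamIso.symm {I J : Type} {c : I → ℝ → Space3} {d : J → ℝ → Space3} (H : FamIso c d) :
    FamIso d c := by
  obtain ⟨h, hh, h1, h2⟩ := H
  refine ⟨h.symm, hh.symm, fun j => ?_, fun i => ?_⟩
  · obtain ⟨i, φ, hi⟩ := h2 j
    exact ⟨i, φ.symm, fun t => by rw [Homeomorph.symm_apply_eq, hi, OrderIso.apply_symm_apply]⟩
  · obtain ⟨j, φ, hi⟩ := h1 i
    exact ⟨j, φ.symm, fun t => by rw [Homeomorph.symm_apply_eq, hi, OrderIso.apply_symm_apply]⟩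

theorem FamIso.trans {I J K : Type} {c : I → ℝ → Space3} {d : J → ℝ → Space3}
    {e : K → ℝ → Space3} (H : FamIso c d) (H' : FamIso d e) : FamIso c e := by
  obtain ⟨h, hh, h1, h2⟩ := H
  obtain ⟨k, hk, k1, k2⟩ := H'
  refine ⟨h.trans k, hh.trans hk, fun i => ?_, fun l => ?_⟩
  · obtain ⟨j, φ, hi⟩ := h1 i
    obtain ⟨l, ψ, hj⟩ := k1 j
    exact ⟨l, φ.trans ψ, fun t => by simp [hi, hj]⟩
  · obtain ⟨j, ψ, hj⟩ := k2 l
    obtain ⟨i, φ, hi⟩ := h2 j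
    exact ⟨i, φ.trans ψ, fun t => by simp [hi, hj]⟩

/-- The strands of the closed braid, one for each position. -/
def closedFam {n : ℕ} (w : BraidWord n) (j : Set.Icc 1 n) (t : ℝ) : Space3 := closedStrand w j t

theorem closedStrand_add_int {n : ℕ} (w : BraidWord n) (j : ℕ) (t : ℝ) (q : ℤ) :
    closedStrand w j (t + q) = closedStrand w ((wordPerm w ^ q) j) t := by
  have hexp : Complex.exp (2 * Real.pi * ((t + (q : ℝ) : ℝ) : ℂ) *
      Complex.I) = Complex.exp (2 * Real.pi * t * Complex.I) := by
    rw [Complex.exp_eq_exp_iff_exists_int]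
    exact ⟨q, by push_cast; ring⟩
  simp only [closedStrand, cylPoint, Int.floor_add_intCast, Int.fract_add_intCast, hexp,
    zpow_add, Equiv.Perm.mul_apply]

theorem exists_least_position {n : ℕ} (w : BraidWord n) (k : Set.Icc 1 n) :
    ∃ (i : ClosedBraidComponent w) (q : ℤ), (wordPerm w ^ q) i.1 = k := by
  let S : Set ℕ := {j | ∃ q : ℤ, (wordPerm w ^ q) k.1 = j}
  have hS : S.Nonempty := ⟨k.1, 0, rfl⟩
  obtain ⟨q, hq⟩ : sInf S ∈ S := Nat.sInf_mem hS
  have hmem : sInf S ∈ Set.Icc 1 n := hq ▸ wordPerm_zpow_mem w k.2 q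
  refine ⟨⟨sInf S, hmem.1, hmem.2, fun r => Nat.sInf_le ⟨r + q, ?_⟩⟩, -q, ?_⟩
  · rw [zpow_add, Equiv.Perm.mul_apply, hq]
  · change (wordPerm w ^ (-q)) (sInf S) = k
    rw [zpow_neg, Equiv.Perm.inv_eq_iff_eq, hq]

/-- Components of a link are disjoint, so a single common point identifies a component. Hence the
assignment of components given by `m1` is injective, and `m2` makes it surjective. -/
theorem OrientedLink.isotopic_of_ambient {K L : OrientedLink} {h : Space3 ≃ₜ Space3}
    (hh : IsAmbient h)
    (m1 : ∀ i : K.ι, ∃ i' : L.ι, ∃ φ : ℝ ≃o ℝ, ∀ t : ℝ,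
      h (K.curve i (t : UnitAddCircle)) = L.curve i' ((φ t : ℝ) : UnitAddCircle))
    (m2 : ∀ i' : L.ι, ∃ (i : K.ι) (s t : ℝ),
      h (K.curve i (s : UnitAddCircle)) = L.curve i' (t : UnitAddCircle)) : K.Isotopic L := by
  obtain ⟨A, hA1, -, hA3, hA4⟩ := hh
  choose e φ he using m1
  have hinj : Function.Injective e := by
    intro i j hij
    have h3 := he i ((φ i).symm 0)
    have h4 := he j ((φ j).symm 0)
    rw [OrderIso.apply_symm_apply] at h3 h4
    rw [hij, ← h4] at h3
    have := K.injective (a₁ := (i, _)) (a₂ := (j, _)) (h.injective h3)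
    exact (Prod.mk.inj this).1
  have hsurj : Function.Surjective e := by
    intro i'
    obtain ⟨i, s, t, hst⟩ := m2 i'
    rw [he] at hst
    exact ⟨i, (Prod.mk.inj (L.injective (a₁ := (e i, _)) (a₂ := (i', _)) hst)).1⟩
  refine ⟨A, hA1, hA3, Equiv.ofBijective e ⟨hinj, hsurj⟩, fun i => ⟨φ i, fun t => ?_⟩⟩
  rw [hA4]
  exact he i t

/-- `closedFam` lists a component once for each position on it, with a parameter that counts turns.
Passing to the least position shifts this parameter by an integer, and the periods rescale it to
`ℝ/ℤ`. -/
theorem FamIso.isotopic {n n' : ℕ} {w : BraidWord n} {w' : BraidWord n'}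
    (H : FamIso (closedFam w) (closedFam w')) : (closedBraid w).Isotopic (closedBraid w') := by
  obtain ⟨h, hh, h1, h2⟩ := H
  have hd : ∀ i : ClosedBraidComponent w, (0 : ℝ) < strandPeriod w i.1 := fun i => by
    exact_mod_cast strandPeriod_pos w ⟨i.2.1, i.2.2.1⟩
  have hd' : ∀ i : ClosedBraidComponent w', (0 : ℝ) < strandPeriod w' i.1 := fun i => by
    exact_mod_cast strandPeriod_pos w' ⟨i.2.1, i.2.2.1⟩
  have m1 : ∀ i : ClosedBraidComponent w, ∃ i' : ClosedBraidComponent w', ∃ φ : ℝ ≃o ℝ, ∀ t : ℝ,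
      h (closedStrand w i.1 (strandPeriod w i.1 * t)) =
        closedStrand w' i'.1 (strandPeriod w' i'.1 * φ t) := by
    intro i
    obtain ⟨k, φ, hk⟩ := h1 ⟨i.1, i.2.1, i.2.2.1⟩
    obtain ⟨i', q, hq⟩ := exists_least_position w' k
    refine ⟨i', (((OrderIso.mulLeft₀ _ (hd i)).trans φ).trans (OrderIso.addRight (q : ℝ))).trans
      (OrderIso.mulLeft₀ _ (hd' i')).symm, fun t => ?_⟩
    have h3 : (strandPeriod w' i'.1 : ℝ) * ((((OrderIso.mulLeft₀ _ (hd i)).trans φ).trans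
        (OrderIso.addRight (q : ℝ))).trans (OrderIso.mulLeft₀ _ (hd' i')).symm t) =
        φ (strandPeriod w i.1 * t) + q :=
      (OrderIso.mulLeft₀ _ (hd' i')).apply_symm_apply _
    rw [h3, closedStrand_add_int, hq]
    exact hk _
  have m2 : ∀ i' : ClosedBraidComponent w', ∃ (i : ClosedBraidComponent w) (s t : ℝ),
      h (closedStrand w i.1 (strandPeriod w i.1 * s)) =
        closedStrand w' i'.1 (strandPeriod w' i'.1 * t) := by
    intro i'
    obtain ⟨k, φ, hk⟩ := h2 ⟨i'.1, i'.2.1, i'.2.2.1⟩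
    obtain ⟨i, q, hq⟩ := exists_least_position w k
    refine ⟨i, (strandPeriod w i.1 : ℝ)⁻¹ * q, (strandPeriod w' i'.1 : ℝ)⁻¹ * φ 0, ?_⟩
    rw [mul_inv_cancel_left₀ (hd i).ne', mul_inv_cancel_left₀ (hd' i').ne']
    have := hk 0
    rw [closedFam, ← hq, ← closedStrand_add_int, zero_add] at this
    exact this
  exact OrientedLink.isotopic_of_ambient (K := closedBraid w) (L := closedBraid w') hh m1 m2

/-! ### Extension of linear homotopies of strands to ambient isotopies -/

/-- By `H` the displacement `u p` depends only on the point `f p` and is `c`-Lipschitz on the image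
of `f`. It extends to all of space at the cost of the factor `lipschitzExtensionConstant Space3`. -/
theorem exists_isAmbient_step {X : Type} {f u : X → Space3} {c : NNReal}
    (hc : lipschitzExtensionConstant Space3 * c < 1)
    (H : ∀ p q, ‖u p - u q‖ ≤ c * ‖f p - f q‖) :
    ∃ h : Space3 ≃ₜ Space3, IsAmbient h ∧ ∀ p, h (f p) = f p + u p := by
  classical
  let v : Space3 → Space3 := fun x => if hx : ∃ p, f p = x then u hx.choose else 0
  have hv : ∀ p, v (f p) = u p := by
    intro p
    have hx : ∃ q, f q = f p := ⟨p, rfl⟩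
    have h1 := H hx.choose p
    rw [hx.choose_spec, sub_self, norm_zero, mul_zero] at h1
    simp only [v, dif_pos hx]
    exact sub_eq_zero.1 (norm_le_zero_iff.1 h1)
  have hlip : LipschitzOnWith c v (Set.range f) := by
    refine LipschitzOnWith.of_dist_le_mul ?_
    rintro _ ⟨p, rfl⟩ _ ⟨q, rfl⟩
    rw [hv, hv, dist_eq_norm, dist_eq_norm]
    exact H p q
  obtain ⟨v', hv', heq⟩ := hlip.extend_finite_dimension
  obtain ⟨h, hh, hx⟩ := exists_isAmbient_of_lipschitz hv' hc
  exact ⟨h, hh, fun p => by rw [hx, ← heq ⟨p, rfl⟩, hv]⟩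

/-- The linear homotopy is cut into `N` equal steps. Relative to the curves at the stage `k / N`,
the displacement of one step has Lipschitz constant `C / N`, which beats the extension constant for
large `N`. -/
theorem exists_isAmbient_of_uniform {X : Type} {f g : X → Space3} {C : ℝ} (hC : 0 ≤ C)
    (H : ∀ p q, ∀ s ∈ Set.Icc (0 : ℝ) 1, ‖(g p - f p) - (g q - f q)‖ ≤
      C * ‖(1 - s) • (f p - f q) + s • (g p - g q)‖) :
    ∃ h : Space3 ≃ₜ Space3, IsAmbient h ∧ ∀ p, h (f p) = g p := by
  obtain ⟨N, hN⟩ := exists_nat_gt ((lipschitzExtensionConstant Space3 : ℝ) * C)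
  have hN0 : (0 : ℝ) < N := lt_of_le_of_lt (by positivity) hN
  have key : ∀ k : ℕ, k ≤ N → ∃ h : Space3 ≃ₜ Space3, IsAmbient h ∧
      ∀ p, h (f p) = f p + ((k : ℝ) / N) • (g p - f p) := by
    intro k
    induction k with
    | zero => exact fun _ => ⟨Homeomorph.refl _, isAmbient_refl, fun p => by simp⟩
    | succ k ih =>
      intro hk
      obtain ⟨h, hh, hf⟩ := ih (by omega)
      have hs : (k : ℝ) / N ∈ Set.Icc (0 : ℝ) 1 := by
        refine ⟨by positivity, ?_⟩
        rw [div_le_one hN0]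
        exact_mod_cast (by omega : k ≤ N)
      obtain ⟨h', hh', hf'⟩ := exists_isAmbient_step
        (f := fun p => f p + ((k : ℝ) / N) • (g p - f p)) (u := fun p => (1 / (N : ℝ)) • (g p - f p))
        (c := Real.toNNReal (C / N)) (by
          rw [← NNReal.coe_lt_coe]
          push_cast
          rw [Real.coe_toNNReal _ (by positivity), ← mul_div_assoc, div_lt_one hN0]
          exact hN) (by
          intro p q
          rw [← smul_sub, norm_smul]
          have h1 := H p q _ hs
          have h2 : f p + ((k : ℝ) / N) • (g p - f p) - (f q + ((k : ℝ) / N) • (g q - f q)) =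
            (1 - (k : ℝ) / N) • (f p - f q) + ((k : ℝ) / N) • (g p - g q) := by module
          rw [h2, Real.coe_toNNReal _ (by positivity), Real.norm_of_nonneg (by positivity), div_mul_eq_mul_div,
            div_mul_eq_mul_div, one_mul]
          gcongr)
      refine ⟨h.trans h', hh.trans hh', fun p => ?_⟩
      rw [Homeomorph.trans_apply, hf]
      rw [hf' p]
      push_cast
      module
  obtain ⟨h, hh, hf⟩ := key N le_rfl
  exact ⟨h, hh, fun p => by rw [hf, div_self hN0.ne']; module⟩

/-- `f j (t + 1) = f (π j) t`: the strand in position `j` continues in position `π j`. -/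
def Equivariant {α : Type} (π : Equiv.Perm ℕ) (f : ℕ → ℝ → α) : Prop :=
  ∀ j t, f j (t + 1) = f (π j) t

theorem Equivariant.add_int {α : Type} {π : Equiv.Perm ℕ} {f : ℕ → ℝ → α} (hf : Equivariant π f)
    (j : ℕ) (t : ℝ) (q : ℤ) : f j (t + q) = f ((π ^ q) j) t := by
  have key : ∀ (i : ℕ) (j : ℕ) (t : ℝ), f j (t + i) = f ((π ^ i) j) t := by
    intro i
    induction i with
    | zero => simp
    | succ i ih =>
      intro j t
      rw [Nat.cast_succ, ← add_assoc, hf, ih, ← Equiv.Perm.mul_apply, pow_succ]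
  obtain ⟨i, rfl | rfl⟩ := q.eq_nat_or_neg
  · exact_mod_cast key i j t
  · have := key i ((π ^ (-i : ℤ)) j) (t - i)
    rw [sub_add_cancel, ← Equiv.Perm.mul_apply, ← zpow_natCast, ← zpow_add, add_neg_cancel,
      zpow_zero] at this
    rw [this]
    push_cast
    rw [← sub_eq_add_neg]
    rfl

theorem mapsTo_zpow {n : ℕ} {π : Equiv.Perm ℕ} (hπ : Set.MapsTo π (Set.Icc 1 n) (Set.Icc 1 n))
    (q : ℤ) {j : ℕ} (hj : j ∈ Set.Icc 1 n) : (π ^ q) j ∈ Set.Icc 1 n := by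
  have key : ∀ (ρ : Equiv.Perm ℕ), Set.MapsTo ρ (Set.Icc 1 n) (Set.Icc 1 n) → ∀ (i : ℕ),
      (ρ ^ i) j ∈ Set.Icc 1 n := by
    intro ρ hρ i
    induction i with
    | zero => exact hj
    | succ i ih => rw [pow_succ']; exact hρ ih
  obtain ⟨i, rfl | rfl⟩ := q.eq_nat_or_neg
  · exact_mod_cast key π hπ i
  · have h2 : Set.MapsTo (π⁻¹ : Equiv.Perm ℕ) (Set.Icc 1 n) (Set.Icc 1 n) := by
      -- An injective self-map of a finite set is onto, so the inverse preserves the set too.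
      have hs : π '' Set.Icc 1 n = Set.Icc 1 n :=
        Set.eq_of_subset_of_ncard_le (Set.mapsTo_iff_image_subset.1 hπ)
          (Set.ncard_image_of_injective _ π.injective).ge (Set.finite_Icc 1 n)
      intro x hx
      rw [← hs] at hx
      obtain ⟨y, hy, rfl⟩ := hx
      simpa using hy
    have := key π⁻¹ h2 i
    rwa [inv_pow, ← zpow_natCast, ← zpow_neg] at this

-- This reduces the uniform bound of `exists_isAmbient_of_uniform` to local conditions, by
-- compactness of one turn. Away from collisions the bound follows from continuity. The only
-- collisions are those of a point with itself (`hinj`), and there `hloc` provides a functional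
-- along which both curves advance with positive speed, so that no convex combination of them
-- stalls.
open Filter Topology in
theorem exists_isAmbient_of_linear {n : ℕ} {π : Equiv.Perm ℕ}
    (hπ : Set.MapsTo π (Set.Icc 1 n) (Set.Icc 1 n)) {f g : ℕ → ℝ → Space3}
    (hf : Equivariant π f) (hg : Equivariant π g)
    (lf : ∀ j ∈ Set.Icc 1 n, LocallyLipschitz (f j))
    (lg : ∀ j ∈ Set.Icc 1 n, LocallyLipschitz (g j))
    (hinj : ∀ i ∈ Set.Icc 1 n, ∀ j ∈ Set.Icc 1 n, ∀ t u, ∀ s ∈ Set.Icc (0 : ℝ) 1,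
      (1 - s) • (f i t - f j u) + s • (g i t - g j u) = 0 → ∃ m : ℤ, u = t + m ∧ (π ^ m) j = i)
    (hloc : ∀ i ∈ Set.Icc 1 n, ∀ t₀ : ℝ, ∃ (ℓ : Space3 →L[ℝ] ℝ) (c : ℝ), 0 < c ∧
      ∀ᶠ p : ℝ × ℝ in 𝓝 (t₀, t₀), p.2 ≤ p.1 → c * (p.1 - p.2) ≤ ℓ (f i p.1 - f i p.2) ∧
        c * (p.1 - p.2) ≤ ℓ (g i p.1 - g i p.2)) :
    ∃ h : Space3 ≃ₜ Space3, IsAmbient h ∧ ∀ j ∈ Set.Icc 1 n, ∀ t, h (f j t) = g j t := by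
  let B : ℕ → ℕ → ℝ → ℝ × ℝ → Prop := fun i j C p => ∀ s ∈ Set.Icc (0 : ℝ) 1,
    ‖(g i p.1 - f i p.1) - (g j p.2 - f j p.2)‖ ≤
      C * ‖(1 - s) • (f i p.1 - f j p.2) + s • (g i p.1 - g j p.2)‖
  have hB : ∀ i j C C' p, C ≤ C' → B i j C p → B i j C' p := by
    intro i j C C' p hC h s hs
    exact (h s hs).trans (by gcongr)
  have diag : ∀ i ∈ Set.Icc 1 n, ∀ t₀ : ℝ, ∃ C, ∀ᶠ p in 𝓝 (t₀, t₀), B i i C p := by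
    intro i hi t₀
    obtain ⟨ℓ, c, hc, hev⟩ := hloc i hi t₀
    obtain ⟨K, U, hU, hK⟩ := lf i hi t₀
    obtain ⟨K', U', hU', hK'⟩ := lg i hi t₀
    refine ⟨(K' + K) * ‖ℓ‖ / c, ?_⟩
    have hsw : ∀ᶠ p : ℝ × ℝ in 𝓝 (t₀, t₀), p.1 ≤ p.2 → c * (p.2 - p.1) ≤ ℓ (f i p.2 - f i p.1) ∧
        c * (p.2 - p.1) ≤ ℓ (g i p.2 - g i p.1) := by
      have : Tendsto Prod.swap (𝓝 (t₀, t₀)) (𝓝 (t₀, t₀)) := continuous_swap.tendsto (t₀, t₀)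
      exact this.eventually hev
    filter_upwards [hev, hsw, prod_mem_nhds (inter_mem hU hU') (inter_mem hU hU')]
      with p h1 h2 h3 s hs
    have n1 : ‖(g i p.1 - f i p.1) - (g i p.2 - f i p.2)‖ ≤ (K' + K) * |p.1 - p.2| := by
      have e1 := hK.dist_le_mul p.1 h3.1.1 p.2 h3.2.1
      have e2 := hK'.dist_le_mul p.1 h3.1.2 p.2 h3.2.2
      rw [dist_eq_norm, dist_eq_norm, Real.norm_eq_abs] at e1 e2
      have : (g i p.1 - f i p.1) - (g i p.2 - f i p.2) =
        (g i p.1 - g i p.2) - (f i p.1 - f i p.2) := by abel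
      rw [this, add_mul]
      exact (norm_sub_le _ _).trans (add_le_add e2 e1)
    -- The functional bounds the interpolated difference from below, since both of its terms advance
    -- in the same direction.
    have n2 : c * |p.1 - p.2| ≤
        ‖ℓ‖ * ‖(1 - s) • (f i p.1 - f i p.2) + s • (g i p.1 - g i p.2)‖ := by
      refine le_trans ?_ (ℓ.le_opNorm _)
      have s0 := hs.1
      have s1 : 0 ≤ 1 - s := by linarith [hs.2]
      rcases le_total p.2 p.1 with h | h
      · obtain ⟨a, b⟩ := h1 h
        rw [abs_of_nonneg (by linarith), map_add, map_smul, map_smul, smul_eq_mul, smul_eq_mul]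
        refine le_trans ?_ (le_abs_self _)
        nlinarith
      · obtain ⟨a, b⟩ := h2 h
        rw [abs_of_nonpos (by linarith), ← norm_neg, ← map_neg]
        have : -((1 - s) • (f i p.1 - f i p.2) + s • (g i p.1 - g i p.2)) =
          (1 - s) • (f i p.2 - f i p.1) + s • (g i p.2 - g i p.1) := by module
        rw [this, map_add, map_smul, map_smul, smul_eq_mul, smul_eq_mul]
        refine le_trans ?_ (le_abs_self _)
        nlinarith
    refine n1.trans ?_
    rw [mul_div_assoc, div_eq_inv_mul, mul_assoc, mul_assoc]
    gcongr
    rw [← div_eq_inv_mul, le_div_iff₀ hc, mul_comm]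
    exact n2
  have loc : ∀ i ∈ Set.Icc 1 n, ∀ j ∈ Set.Icc 1 n, ∀ t₀ u₀ : ℝ,
      ∃ C, ∀ᶠ p in 𝓝 (t₀, u₀), B i j C p := by
    intro i hi j hj t₀ u₀
    by_cases hcol : ∃ s ∈ Set.Icc (0 : ℝ) 1,
      (1 - s) • (f i t₀ - f j u₀) + s • (g i t₀ - g j u₀) = 0
    -- A point meets only itself, seen `m` turns later from another position; a shift by `m` leads
    -- back to the diagonal.
    · obtain ⟨s, hs, h0⟩ := hcol
      obtain ⟨m, rfl, hm⟩ := hinj i hi j hj t₀ u₀ s hs h0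
      obtain ⟨C, hC⟩ := diag i hi t₀
      refine ⟨C, ?_⟩
      have hT : Tendsto (fun p : ℝ × ℝ => (p.1, p.2 - (m : ℝ))) (𝓝 (t₀, t₀ + m)) (𝓝 (t₀, t₀)) := by
        have : Continuous (fun p : ℝ × ℝ => (p.1, p.2 - (m : ℝ))) := by fun_prop
        have := this.tendsto (t₀, t₀ + m)
        simpa using this
      filter_upwards [hT.eventually hC] with p hp s hs
      have := hp s hs
      have e1 := hf.add_int j (p.2 - m) m
      have e2 := hg.add_int j (p.2 - m) m
      rw [sub_add_cancel, hm] at e1 e2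
      rw [e1, e2]
      exact this
    · push Not at hcol
      have cf := (lf i hi).continuous
      have cg := (lg i hi).continuous
      have cf' := (lf j hj).continuous
      have cg' := (lg j hj).continuous
      have hD : Continuous fun s : ℝ => ‖(1 - s) • (f i t₀ - f j u₀) + s • (g i t₀ - g j u₀)‖ := by
        fun_prop
      -- The distance has a positive minimum `ε` over all stages, and nearby times lose at most half
      -- of it.
      obtain ⟨s₀, hs₀, hmin⟩ := isCompact_Icc.exists_isMinOn
        (Set.nonempty_Icc.2 (zero_le_one (α := ℝ))) hD.continuousOn
      have hε := norm_pos_iff.2 (hcol s₀ hs₀)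
      set ε := ‖(1 - s₀) • (f i t₀ - f j u₀) + s₀ • (g i t₀ - g j u₀)‖ with hεdef
      let R : ℝ × ℝ → ℝ := fun p => ‖f i p.1 - f i t₀‖ + ‖f j p.2 - f j u₀‖ +
        ‖g i p.1 - g i t₀‖ + ‖g j p.2 - g j u₀‖
      have hR : Continuous R := by fun_prop
      let S : ℝ × ℝ → ℝ := fun p => ‖(g i p.1 - f i p.1) - (g j p.2 - f j p.2)‖
      have hS : Continuous S := by fun_prop
      have ev1 : ∀ᶠ p in 𝓝 (t₀, u₀), R p < ε / 2 := by
        refine hR.continuousAt.eventually_lt_const ?_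
        simp only [R, sub_self, norm_zero]
        linarith
      have ev2 : ∀ᶠ p in 𝓝 (t₀, u₀), S p < S (t₀, u₀) + 1 :=
        hS.continuousAt.eventually_lt_const (by linarith)
      refine ⟨(S (t₀, u₀) + 1) / (ε / 2), ?_⟩
      filter_upwards [ev1, ev2] with p h1 h2 s hs
      have h3 : ε ≤ ‖(1 - s) • (f i t₀ - f j u₀) + s • (g i t₀ - g j u₀)‖ := hmin hs
      have s0 := hs.1
      have s1 : 0 ≤ 1 - s := by linarith [hs.2]
      have h4 : ‖(1 - s) • (f i t₀ - f j u₀) + s • (g i t₀ - g j u₀)‖ ≤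
          ‖(1 - s) • (f i p.1 - f j p.2) + s • (g i p.1 - g j p.2)‖ + R p := by
        have e : (1 - s) • (f i t₀ - f j u₀) + s • (g i t₀ - g j u₀) =
          ((1 - s) • (f i p.1 - f j p.2) + s • (g i p.1 - g j p.2)) -
          (((1 - s) • (f i p.1 - f i t₀) - (1 - s) • (f j p.2 - f j u₀)) +
            (s • (g i p.1 - g i t₀) - s • (g j p.2 - g j u₀))) := by module
        rw [e]
        refine (norm_sub_le _ _).trans (add_le_add le_rfl ?_)
        refine (norm_add_le _ _).trans ?_
        have a1 : ‖(1 - s) • (f i p.1 - f i t₀) - (1 - s) • (f j p.2 - f j u₀)‖ ≤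
            ‖f i p.1 - f i t₀‖ + ‖f j p.2 - f j u₀‖ := by
          rw [← smul_sub, norm_smul, Real.norm_of_nonneg s1]
          refine le_trans ?_ (norm_sub_le _ _)
          exact mul_le_of_le_one_left (norm_nonneg _) (by linarith)
        have a2 : ‖s • (g i p.1 - g i t₀) - s • (g j p.2 - g j u₀)‖ ≤
            ‖g i p.1 - g i t₀‖ + ‖g j p.2 - g j u₀‖ := by
          rw [← smul_sub, norm_smul, Real.norm_of_nonneg s0]
          refine le_trans ?_ (norm_sub_le _ _)
          exact mul_le_of_le_one_left (norm_nonneg _) hs.2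
        simp only [R]
        linarith
      have h5 : ε / 2 ≤ ‖(1 - s) • (f i p.1 - f j p.2) + s • (g i p.1 - g j p.2)‖ := by linarith
      refine h2.le.trans ?_
      rw [div_mul_eq_mul_div, le_div_iff₀ (by linarith)]
      have : 0 ≤ S (t₀, u₀) := norm_nonneg _
      gcongr
  have unif : ∀ i j : ℕ, ∃ C : ℝ, 0 ≤ C ∧ (i ∈ Set.Icc 1 n → j ∈ Set.Icc 1 n →
      ∀ p ∈ Set.Icc (0 : ℝ) 1 ×ˢ Set.Icc (0 : ℝ) 1, B i j C p) := by
    intro i j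
    by_cases hij : i ∈ Set.Icc 1 n ∧ j ∈ Set.Icc 1 n
    swap
    · exact ⟨0, le_rfl, fun hi hj => absurd ⟨hi, hj⟩ hij⟩
    obtain ⟨C, h0, hC⟩ : ∃ C : ℝ, 0 ≤ C ∧
        ∀ p ∈ Set.Icc (0 : ℝ) 1 ×ˢ Set.Icc (0 : ℝ) 1, B i j C p := by
      refine (isCompact_Icc.prod isCompact_Icc).induction_on
        (p := fun s : Set (ℝ × ℝ) => ∃ C : ℝ, 0 ≤ C ∧ ∀ p ∈ s, B i j C p) ?_ ?_ ?_ ?_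
      · exact ⟨0, le_rfl, by simp⟩
      · rintro s t hst ⟨C, h0, hC⟩
        exact ⟨C, h0, fun p hp => hC p (hst hp)⟩
      · rintro s t ⟨C, h0, hC⟩ ⟨C', h0', hC'⟩
        refine ⟨max C C', h0.trans (le_max_left _ _), fun p hp => ?_⟩
        rcases hp with hp | hp
        · exact hB _ _ _ _ _ (le_max_left _ _) (hC p hp)
        · exact hB _ _ _ _ _ (le_max_right _ _) (hC' p hp)
      · rintro ⟨t, u⟩ -
        obtain ⟨C, hC⟩ := loc i hij.1 j hij.2 t u
        exact ⟨_, mem_nhdsWithin_of_mem_nhds hC, max C 0, le_max_right _ _,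
          fun p hp => hB _ _ _ _ _ (le_max_left _ _) hp⟩
    exact ⟨C, h0, fun _ _ => hC⟩
  choose C hC0 hC using unif
  let T : ℝ := ∑ i ∈ Finset.Icc 1 n, ∑ j ∈ Finset.Icc 1 n, C i j
  have hT : ∀ i ∈ Set.Icc 1 n, ∀ j ∈ Set.Icc 1 n, C i j ≤ T := by
    intro i hi j hj
    refine le_trans ?_ (Finset.single_le_sum (f := fun i => ∑ j ∈ Finset.Icc 1 n, C i j)
      (fun i _ => Finset.sum_nonneg fun j _ => hC0 i j) (Finset.mem_Icc.2 hi))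
    exact Finset.single_le_sum (f := fun j => C i j) (fun j _ => hC0 i j) (Finset.mem_Icc.2 hj)
  have hT0 : 0 ≤ T := Finset.sum_nonneg fun i _ => Finset.sum_nonneg fun j _ => hC0 i j
  obtain ⟨h, hh, heq⟩ := exists_isAmbient_of_uniform (X := Set.Icc 1 n × ℝ)
    (f := fun p => f p.1 p.2) (g := fun p => g p.1 p.2) hT0 (by
      -- Equivariance moves both times into one turn, where the bound is known.
      rintro ⟨i, t⟩ ⟨j, u⟩ s hs
      have hi := mapsTo_zpow hπ ⌊t⌋ i.2
      have hj := mapsTo_zpow hπ ⌊u⌋ j.2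
      have := hB _ _ _ _ _ (hT _ hi _ hj) (hC _ _ hi hj (Int.fract t, Int.fract u)
        ⟨⟨Int.fract_nonneg t, (Int.fract_lt_one t).le⟩,
          ⟨Int.fract_nonneg u, (Int.fract_lt_one u).le⟩⟩) s hs
      simp only [← hf.add_int, ← hg.add_int, Int.fract_add_floor] at this
      exact this)
  exact ⟨h, hh, fun j hj t => heq (⟨j, hj⟩, t)⟩

/-! ### Locally Lipschitz functions -/

open Filter Topology in
theorem LocallyLipschitz.if_le {E : Type} [PseudoMetricSpace E] {f g : ℝ → E}
    (hf : LocallyLipschitz f) (hg : LocallyLipschitz g) {a : ℝ} (h : f a = g a) :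
    LocallyLipschitz fun t => if t ≤ a then f t else g t := by
  intro x
  obtain ⟨K, U, hU, hK⟩ := hf x
  obtain ⟨K', U', hU', hK'⟩ := hg x
  obtain ⟨ε, hε, hb⟩ := Metric.mem_nhds_iff.1 (inter_mem hU hU')
  refine ⟨max K K', Metric.ball x ε, Metric.ball_mem_nhds x hε, LipschitzOnWith.of_dist_le_mul ?_⟩
  have k1 : (K : ℝ) ≤ (max K K' : NNReal) := by exact_mod_cast le_max_left _ _
  have k2 : (K' : ℝ) ≤ (max K K' : NNReal) := by exact_mod_cast le_max_right _ _
  -- Points on different sides of `a` are compared through `a`, where the branches agree.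
  have cross : ∀ t ∈ Metric.ball x ε, ∀ u ∈ Metric.ball x ε, t ≤ a → a < u →
      dist (f t) (g u) ≤ (max K K' : NNReal) * dist t u := by
    intro t ht u hu hta hau
    have ha : a ∈ Metric.ball x ε := by
      rw [Real.ball_eq_Ioo] at *
      exact ⟨ht.1.trans_le hta, hau.trans hu.2⟩
    have e1 := hK.dist_le_mul t (hb ht).1 a (hb ha).1
    have e2 := hK'.dist_le_mul a (hb ha).2 u (hb hu).2
    rw [Real.dist_eq, abs_of_nonpos (by linarith)] at *
    have := dist_triangle (f t) (g a) (g u)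
    rw [h] at e1
    nlinarith
  intro t ht u hu
  by_cases h1 : t ≤ a <;> by_cases h2 : u ≤ a
  · simp only [h1, h2, if_true]
    exact (hK.dist_le_mul t (hb ht).1 u (hb hu).1).trans (by gcongr)
  · simp only [h1, h2, if_true, if_false]
    exact cross t ht u hu h1 (not_le.1 h2)
  · simp only [h1, h2, if_true, if_false]
    rw [dist_comm, dist_comm t]
    exact cross u hu t ht h2 (not_le.1 h1)
  · simp only [h1, h2, if_false]
    exact (hK'.dist_le_mul t (hb ht).2 u (hb hu).2).trans (by gcongr)

theorem LocallyLipschitz.congr_of_eventuallyEq {E : Type} [PseudoMetricSpace E] {f : ℝ → E}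
    (h : ∀ x, ∃ g : ℝ → E, LocallyLipschitz g ∧ f =ᶠ[nhds x] g) : LocallyLipschitz f := by
  intro x
  obtain ⟨g, hg, he⟩ := h x
  obtain ⟨K, U, hU, hK⟩ := hg x
  refine ⟨K, U ∩ {y | f y = g y}, Filter.inter_mem hU he, fun y hy z hz => ?_⟩
  rw [hy.2, hz.2]
  exact hK hy.1 hz.1

theorem LocallyLipschitz.real_mul {f g : ℝ → ℝ} (hf : LocallyLipschitz f)
    (hg : LocallyLipschitz g) : LocallyLipschitz fun t => f t * g t := by
  have : LocallyLipschitz fun p : ℝ × ℝ => p.1 * p.2 :=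
    ContDiff.locallyLipschitz (𝕂 := ℝ) (by fun_prop)
  exact this.comp (hf.prodMk hg)

theorem LocallyLipschitz.real_min {f g : ℝ → ℝ} (hf : LocallyLipschitz f)
    (hg : LocallyLipschitz g) : LocallyLipschitz fun t => min (f t) (g t) :=
  lipschitzWith_min.locallyLipschitz.comp (hf.prodMk hg)

theorem contDiff_cylPoint : ContDiff ℝ 1 fun q : (ℝ × ℝ) × ℝ => cylPoint q.1 q.2 := by
  have h1 : ContDiff ℝ 1 fun q : (ℝ × ℝ) × ℝ => ((q.1.1 : ℝ) : ℂ) :=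
    Complex.ofRealCLM.contDiff.comp (contDiff_fst.comp contDiff_fst)
  have h2 : ContDiff ℝ 1 fun q : (ℝ × ℝ) × ℝ => 2 * (Real.pi : ℂ) * ((q.2 : ℝ) : ℂ) * Complex.I :=
    ((contDiff_const (c := 2 * (Real.pi : ℂ))).mul
      (Complex.ofRealCLM.contDiff.comp contDiff_snd)).mul contDiff_const
  have h3 : ContDiff ℝ 1 fun q : (ℝ × ℝ) × ℝ => q.1.2 := contDiff_snd.comp contDiff_fst
  exact (h1.mul h2.cexp).prodMk h3

theorem locallyLipschitz_cylPoint_uncurry :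
    LocallyLipschitz fun q : (ℝ × ℝ) × ℝ => cylPoint q.1 q.2 :=
  contDiff_cylPoint.locallyLipschitz (𝕂 := ℝ)

theorem locallyLipschitz_prodMk {p : ℝ → ℝ × ℝ} {θ : ℝ → ℝ} (hp : LocallyLipschitz p)
    (hθ : LocallyLipschitz θ) : LocallyLipschitz fun t => (p t, θ t) := hp.prodMk hθ

theorem locallyLipschitz_cylPoint {p : ℝ → ℝ × ℝ} {θ : ℝ → ℝ} (hp : LocallyLipschitz p)
    (hθ : LocallyLipschitz θ) : LocallyLipschitz fun t => cylPoint (p t) (θ t) := by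
  have h6 := locallyLipschitz_prodMk hp hθ
  have h7 := locallyLipschitz_cylPoint_uncurry.comp h6
  exact h7

/-! ### Unrolled motions -/

/-- The motion `p`, `0 ≤ t ≤ 1`, repeated for ever, where `π` is the permutation it causes. -/
def unroll {α : Type} (π : Equiv.Perm ℕ) (p : ℝ → ℕ → α) (j : ℕ) (t : ℝ) : α :=
  p (Int.fract t) ((π ^ ⌊t⌋) j)

theorem equivariant_unroll {α : Type} (π : Equiv.Perm ℕ) (p : ℝ → ℕ → α) :
    Equivariant π (unroll π p) := by
  intro j t
  simp only [unroll, Int.fract_add_one, Int.floor_add_one, zpow_add_one, Equiv.Perm.mul_apply]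

/-- The closing condition `hp` makes the formula valid at the right end `t = k + 1` as well. -/
theorem unroll_of_mem {α : Type} {n : ℕ} {π : Equiv.Perm ℕ}
    (hπ : Set.MapsTo π (Set.Icc 1 n) (Set.Icc 1 n)) {p : ℝ → ℕ → α}
    (hp : ∀ j ∈ Set.Icc 1 n, p 1 j = p 0 (π j)) {j : ℕ} (hj : j ∈ Set.Icc 1 n) {t : ℝ} {k : ℤ}
    (h1 : (k : ℝ) ≤ t) (h2 : t ≤ k + 1) : unroll π p j t = p (t - k) ((π ^ k) j) := by
  rcases h2.lt_or_eq with h2 | rfl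
  · have : ⌊t⌋ = k := Int.floor_eq_iff.2 ⟨h1, h2⟩
    simp only [unroll, Int.fract, this]
  · rw [equivariant_unroll, unroll, Int.fract_intCast, Int.floor_intCast, add_sub_cancel_left,
      hp _ (mapsTo_zpow hπ k hj), ← Equiv.Perm.mul_apply, ← Equiv.Perm.mul_apply, ← zpow_add_one,
      ← zpow_one_add, add_comm]

/-- Around any time only two pieces, glued at one integer, are visible. Continuity and the local
Lipschitz property of `unroll` follow from those of the pieces. -/
theorem unroll_eq_ite {α : Type} {n : ℕ} {π : Equiv.Perm ℕ}
    (hπ : Set.MapsTo π (Set.Icc 1 n) (Set.Icc 1 n)) {p : ℝ → ℕ → α}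
    (hp : ∀ j ∈ Set.Icc 1 n, p 1 j = p 0 (π j)) {j : ℕ} (hj : j ∈ Set.Icc 1 n) {t : ℝ} {k : ℤ}
    (h1 : (k : ℝ) - 1 < t) (h2 : t < k + 1) : unroll π p j t =
      if t ≤ k then p (t - (k - 1)) ((π ^ (k - 1)) j) else p (t - k) ((π ^ k) j) := by
  split_ifs with h
  · have := unroll_of_mem hπ hp hj (t := t) (k := k - 1) (by push_cast; linarith)
      (by push_cast; linarith)
    rw [this]
    push_cast
    rfl
  · exact unroll_of_mem hπ hp hj (not_le.1 h).le h2.le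

theorem eventually_unroll_eq_ite {α : Type} {n : ℕ} {π : Equiv.Perm ℕ}
    (hπ : Set.MapsTo π (Set.Icc 1 n) (Set.Icc 1 n)) {p : ℝ → ℕ → α}
    (hp : ∀ j ∈ Set.Icc 1 n, p 1 j = p 0 (π j)) {j : ℕ} (hj : j ∈ Set.Icc 1 n) (t₀ : ℝ) :
    ∀ᶠ t in nhds t₀, unroll π p j t = if t ≤ (⌊t₀⌋ : ℤ) then
      p (t - (⌊t₀⌋ - 1)) ((π ^ (⌊t₀⌋ - 1)) j) else p (t - ⌊t₀⌋) ((π ^ ⌊t₀⌋) j) := by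
  filter_upwards [Ioo_mem_nhds (show (⌊t₀⌋ : ℝ) - 1 < t₀ by linarith [Int.floor_le t₀])
    (Int.lt_floor_add_one t₀)] with t ht
  exact unroll_eq_ite hπ hp hj ht.1 ht.2

theorem closing_zpow {α : Type} {n : ℕ} {π : Equiv.Perm ℕ}
    (hπ : Set.MapsTo π (Set.Icc 1 n) (Set.Icc 1 n)) {p : ℝ → ℕ → α}
    (hp : ∀ j ∈ Set.Icc 1 n, p 1 j = p 0 (π j)) {j : ℕ} (hj : j ∈ Set.Icc 1 n) (k : ℤ) :
    p 1 ((π ^ (k - 1)) j) = p 0 ((π ^ k) j) := by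
  rw [hp _ (mapsTo_zpow hπ _ hj), ← Equiv.Perm.mul_apply, ← zpow_one_add, add_sub_cancel]

theorem locallyLipschitz_sub_const (a : ℝ) : LocallyLipschitz fun t : ℝ => t - a :=
  ContDiff.locallyLipschitz (𝕂 := ℝ) (by fun_prop)

theorem locallyLipschitz_unroll {E : Type} [PseudoMetricSpace E] {n : ℕ} {π : Equiv.Perm ℕ}
    (hπ : Set.MapsTo π (Set.Icc 1 n) (Set.Icc 1 n)) {p : ℝ → ℕ → E}
    (hp : ∀ j ∈ Set.Icc 1 n, p 1 j = p 0 (π j))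
    (lp : ∀ j ∈ Set.Icc 1 n, LocallyLipschitz fun t => p t j) {j : ℕ} (hj : j ∈ Set.Icc 1 n) :
    LocallyLipschitz (unroll π p j) := by
  refine LocallyLipschitz.congr_of_eventuallyEq fun t₀ => ⟨_, ?_,
    eventually_unroll_eq_ite hπ hp hj t₀⟩
  refine LocallyLipschitz.if_le
    ((lp _ (mapsTo_zpow hπ (⌊t₀⌋ - 1) hj)).comp (locallyLipschitz_sub_const _))
    ((lp _ (mapsTo_zpow hπ ⌊t₀⌋ hj)).comp (locallyLipschitz_sub_const _)) ?_
  simp [closing_zpow hπ hp hj]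

theorem continuous_unroll {X E : Type} [TopologicalSpace X] [TopologicalSpace E] {n : ℕ}
    {π : Equiv.Perm ℕ}
    (hπ : Set.MapsTo π (Set.Icc 1 n) (Set.Icc 1 n)) {p : X → ℝ → ℕ → E}
    (hp : ∀ x, ∀ j ∈ Set.Icc 1 n, p x 1 j = p x 0 (π j))
    (cp : ∀ j ∈ Set.Icc 1 n, Continuous fun q : X × ℝ => p q.1 q.2 j) {j : ℕ}
    (hj : j ∈ Set.Icc 1 n) : Continuous fun q : X × ℝ => unroll π (p q.1) j q.2 := by
  rw [continuous_iff_continuousAt]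
  rintro ⟨x₀, t₀⟩
  have hev : ∀ᶠ q : X × ℝ in nhds (x₀, t₀), q.2 ∈ Set.Ioo ((⌊t₀⌋ : ℝ) - 1) (⌊t₀⌋ + 1) :=
    continuous_snd.continuousAt.eventually (Ioo_mem_nhds
      (show (⌊t₀⌋ : ℝ) - 1 < t₀ by linarith [Int.floor_le t₀]) (Int.lt_floor_add_one t₀))
  refine ContinuousAt.congr (f := fun q : X × ℝ => if q.2 ≤ (⌊t₀⌋ : ℤ) then
      p q.1 (q.2 - (⌊t₀⌋ - 1)) ((π ^ (⌊t₀⌋ - 1)) j) else p q.1 (q.2 - ⌊t₀⌋) ((π ^ ⌊t₀⌋) j)) ?_ ?_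
  · refine Continuous.continuousAt (Continuous.if_le ?_ ?_ continuous_snd continuous_const ?_)
    · exact (cp _ (mapsTo_zpow hπ (⌊t₀⌋ - 1) hj)).comp
        (continuous_fst.prodMk (continuous_snd.sub continuous_const))
    · exact (cp _ (mapsTo_zpow hπ ⌊t₀⌋ hj)).comp
        (continuous_fst.prodMk (continuous_snd.sub continuous_const))
    · rintro ⟨x, t⟩ (rfl : t = _)
      simp [closing_zpow hπ (hp x) hj]
  · filter_upwards [hev] with q hq
    exact (unroll_eq_ite hπ (hp q.1) hj hq.1 hq.2).symm

/-! ### Linear homotopies of closed braids -/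

theorem cylPoint_eq {p q : ℝ × ℝ} (hp : 0 < p.1) (hq : 0 < q.1) {t u : ℝ}
    (h : cylPoint p t = cylPoint q u) : p = q ∧ ∃ m : ℤ, u = t + m := by
  simp only [cylPoint, Prod.mk.injEq] at h
  obtain ⟨h1, h2⟩ := h
  have e1 : ∀ x : ℝ, ‖Complex.exp (2 * Real.pi * x * Complex.I)‖ = 1 := fun x => by
    have := Complex.norm_exp_ofReal_mul_I (2 * Real.pi * x)
    push_cast at this
    exact this
  have hr : p.1 = q.1 := by
    have := congrArg norm h1
    rwa [norm_mul, norm_mul, e1, e1, mul_one, mul_one, Complex.norm_real, Complex.norm_real,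
      Real.norm_of_nonneg hp.le, Real.norm_of_nonneg hq.le] at this
  refine ⟨Prod.ext hr h2, ?_⟩
  rw [hr] at h1
  have h3 := mul_left_cancel₀ (Complex.ofReal_ne_zero.2 hq.ne') h1
  obtain ⟨m, hm⟩ := Complex.exp_eq_exp_iff_exists_int.1 h3.symm
  refine ⟨m, ?_⟩
  have h4 : (u : ℂ) = t + m := by
    apply mul_left_cancel₀ Complex.two_pi_I_ne_zero
    linear_combination hm
  exact_mod_cast h4

/-- For a fixed angle `cylPoint` is linear in the point of the half-plane, so a linear homotopy in
space that keeps angles is one in the half-plane. -/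
theorem cylPoint_linear (p q p' q' : ℝ × ℝ) (s t u : ℝ) :
    (1 - s) • (cylPoint p t - cylPoint q u) + s • (cylPoint p' t - cylPoint q' u) =
      cylPoint ((1 - s) • p + s • p') t - cylPoint ((1 - s) • q + s • q') u := by
  ext1
  · simp [cylPoint]
    ring
  · simp [cylPoint]
    ring

/-- The tangential coordinate at the angle `2πθ`. -/
def tangentForm (θ : ℝ) : Space3 →L[ℝ] ℝ :=
  (Complex.imCLM.comp (ContinuousLinearMap.mul ℝ ℂ
    (Complex.exp (-(2 * Real.pi * θ * Complex.I))))).comp (ContinuousLinearMap.fst ℝ ℂ ℝ)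

theorem tangentForm_cylPoint (θ : ℝ) (p : ℝ × ℝ) (t : ℝ) :
    tangentForm θ (cylPoint p t) = p.1 * Real.sin (2 * Real.pi * (t - θ)) := by
  have : Complex.exp (-(2 * Real.pi * θ * Complex.I)) * ((p.1 : ℂ) *
      Complex.exp (2 * Real.pi * t * Complex.I)) =
      p.1 * Complex.exp ((2 * Real.pi * (t - θ) : ℝ) * Complex.I) := by
    rw [mul_left_comm, ← Complex.exp_add]
    congr 2
    push_cast
    ring
  simp only [tangentForm, cylPoint, ContinuousLinearMap.comp_apply, ContinuousLinearMap.coe_fst',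
    ContinuousLinearMap.mul_apply', this, Complex.imCLM_apply, Complex.im_ofReal_mul,
    Complex.exp_ofReal_mul_I_im]

theorem half_sub_le_sin_sub {a b : ℝ} (ha : |a| ≤ 1) (hb : |b| ≤ 1) (h : b ≤ a) :
    (a - b) / 2 ≤ Real.sin a - Real.sin b := by
  have hm : MonotoneOn (fun x => Real.sin x - x / 2) (Set.Icc (-1) 1) := by
    -- The derivative `cos x - 1/2` is nonnegative on `[-1, 1]` because `cos x ≥ 1 - x²/2`.
    refine monotoneOn_of_deriv_nonneg (convex_Icc _ _) (by fun_prop) (by fun_prop) fun x hx => ?_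
    rw [interior_Icc] at hx
    have hd : deriv (fun x => Real.sin x - x / 2) x = Real.cos x - 1 / 2 := by
      have := (Real.hasDerivAt_sin x).sub ((hasDerivAt_id x).div_const 2)
      exact this.deriv
    rw [hd]
    have := Real.one_sub_sq_div_two_le_cos (x := x)
    nlinarith [hx.1, hx.2]
  have := hm (abs_le.1 hb) (abs_le.1 ha) h
  simp only at this
  linarith

open Filter Topology in
/-- A curve that turns forwards around the axis advances in the tangential direction. -/
theorem eventually_tangentForm {p : ℝ → ℝ × ℝ} {θ : ℝ → ℝ} {t₀ φ : ℝ} {k : ℤ}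
    (hp : LocallyLipschitz p) (hθ : ContinuousAt θ t₀) (hpos : 0 < (p t₀).1)
    (hφ : θ t₀ = φ + k)
    (hinc : ∀ᶠ q : ℝ × ℝ in 𝓝 (t₀, t₀), q.2 ≤ q.1 → q.1 - q.2 ≤ θ q.1 - θ q.2) :
    ∃ c : ℝ, 0 < c ∧ ∀ᶠ q : ℝ × ℝ in 𝓝 (t₀, t₀), q.2 ≤ q.1 → c * (q.1 - q.2) ≤
      tangentForm φ (cylPoint (p q.1) (θ q.1) - cylPoint (p q.2) (θ q.2)) := by
  set R := (p t₀).1 with hR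
  -- The sines differ by at least `3 * (q.1 - q.2)`, as `2π > 6`, and nearby radii exceed `R / 2`: a
  -- gain of `3R/2` per unit of time. The variation of the radius costs at most `R / 2`, by the
  -- bound `R / (2 * (K + 1))` imposed on the angle.
  refine ⟨R, hpos, ?_⟩
  obtain ⟨K, U, hU, hK⟩ := hp t₀
  have hc1 : ContinuousAt (fun t => (p t).1) t₀ := hp.continuous.fst.continuousAt
  have hsin : ∀ t, Real.sin (2 * Real.pi * (θ t - φ)) =
      Real.sin (2 * Real.pi * (θ t - θ t₀)) := by
    intro t
    have : 2 * Real.pi * (θ t - φ) = 2 * Real.pi * (θ t - θ t₀) + k * (2 * Real.pi) := by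
      rw [hφ]; ring
    rw [this, Real.sin_add_int_mul_two_pi]
  have hb : ContinuousAt (fun t => |2 * Real.pi * (θ t - θ t₀)|) t₀ :=
    (continuousAt_const.mul (hθ.sub continuousAt_const)).abs
  have e1 : ∀ᶠ t in 𝓝 t₀, R / 2 < (p t).1 := hc1.eventually_const_lt (by linarith)
  have e2 : ∀ᶠ t in 𝓝 t₀, |2 * Real.pi * (θ t - θ t₀)| < 1 := hb.eventually_lt_const (by simp)
  have e3 : ∀ᶠ t in 𝓝 t₀, |2 * Real.pi * (θ t - θ t₀)| < R / (2 * (K + 1)) :=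
    hb.eventually_lt_const (by simp; positivity)
  have E := (e1.and (e2.and (e3.and (show ∀ᶠ t in 𝓝 t₀, t ∈ U from hU))))
  filter_upwards [hinc, E.prod_nhds E] with q h1 ⟨⟨a1, a2, a3, a4⟩, ⟨b1, b2, b3, b4⟩⟩ hq
  have h2 := h1 hq
  rw [map_sub, tangentForm_cylPoint, tangentForm_cylPoint, hsin, hsin]
  set a := 2 * Real.pi * (θ q.1 - θ t₀)
  set b := 2 * Real.pi * (θ q.2 - θ t₀)
  have hab : 6 * (q.1 - q.2) ≤ a - b := by
    have : a - b = 2 * Real.pi * (θ q.1 - θ q.2) := by simp only [a, b]; ring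
    rw [this]
    have := Real.pi_gt_three
    nlinarith
  have h3 := half_sub_le_sin_sub a2.le b2.le (by linarith)
  have h4 : |(p q.1).1 - (p q.2).1| ≤ K * (q.1 - q.2) := by
    have := hK.dist_le_mul _ a4 _ b4
    rw [Real.dist_eq, abs_of_nonneg (by linarith)] at this
    refine le_trans ?_ this
    rw [← Real.dist_eq, Prod.dist_eq]
    exact le_max_left _ _
  have h5 : |Real.sin b| ≤ R / (2 * (K + 1)) := Real.abs_sin_le_abs.trans b3.le
  have h6 : |((p q.1).1 - (p q.2).1) * Real.sin b| ≤ R / 2 * (q.1 - q.2) := by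
    rw [abs_mul]
    calc _ ≤ (K * (q.1 - q.2)) * (R / (2 * (K + 1))) := by gcongr
      _ = K / (K + 1) * (R / 2 * (q.1 - q.2)) := by field_simp
      _ ≤ 1 * (R / 2 * (q.1 - q.2)) := by
        have : (K : ℝ) / (K + 1) ≤ 1 := by rw [div_le_one (by positivity)]; linarith
        have h7 : 0 ≤ q.1 - q.2 := by linarith
        gcongr
      _ = _ := one_mul _
  have h7 := neg_le_of_abs_le h6
  have h8 : (p q.1).1 * Real.sin a - (p q.2).1 * Real.sin b =
    (p q.1).1 * (Real.sin a - Real.sin b) + ((p q.1).1 - (p q.2).1) * Real.sin b := by ring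
  rw [h8]
  have h9 : R / 2 * (3 * (q.1 - q.2)) ≤ (p q.1).1 * (Real.sin a - Real.sin b) :=
    mul_le_mul a1.le (by linarith) (by linarith) (by linarith)
  linarith

/-- All strands turn with the same angular speed, so two of them can only meet in a common
half-plane; distinct positions at each time suffice. The direction in which every strand advances is
the tangential one. -/
theorem exists_isAmbient_braid_linear {n : ℕ} {π : Equiv.Perm ℕ}
    (hπ : Set.MapsTo π (Set.Icc 1 n) (Set.Icc 1 n)) {P Q : ℕ → ℝ → ℝ × ℝ}
    (hP : Equivariant π P) (hQ : Equivariant π Q)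
    (lP : ∀ j ∈ Set.Icc 1 n, LocallyLipschitz (P j))
    (lQ : ∀ j ∈ Set.Icc 1 n, LocallyLipschitz (Q j))
    (pP : ∀ j ∈ Set.Icc 1 n, ∀ t, 0 < (P j t).1) (pQ : ∀ j ∈ Set.Icc 1 n, ∀ t, 0 < (Q j t).1)
    (hne : ∀ i ∈ Set.Icc 1 n, ∀ j ∈ Set.Icc 1 n, i ≠ j → ∀ t, ∀ s ∈ Set.Icc (0 : ℝ) 1,
      (1 - s) • (P i t - P j t) + s • (Q i t - Q j t) ≠ 0) :
    ∃ h : Space3 ≃ₜ Space3, IsAmbient h ∧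
      ∀ j ∈ Set.Icc 1 n, ∀ t, h (cylPoint (P j t) t) = cylPoint (Q j t) t := by
  have hcyl : ∀ {P : ℕ → ℝ → ℝ × ℝ}, Equivariant π P →
      Equivariant π fun j t => cylPoint (P j t) t := by
    intro P hP j t
    have : Complex.exp (2 * Real.pi * (t + 1) * Complex.I) =
        Complex.exp (2 * Real.pi * t * Complex.I) := by
      rw [Complex.exp_eq_exp_iff_exists_int]
      exact ⟨1, by push_cast; ring⟩
    simp only [hP j t, cylPoint, Complex.ofReal_add, Complex.ofReal_one, this]
  have hinc : ∀ t₀ : ℝ, ∀ᶠ q : ℝ × ℝ in nhds (t₀, t₀), q.2 ≤ q.1 → q.1 - q.2 ≤ q.1 - q.2 :=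
    fun t₀ => Filter.Eventually.of_forall fun q _ => le_rfl
  refine exists_isAmbient_of_linear hπ (hcyl hP) (hcyl hQ)
    (fun j hj => locallyLipschitz_cylPoint (lP j hj) LocallyLipschitz.id)
    (fun j hj => locallyLipschitz_cylPoint (lQ j hj) LocallyLipschitz.id) ?_ ?_
  · intro i hi j hj t u s hs h0
    rw [cylPoint_linear, sub_eq_zero] at h0
    have pos : ∀ k ∈ Set.Icc 1 n, ∀ v, 0 < ((1 - s) • P k v + s • Q k v).1 := by
      intro k hk v
      have h1 := pP k hk v
      have h2 := pQ k hk v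
      simp only [Prod.fst_add, Prod.smul_fst, smul_eq_mul]
      rcases hs.1.eq_or_lt with rfl | h3
      · simpa using h1
      · have : 0 ≤ 1 - s := by linarith [hs.2]
        positivity
    obtain ⟨h1, m, rfl⟩ := cylPoint_eq (pos i hi t) (pos j hj u) h0
    refine ⟨m, rfl, ?_⟩
    rw [hP.add_int, hQ.add_int] at h1
    by_contra hij
    refine hne i hi _ (mapsTo_zpow hπ m hj) (Ne.symm hij) t s hs ?_
    have h2 : (1 - s) • (P i t - P ((π ^ m) j) t) + s • (Q i t - Q ((π ^ m) j) t) =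
      ((1 - s) • P i t + s • Q i t) - ((1 - s) • P ((π ^ m) j) t + s • Q ((π ^ m) j) t) := by module
    rw [h2, h1, sub_self]
  · intro i hi t₀
    obtain ⟨c, hc, h1⟩ := eventually_tangentForm (θ := fun t => t) (k := 0) (φ := t₀) (lP i hi)
      continuousAt_id (pP i hi t₀) (by simp) (hinc t₀)
    obtain ⟨c', hc', h2⟩ := eventually_tangentForm (θ := fun t => t) (k := 0) (φ := t₀) (lQ i hi)
      continuousAt_id (pQ i hi t₀) (by simp) (hinc t₀)
    refine ⟨tangentForm t₀, min c c', lt_min hc hc', ?_⟩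
    filter_upwards [h1, h2] with q a b hq
    have : 0 ≤ q.1 - q.2 := by linarith
    exact ⟨le_trans (by gcongr; exact min_le_left _ _) (a hq),
      le_trans (by gcongr; exact min_le_right _ _) (b hq)⟩

/-! ### Homotopies of closed braids -/

/-- Moving every strand by at most `ε` changes a difference of two strands by at most `2ε`, less
than their distance. -/
theorem exists_isAmbient_of_close {n : ℕ} {π : Equiv.Perm ℕ}
    (hπ : Set.MapsTo π (Set.Icc 1 n) (Set.Icc 1 n)) {P Q : ℕ → ℝ → ℝ × ℝ}
    (hP : Equivariant π P) (hQ : Equivariant π Q)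
    (lP : ∀ j ∈ Set.Icc 1 n, LocallyLipschitz (P j))
    (lQ : ∀ j ∈ Set.Icc 1 n, LocallyLipschitz (Q j)) {ε : ℝ} (hε : 0 < ε)
    (pP : ∀ j ∈ Set.Icc 1 n, ∀ t, 4 * ε ≤ (P j t).1)
    (hne : ∀ i ∈ Set.Icc 1 n, ∀ j ∈ Set.Icc 1 n, i ≠ j → ∀ t, 4 * ε ≤ ‖P i t - P j t‖)
    (hPQ : ∀ j ∈ Set.Icc 1 n, ∀ t, ‖Q j t - P j t‖ ≤ ε) :
    ∃ h : Space3 ≃ₜ Space3, IsAmbient h ∧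
      ∀ j ∈ Set.Icc 1 n, ∀ t, h (cylPoint (P j t) t) = cylPoint (Q j t) t := by
  refine exists_isAmbient_braid_linear hπ hP hQ lP lQ (fun j hj t => ?_) (fun j hj t => ?_) ?_
  · linarith [pP j hj t]
  · have h1 := (norm_fst_le _).trans (hPQ j hj t)
    rw [Prod.fst_sub, Real.norm_eq_abs] at h1
    have := neg_le_of_abs_le h1
    linarith [pP j hj t]
  · intro i hi j hj hij t s hs h0
    have e : P i t - P j t = ((1 - s) • (P i t - P j t) + s • (Q i t - Q j t)) -
      s • ((Q i t - P i t) - (Q j t - P j t)) := by module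
    rw [h0, zero_sub] at e
    have h1 := hne i hi j hj hij t
    rw [e, norm_neg, norm_smul, Real.norm_of_nonneg hs.1] at h1
    have h2 : ‖(Q i t - P i t) - (Q j t - P j t)‖ ≤ 2 * ε :=
      (norm_sub_le _ _).trans (by linarith [hPQ i hi t, hPQ j hj t])
    have h3 : s * ‖(Q i t - P i t) - (Q j t - P j t)‖ ≤ 1 * (2 * ε) :=
      mul_le_mul hs.2 h2 (norm_nonneg _) zero_le_one
    linarith

theorem exists_pos_forall_mem_Icc {n : ℕ} {Φ : ℕ → ℝ → Prop}
    (hmono : ∀ j ε ε', ε' ≤ ε → Φ j ε → Φ j ε')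
    (h : ∀ j ∈ Set.Icc 1 n, ∃ ε > 0, Φ j ε) : ∃ ε > 0, ∀ j ∈ Set.Icc 1 n, Φ j ε := by
  have h1 : ∀ᶠ ε in nhdsWithin (0 : ℝ) (Set.Ioi 0), ∀ j ∈ Set.Icc 1 n, Φ j ε := by
    rw [Filter.eventually_all_finite (Set.finite_Icc 1 n)]
    intro j hj
    obtain ⟨ε, hε, hΦ⟩ := h j hj
    filter_upwards [Ioc_mem_nhdsGT hε] with x hx using hmono j ε x hx.2 hΦ
  obtain ⟨ε, h2, h3⟩ := (h1.and self_mem_nhdsWithin).exists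
  exact ⟨ε, h3, h2⟩

/-- Averages over intervals of length `η`. -/
def slidingAverage (η : ℝ) (g : ℝ → ℝ × ℝ) (t : ℝ) : ℝ × ℝ := η⁻¹ • ∫ u in t..t + η, g u

/-- The average of a continuous curve is continuously differentiable. This repairs the intermediate
stages of a homotopy, which are only continuous in time. -/
theorem locallyLipschitz_slidingAverage {η : ℝ} {g : ℝ → ℝ × ℝ} (hg : Continuous g) :
    LocallyLipschitz (slidingAverage η g) := by
  have hd : ∀ t, HasDerivAt (fun t => ∫ u in (0 : ℝ)..t, g u) (g t) t := fun t =>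
    hg.integral_hasStrictDerivAt 0 t |>.hasDerivAt
  have hF : ContDiff ℝ 1 fun t => ∫ u in (0 : ℝ)..t, g u := by
    rw [contDiff_one_iff_deriv]
    refine ⟨fun t => (hd t).differentiableAt, ?_⟩
    have : deriv (fun t => ∫ u in (0 : ℝ)..t, g u) = g := funext fun t => (hd t).deriv
    rwa [this]
  have hF2 : ContDiff ℝ 1 fun t => η⁻¹ • ((∫ u in (0 : ℝ)..(t + η), g u) -
      ∫ u in (0 : ℝ)..t, g u) :=
    ((hF.comp (contDiff_id.add contDiff_const)).sub hF).const_smul _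
  have : slidingAverage η g = fun t => η⁻¹ • ((∫ u in (0 : ℝ)..(t + η), g u) -
      ∫ u in (0 : ℝ)..t, g u) := by
    funext t
    rw [slidingAverage, intervalIntegral.integral_interval_sub_left] <;>
      exact hg.intervalIntegrable _ _
  rw [this]
  exact hF2.locallyLipschitz (𝕂 := ℝ)

theorem norm_slidingAverage_sub_le {η ε : ℝ} (hη : 0 < η) {g : ℝ → ℝ × ℝ} (hg : Continuous g)
    {t : ℝ} (h : ∀ u ∈ Set.Icc t (t + η), ‖g u - g t‖ ≤ ε) :
    ‖slidingAverage η g t - g t‖ ≤ ε := by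
  have e : slidingAverage η g t - g t = η⁻¹ • ∫ u in t..t + η, (g u - g t) := by
    rw [intervalIntegral.integral_sub (hg.intervalIntegrable _ _)
      (continuous_const.intervalIntegrable _ _), intervalIntegral.integral_const, smul_sub,
      add_sub_cancel_left, smul_smul, inv_mul_cancel₀ hη.ne', one_smul, slidingAverage]
  have h2 : ‖∫ u in t..t + η, (g u - g t)‖ ≤ ε * |t + η - t| := by
    refine intervalIntegral.norm_integral_le_of_norm_le_const fun u hu => ?_
    rw [Set.uIoc_of_le (by linarith)] at hu
    exact h u ⟨hu.1.le, hu.2⟩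
  rw [add_sub_cancel_left, abs_of_pos hη] at h2
  rw [e, norm_smul, norm_inv, Real.norm_of_nonneg hη.le, inv_mul_le_iff₀ hη, mul_comm]
  exact h2

/-- Every stage is replaced by its sliding average, which is locally Lipschitz, equivariant and
close to it. Averages at neighbouring stages are joined by `exists_isAmbient_of_close`, and so are
the two ends and their own averages. -/
theorem exists_isAmbient_braid_homotopy {n : ℕ} {π : Equiv.Perm ℕ}
    (hπ : Set.MapsTo π (Set.Icc 1 n) (Set.Icc 1 n)) {G : ℝ → ℕ → ℝ → ℝ × ℝ}
    (hG : ∀ s, Equivariant π (G s))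
    (cG : ∀ j ∈ Set.Icc 1 n, Continuous fun q : ℝ × ℝ => G q.1 j q.2)
    (pG : ∀ s ∈ Set.Icc (0 : ℝ) 1, ∀ j ∈ Set.Icc 1 n, ∀ t, 0 < (G s j t).1)
    (hne : ∀ s ∈ Set.Icc (0 : ℝ) 1, ∀ i ∈ Set.Icc 1 n, ∀ j ∈ Set.Icc 1 n, i ≠ j → ∀ t,
      G s i t ≠ G s j t)
    (l0 : ∀ j ∈ Set.Icc 1 n, LocallyLipschitz (G 0 j))
    (l1 : ∀ j ∈ Set.Icc 1 n, LocallyLipschitz (G 1 j)) :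
    ∃ h : Space3 ≃ₜ Space3, IsAmbient h ∧
      ∀ j ∈ Set.Icc 1 n, ∀ t, h (cylPoint (G 0 j t) t) = cylPoint (G 1 j t) t := by
  have red : ∀ s j t, G s j t = G s ((π ^ ⌊t⌋) j) (Int.fract t) := fun s j t => by
    rw [← (hG s).add_int, Int.fract_add_floor]
  have cGs : ∀ s, ∀ j ∈ Set.Icc 1 n, Continuous (G s j) := fun s j hj =>
    (cG j hj).comp (continuous_const.prodMk continuous_id)
  -- The factor `16` is a budget: averaging costs `2ε` of the distance between strands, and the
  -- averages must still be `4 * (3 * ε)` apart for steps of size `3 * ε`.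
  have lower : ∀ F : ℝ × ℝ → ℝ, Continuous F →
      (∀ q ∈ Set.Icc (0 : ℝ) 1 ×ˢ Set.Icc (0 : ℝ) 1, 0 < F q) →
      ∃ ε > 0, ∀ q ∈ Set.Icc (0 : ℝ) 1 ×ˢ Set.Icc (0 : ℝ) 1, 16 * ε ≤ F q := by
    intro F hF hpos
    obtain ⟨q₀, hq₀, hmin⟩ := (isCompact_Icc.prod isCompact_Icc).exists_isMinOn
      (s := Set.Icc (0 : ℝ) 1 ×ˢ Set.Icc (0 : ℝ) 1) ⟨(0, 0), by simp⟩ hF.continuousOn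
    exact ⟨F q₀ / 16, by linarith [hpos q₀ hq₀], fun q hq => by
      have : F q₀ ≤ F q := hmin hq
      linarith⟩
  obtain ⟨ε₁, hε₁, sep⟩ := exists_pos_forall_mem_Icc (n := n)
    (Φ := fun i ε => ∀ j ∈ Set.Icc 1 n, i ≠ j → ∀ q ∈ Set.Icc (0 : ℝ) 1 ×ˢ Set.Icc (0 : ℝ) 1,
      16 * ε ≤ ‖G q.1 i q.2 - G q.1 j q.2‖)
    (fun i ε ε' h H j hj hij q hq => (by linarith [H j hj hij q hq])) (fun i hi => by
      refine exists_pos_forall_mem_Icc (n := n)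
        (Φ := fun j ε => i ≠ j → ∀ q ∈ Set.Icc (0 : ℝ) 1 ×ˢ Set.Icc (0 : ℝ) 1,
          16 * ε ≤ ‖G q.1 i q.2 - G q.1 j q.2‖)
        (fun j ε ε' h H hij q hq => (by linarith [H hij q hq])) fun j hj => ?_
      by_cases hij : i = j
      · exact ⟨1, one_pos, fun h => absurd hij h⟩
      obtain ⟨ε, hε, H⟩ := lower (fun q => ‖G q.1 i q.2 - G q.1 j q.2‖)
        ((cG i hi).sub (cG j hj)).norm
        (fun q hq => norm_pos_iff.2 (sub_ne_zero.2 (hne q.1 hq.1 i hi j hj hij q.2)))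
      exact ⟨ε, hε, fun _ => H⟩)
  obtain ⟨ε₂, hε₂, rad⟩ := exists_pos_forall_mem_Icc (n := n)
    (Φ := fun j ε => ∀ q ∈ Set.Icc (0 : ℝ) 1 ×ˢ Set.Icc (0 : ℝ) 1, 16 * ε ≤ (G q.1 j q.2).1)
    (fun j ε ε' h H q hq => (by linarith [H q hq])) (fun j hj =>
      lower _ (cG j hj).fst fun q hq => pG q.1 hq.1 j hj q.2)
  set ε := min ε₁ ε₂ with hεdef
  have hε : 0 < ε := lt_min hε₁ hε₂
  have fr : ∀ t : ℝ, Int.fract t ∈ Set.Icc (0 : ℝ) 1 := fun t =>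
    ⟨Int.fract_nonneg t, (Int.fract_lt_one t).le⟩
  have sep' : ∀ s ∈ Set.Icc (0 : ℝ) 1, ∀ i ∈ Set.Icc 1 n, ∀ j ∈ Set.Icc 1 n, i ≠ j → ∀ t,
      16 * ε ≤ ‖G s i t - G s j t‖ := by
    intro s hs i hi j hj hij t
    have := sep _ (mapsTo_zpow hπ ⌊t⌋ hi) _ (mapsTo_zpow hπ ⌊t⌋ hj)
      ((π ^ ⌊t⌋).injective.ne hij) (s, Int.fract t) ⟨hs, fr t⟩
    rw [red s i, red s j]
    linarith [min_le_left ε₁ ε₂]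
  have rad' : ∀ s ∈ Set.Icc (0 : ℝ) 1, ∀ j ∈ Set.Icc 1 n, ∀ t, 16 * ε ≤ (G s j t).1 := by
    intro s hs j hj t
    have := rad _ (mapsTo_zpow hπ ⌊t⌋ hj) (s, Int.fract t) ⟨hs, fr t⟩
    rw [red s j]
    linarith [min_le_right ε₁ ε₂]
  obtain ⟨η, hη, uc⟩ := exists_pos_forall_mem_Icc (n := n)
    (Φ := fun j η => ∀ s ∈ Set.Icc (0 : ℝ) 1, ∀ s' ∈ Set.Icc (0 : ℝ) 1, ∀ t ∈ Set.Icc (0 : ℝ) 1,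
      ∀ t', |s' - s| ≤ η → |t' - t| ≤ η → ‖G s' j t' - G s j t‖ ≤ ε)
    (fun j η η' h H s hs s' hs' t ht t' h1 h2 => H s hs s' hs' t ht t' (h1.trans h) (h2.trans h))
    (fun j hj => by
      have hK : IsCompact (Set.Icc (0 : ℝ) 1 ×ˢ Set.Icc (-1 : ℝ) 2) :=
        isCompact_Icc.prod isCompact_Icc
      obtain ⟨η, hη, H⟩ := Metric.uniformContinuousOn_iff.1
        (hK.uniformContinuousOn_of_continuous (cG j hj).continuousOn) ε hε
      refine ⟨min (η / 2) 1, by positivity, fun s hs s' hs' t ht t' h1 h2 => ?_⟩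
      have h3 := abs_le.1 (h2.trans (min_le_right _ _))
      have h4 := H (s', t') ⟨hs', by constructor <;> linarith [ht.1, ht.2]⟩ (s, t)
        ⟨hs, by constructor <;> linarith [ht.1, ht.2]⟩ (by
          rw [Prod.dist_eq, Real.dist_eq, Real.dist_eq]
          exact max_lt (by linarith [min_le_left (η / 2) 1]) (by linarith [min_le_left (η / 2) 1]))
      rw [dist_eq_norm] at h4
      exact h4.le)
  have uc' : ∀ s ∈ Set.Icc (0 : ℝ) 1, ∀ s' ∈ Set.Icc (0 : ℝ) 1, ∀ j ∈ Set.Icc 1 n, ∀ t t',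
      |s' - s| ≤ η → |t' - t| ≤ η → ‖G s' j t' - G s j t‖ ≤ ε := by
    intro s hs s' hs' j hj t t' h1 h2
    have := uc _ (mapsTo_zpow hπ ⌊t⌋ hj) s hs s' hs' (Int.fract t) (fr t) (t' - ⌊t⌋) h1 (by
      rwa [Int.fract, sub_sub_sub_cancel_right])
    rwa [← (hG s').add_int, ← (hG s).add_int, sub_add_cancel, Int.fract_add_floor] at this
  let A : ℝ → ℕ → ℝ → ℝ × ℝ := fun s j => slidingAverage η (G s j)
  have hA : ∀ s, Equivariant π (A s) := by
    intro s j t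
    simp only [A, slidingAverage]
    rw [add_right_comm, ← intervalIntegral.integral_comp_add_right (fun u => G s j u)]
    simp only [hG s j _]
  have lA : ∀ s, ∀ j ∈ Set.Icc 1 n, LocallyLipschitz (A s j) := fun s j hj =>
    locallyLipschitz_slidingAverage (cGs s j hj)
  have dA : ∀ s ∈ Set.Icc (0 : ℝ) 1, ∀ j ∈ Set.Icc 1 n, ∀ t, ‖A s j t - G s j t‖ ≤ ε := by
    intro s hs j hj t
    refine norm_slidingAverage_sub_le hη (cGs s j hj) fun u hu => uc' s hs s hs j hj t u ?_ ?_
    · simpa using hη.le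
    · rw [abs_of_nonneg (by linarith [hu.1])]
      linarith [hu.2]
  have sepA : ∀ s ∈ Set.Icc (0 : ℝ) 1, ∀ i ∈ Set.Icc 1 n, ∀ j ∈ Set.Icc 1 n, i ≠ j → ∀ t,
      4 * (3 * ε) ≤ ‖A s i t - A s j t‖ := by
    intro s hs i hi j hj hij t
    have e : G s i t - G s j t = (A s i t - A s j t) - ((A s i t - G s i t) -
      (A s j t - G s j t)) := by module
    have h1 := sep' s hs i hi j hj hij t
    rw [e] at h1
    have h2 := norm_sub_le (A s i t - A s j t) ((A s i t - G s i t) - (A s j t - G s j t))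
    have h3 := norm_sub_le (A s i t - G s i t) (A s j t - G s j t)
    linarith [dA s hs i hi t, dA s hs j hj t]
  have radA : ∀ s ∈ Set.Icc (0 : ℝ) 1, ∀ j ∈ Set.Icc 1 n, ∀ t, 4 * (3 * ε) ≤ (A s j t).1 := by
    intro s hs j hj t
    have h1 := (norm_fst_le _).trans (dA s hs j hj t)
    rw [Prod.fst_sub, Real.norm_eq_abs] at h1
    have := neg_le_of_abs_le h1
    linarith [rad' s hs j hj t]
  have h0I : (0 : ℝ) ∈ Set.Icc (0 : ℝ) 1 := by simp
  have h1I : (1 : ℝ) ∈ Set.Icc (0 : ℝ) 1 := by simp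
  obtain ⟨N, hN⟩ := exists_nat_gt (1 / η)
  have hN0 : (0 : ℝ) < N := lt_trans (by positivity) hN
  have hNη : 1 / (N : ℝ) ≤ η := by
    rw [div_le_iff₀ hN0]
    rw [div_lt_iff₀ hη] at hN
    linarith
  have chain : ∀ k : ℕ, k ≤ N → ∃ h : Space3 ≃ₜ Space3, IsAmbient h ∧
      ∀ j ∈ Set.Icc 1 n, ∀ t, h (cylPoint (A 0 j t) t) = cylPoint (A (k / N) j t) t := by
    intro k
    induction k with
    | zero => exact fun _ => ⟨Homeomorph.refl _, isAmbient_refl, fun j _ t => by simp⟩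
    | succ k ih =>
      intro hk
      obtain ⟨h, hh, H⟩ := ih (by omega)
      have m1 : (k : ℝ) / N ∈ Set.Icc (0 : ℝ) 1 := by
        refine ⟨by positivity, ?_⟩
        rw [div_le_one hN0]
        exact_mod_cast (by omega : k ≤ N)
      have m2 : ((k + 1 : ℕ) : ℝ) / N ∈ Set.Icc (0 : ℝ) 1 := by
        refine ⟨by positivity, ?_⟩
        rw [div_le_one hN0]
        exact_mod_cast hk
      -- The size `3 * ε` of a step is `ε` for each of the two averages and `ε` for the change of
      -- stage.
      obtain ⟨h', hh', H'⟩ := exists_isAmbient_of_close hπ (hA (k / N)) (hA ((k + 1 : ℕ) / N))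
        (lA _) (lA _) (ε := 3 * ε) (by positivity) (radA _ m1) (sepA _ m1) (by
          intro j hj t
          have e : A ((k + 1 : ℕ) / N) j t - A (k / N) j t =
            (A ((k + 1 : ℕ) / N) j t - G ((k + 1 : ℕ) / N) j t) +
            (G ((k + 1 : ℕ) / N) j t - G (k / N) j t) - (A (k / N) j t - G (k / N) j t) := by module
          rw [e]
          have h1 := uc' _ m1 _ m2 j hj t t (by
            rw [← sub_div, Nat.cast_succ, add_sub_cancel_left, abs_of_pos (by positivity)]
            exact hNη) (by simpa using hη.le)
          have h2 := norm_sub_le ((A ((k + 1 : ℕ) / N) j t - G ((k + 1 : ℕ) / N) j t) +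
            (G ((k + 1 : ℕ) / N) j t - G (k / N) j t)) (A (k / N) j t - G (k / N) j t)
          have h3 := norm_add_le (A ((k + 1 : ℕ) / N) j t - G ((k + 1 : ℕ) / N) j t)
            (G ((k + 1 : ℕ) / N) j t - G (k / N) j t)
          linarith [dA _ m1 j hj t, dA _ m2 j hj t])
      exact ⟨h.trans h', hh.trans hh', fun j hj t => by
        rw [Homeomorph.trans_apply, H j hj, H' j hj]⟩
  obtain ⟨h₂, hh₂, H₂⟩ := chain N le_rfl
  rw [div_self hN0.ne'] at H₂
  obtain ⟨h₁, hh₁, H₁⟩ := exists_isAmbient_of_close hπ (hG 0) (hA 0) l0 (lA 0) hε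
    (fun j hj t => by linarith [rad' 0 h0I j hj t])
    (fun i hi j hj hij t => by linarith [sep' 0 h0I i hi j hj hij t]) (dA 0 h0I)
  obtain ⟨h₃, hh₃, H₃⟩ := exists_isAmbient_of_close hπ (hG 1) (hA 1) l1 (lA 1) hε
    (fun j hj t => by linarith [rad' 1 h1I j hj t])
    (fun i hi j hj hij t => by linarith [sep' 1 h1I i hi j hj hij t]) (dA 1 h1I)
  refine ⟨(h₁.trans h₂).trans h₃.symm, (hh₁.trans hh₂).trans hh₃.symm, fun j hj t => ?_⟩
  rw [Homeomorph.trans_apply, Homeomorph.trans_apply, H₁ j hj, H₂ j hj, ← H₃ j hj,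
    Homeomorph.symm_apply_apply]

/-- The strands of the closure of a motion `p` of points of the half-plane, `0 ≤ t ≤ 1`, that
causes the permutation `π`. -/
def braidFam (n : ℕ) (π : Equiv.Perm ℕ) (p : ℝ → ℕ → ℝ × ℝ) (j : Set.Icc 1 n) (t : ℝ) : Space3 :=
  cylPoint (unroll π p j t) t

theorem braidFam_homotopy {n : ℕ} {π : Equiv.Perm ℕ}
    (hπ : Set.MapsTo π (Set.Icc 1 n) (Set.Icc 1 n)) {p : ℝ → ℝ → ℕ → ℝ × ℝ}
    (hp : ∀ s ∈ Set.Icc (0 : ℝ) 1, ∀ j ∈ Set.Icc 1 n, p s 1 j = p s 0 (π j))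
    (cp : ∀ j ∈ Set.Icc 1 n, Continuous fun q : ℝ × ℝ => p q.1 q.2 j)
    (pos : ∀ s ∈ Set.Icc (0 : ℝ) 1, ∀ u ∈ Set.Icc (0 : ℝ) 1, ∀ j ∈ Set.Icc 1 n, 0 < (p s u j).1)
    (hne : ∀ s ∈ Set.Icc (0 : ℝ) 1, ∀ u ∈ Set.Icc (0 : ℝ) 1, ∀ i ∈ Set.Icc 1 n,
      ∀ j ∈ Set.Icc 1 n, p s u i = p s u j → i = j)
    (l0 : ∀ j ∈ Set.Icc 1 n, LocallyLipschitz fun u => p 0 u j)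
    (l1 : ∀ j ∈ Set.Icc 1 n, LocallyLipschitz fun u => p 1 u j) :
    FamIso (braidFam n π (p 0)) (braidFam n π (p 1)) := by
  have fr : ∀ t : ℝ, Int.fract t ∈ Set.Icc (0 : ℝ) 1 := fun t =>
    ⟨Int.fract_nonneg t, (Int.fract_lt_one t).le⟩
  -- The hypotheses hold for stages in `[0, 1]` only, whereas equivariance and continuity are
  -- required at all real stages; hence the clamping.
  let c : ℝ → ℝ := fun s => max 0 (min s 1)
  have hc : ∀ s, c s ∈ Set.Icc (0 : ℝ) 1 := fun s =>
    ⟨le_max_left _ _, max_le zero_le_one (min_le_right _ _)⟩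
  have cc : Continuous c := by fun_prop
  have c0 : c 0 = 0 := by simp [c]
  have c1 : c 1 = 1 := by simp [c]
  obtain ⟨h, hh, H⟩ := exists_isAmbient_braid_homotopy hπ (G := fun s => unroll π (p (c s)))
    (fun s => equivariant_unroll π (p (c s)))
    (fun j hj => continuous_unroll hπ (fun s => hp _ (hc s)) (fun j hj =>
      (cp j hj).comp ((cc.comp continuous_fst).prodMk continuous_snd)) hj)
    (fun s hs j hj t => pos _ (hc s) _ (fr t) _ (mapsTo_zpow hπ _ hj))
    (fun s hs i hi j hj hij t h => hij ((π ^ ⌊t⌋).injective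
      (hne _ (hc s) _ (fr t) _ (mapsTo_zpow hπ _ hi) _ (mapsTo_zpow hπ _ hj) h)))
    (fun j hj => locallyLipschitz_unroll hπ (hp _ (hc 0)) (by rwa [c0]) hj)
    (fun j hj => locallyLipschitz_unroll hπ (hp _ (hc 1)) (by rwa [c1]) hj)
  simp only [c0, c1] at H
  exact FamIso.of_eq hh fun j t => H j j.2 t

theorem mapsTo_wordPerm {n : ℕ} (w : BraidWord n) :
    Set.MapsTo (wordPerm w) (Set.Icc 1 n) (Set.Icc 1 n) := fun _ hj => wordPerm_mem w hj

theorem locallyLipschitz_prodMk' {p θ : ℝ → ℝ} (hp : LocallyLipschitz p)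
    (hθ : LocallyLipschitz θ) : LocallyLipschitz fun t => (p t, θ t) := hp.prodMk hθ

theorem locallyLipschitz_letterMotion {n : ℕ} (g : BraidLetter n) (j : ℕ) :
    LocallyLipschitz (letterMotion g j) := by
  have h1 : LocallyLipschitz fun s : ℝ => min s (1 - s) :=
    LocallyLipschitz.id.real_min (ContDiff.locallyLipschitz (𝕂 := ℝ) (by fun_prop))
  have h2 : ∀ c : ℝ, LocallyLipschitz fun s : ℝ => c * min s (1 - s) := fun c =>
    (LocallyLipschitz.const c).real_mul h1
  have h3 : LocallyLipschitz fun s : ℝ => (g.1.1 : ℝ) + s :=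
    ContDiff.locallyLipschitz (𝕂 := ℝ) (by fun_prop)
  have h4 : LocallyLipschitz fun s : ℝ => (g.1.1 : ℝ) + 1 - s :=
    ContDiff.locallyLipschitz (𝕂 := ℝ) (by fun_prop)
  by_cases e1 : j = g.1.1
  · have := locallyLipschitz_prodMk' h3 (h2 (if g.2 then 1 else -1))
    convert this using 2
    simp [letterMotion, e1]
  · by_cases e2 : j = g.1.1 + 1
    · have := locallyLipschitz_prodMk' h4 (h2 (if g.2 then -1 else 1))
      convert this using 2
      simp [letterMotion, e2]
    · have : letterMotion g j = fun _ => ((j : ℝ), (0 : ℝ)) := by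
        funext s
        simp [letterMotion, e1, e2]
      rw [this]
      exact LocallyLipschitz.const _

theorem locallyLipschitz_wordMotion {n : ℕ} (w : BraidWord n) (j : ℕ) :
    LocallyLipschitz (wordMotion w j) := by
  induction w generalizing j with
  | nil => exact LocallyLipschitz.const _
  | cons g w ih =>
    refine LocallyLipschitz.if_le (locallyLipschitz_letterMotion g j)
      ((ih _).comp (locallyLipschitz_sub_const 1)) ?_
    simp [letterMotion_one, wordMotion_zero]

theorem wordMotion_of_le {n : ℕ} (w : BraidWord n) (j : ℕ) {s : ℝ} (hs : (w.length : ℝ) ≤ s) :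
    wordMotion w j s = (((wordPerm w j : ℕ) : ℝ), 0) := by
  induction w generalizing j s with
  | nil => rfl
  | cons g w ih =>
    rw [List.length_cons, Nat.cast_succ] at hs
    by_cases h : s ≤ 1
    · have hw : (w.length : ℝ) = 0 := le_antisymm (by linarith) (Nat.cast_nonneg _)
      have h1 : s = 1 := by linarith
      have h2 := wordMotion_zero w (letterPerm g j)
      rw [ih _ hw.le] at h2
      simp only [wordMotion, h, if_true]
      rw [h1, letterMotion_one, ← h2]
      rfl
    · simp only [wordMotion, h, if_false]
      exact ih _ (by linarith)

/-- The speed at which the letters of a word are run through does not matter. -/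
theorem closedFam_retime {n : ℕ} (w : BraidWord n) {τ : ℝ → ℝ} (hτ : LocallyLipschitz τ)
    (τ0 : τ 0 = 0) (τ1 : w.length ≤ τ 1) (hpos : ∀ u ∈ Set.Icc (0 : ℝ) 1, 0 ≤ τ u) :
    FamIso (closedFam w) (braidFam n (wordPerm w) fun u j => wordMotion w j (τ u)) := by
  have hnn : ∀ s ∈ Set.Icc (0 : ℝ) 1, ∀ u ∈ Set.Icc (0 : ℝ) 1,
      0 ≤ (1 - s) * ((w.length + 1) * u) + s * τ u := by
    intro s hs u hu
    have h1 := hpos u hu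
    have h2 := hu.1
    have h3 := hs.1
    have h4 : 0 ≤ 1 - s := by linarith [hs.2]
    positivity
  -- All strands share one clock, so no change of its speed makes them collide; the two clocks are
  -- interpolated linearly.
  have := braidFam_homotopy (n := n) (mapsTo_wordPerm w)
    (p := fun s u j => wordMotion w j ((1 - s) * ((w.length + 1) * u) + s * τ u))
    (fun s hs j hj => by
      have e1 : w.length ≤ (1 - s) * (((w.length : ℝ) + 1) * 1) + s * τ 1 := by
        nlinarith [hs.1, hs.2]
      have e2 : (1 - s) * (((w.length : ℝ) + 1) * 0) + s * τ 0 = 0 := by rw [τ0]; ring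
      simp only [wordMotion_of_le w j e1, e2, wordMotion_zero])
    (fun j hj => (continuous_wordMotion w j).comp (by
      have := hτ.continuous
      fun_prop))
    (fun s hs u hu j hj => wordMotion_pos w (hnn s hs u hu) hj)
    (fun s hs u hu i hi j hj h => wordMotion_injective w (hnn s hs u hu) h)
    (fun j hj => by
      simp only [sub_zero, one_mul, zero_mul, add_zero]
      have h1 : LocallyLipschitz fun u : ℝ => ((w.length : ℝ) + 1) * u :=
        ContDiff.locallyLipschitz (𝕂 := ℝ) (by fun_prop)
      exact (locallyLipschitz_wordMotion w j).comp h1)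
    (fun j hj => by
      simp only [sub_self, one_mul, zero_mul, zero_add]
      exact (locallyLipschitz_wordMotion w j).comp hτ)
  simp only [sub_zero, one_mul, zero_mul, add_zero, sub_self, zero_add] at this
  exact this

/-! ### Rotation of a closed braid -/

theorem wordPerm_append {n : ℕ} (u v : BraidWord n) :
    wordPerm (u ++ v) = wordPerm v * wordPerm u := by
  induction u with
  | nil => rfl
  | cons g u ih => rw [List.cons_append, wordPerm, ih, wordPerm, mul_assoc]

theorem wordMotion_append {n : ℕ} (u v : BraidWord n) (j : ℕ) {s : ℝ} (h0 : 0 ≤ s) :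
    wordMotion (u ++ v) j s = if s ≤ u.length then wordMotion u j s else
      wordMotion v (wordPerm u j) (s - u.length) := by
  induction u generalizing j s with
  | nil =>
    by_cases h : s ≤ 0
    · obtain rfl : s = 0 := le_antisymm h h0
      simp [wordMotion_zero]
    · simp [h, wordPerm]
  | cons g u ih =>
    have hu : (0 : ℝ) ≤ u.length := Nat.cast_nonneg _
    by_cases h : s ≤ 1
    · have : s ≤ ((g :: u).length : ℝ) := by push_cast [List.length_cons]; linarith
      simp only [List.cons_append, wordMotion, h, if_true, this]
    · simp only [List.cons_append, wordMotion, h, if_false, List.length_cons, Nat.cast_succ]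
      rw [ih _ (by linarith)]
      by_cases h2 : s - 1 ≤ u.length
      · rw [if_pos h2, if_pos (by linarith)]
      · rw [if_neg h2, if_neg (by linarith)]
        congr 1
        ring

/-- The rotation around the vertical axis by the angle `θ`. -/
def axisRotation (θ : ℝ) : Space3 ≃ₜ Space3 where
  toFun x := (Complex.exp (θ * Complex.I) * x.1, x.2)
  invFun x := (Complex.exp (-(θ * Complex.I)) * x.1, x.2)
  left_inv x := by simp [← mul_assoc, ← Complex.exp_add]
  right_inv x := by simp [← mul_assoc, ← Complex.exp_add]
  continuous_toFun := by fun_prop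
  continuous_invFun := by fun_prop

theorem isAmbient_axisRotation (θ : ℝ) : IsAmbient (axisRotation θ) := by
  refine ⟨fun s => axisRotation (s.1 * θ), ?_, ?_, ?_, ?_⟩
  · simp only [axisRotation, Homeomorph.homeomorph_mk_coe, Equiv.coe_fn_mk]
    fun_prop
  · simp only [axisRotation, Homeomorph.homeomorph_mk_coe_symm, Equiv.coe_fn_symm_mk]
    fun_prop
  · ext1 x
    simp [axisRotation]
  · simp

theorem axisRotation_cylPoint (p : ℝ × ℝ) (t a : ℝ) :
    axisRotation (2 * Real.pi * a) (cylPoint p t) = cylPoint p (t + a) := by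
  have : Complex.exp ((2 * Real.pi * a : ℝ) * Complex.I) *
      ((p.1 : ℂ) * Complex.exp (2 * Real.pi * t * Complex.I)) =
      p.1 * Complex.exp (2 * Real.pi * (t + a : ℝ) * Complex.I) := by
    rw [mul_left_comm, ← Complex.exp_add]
    congr 2
    push_cast
    ring
  exact Prod.ext this rfl

/-- Turning a closed motion of two equal halves by half a turn exchanges the halves. -/
theorem braidFam_rotate {n : ℕ} {π π' ρ : Equiv.Perm ℕ} {p p' : ℝ → ℕ → ℝ × ℝ}
    (hρ : Set.MapsTo ρ (Set.Icc 1 n) (Set.Icc 1 n)) (hπ : ρ * π = π' * ρ)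
    (h1 : ∀ u ∈ Set.Ico (0 : ℝ) (1 / 2), ∀ j, p (u + 1 / 2) j = p' u (ρ j))
    (h2 : ∀ u ∈ Set.Ico (1 / 2 : ℝ) 1, ∀ j, p (u - 1 / 2) (π j) = p' u (ρ j)) :
    FamIso (braidFam n π p) (braidFam n π' p') := by
  have hz : ∀ (q : ℤ) j, ρ ((π ^ q) j) = (π' ^ q) (ρ j) := by
    intro q j
    have : π' = ρ * π * ρ⁻¹ := by rw [hπ]; group
    rw [this, conj_zpow]
    simp
  have key : ∀ j t, unroll π p j (t + 1 / 2) = unroll π' p' (ρ j) t := by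
    intro j t
    have f0 := Int.fract_nonneg t
    have f1 := Int.fract_lt_one t
    have ft : t = ⌊t⌋ + Int.fract t := (Int.floor_add_fract t).symm
    rcases lt_or_ge (Int.fract t) (1 / 2) with h | h
    · have e1 : ⌊t + 1 / 2⌋ = ⌊t⌋ := Int.floor_eq_iff.2 ⟨by linarith, by linarith⟩
      have e2 : Int.fract (t + 1 / 2) = Int.fract t + 1 / 2 := by
        rw [Int.fract, Int.fract, e1]; ring
      rw [unroll, unroll, e1, e2, h1 _ ⟨f0, h⟩, hz]
    · have e1 : ⌊t + 1 / 2⌋ = ⌊t⌋ + 1 :=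
        Int.floor_eq_iff.2 ⟨by push_cast; linarith, by push_cast; linarith⟩
      have e2 : Int.fract (t + 1 / 2) = Int.fract t - 1 / 2 := by
        rw [Int.fract, Int.fract, e1]; push_cast; ring
      rw [unroll, unroll, e1, e2, add_comm, zpow_one_add, Equiv.Perm.mul_apply, h2 _ ⟨h, f1⟩, hz]
  have hr : ∀ j t, axisRotation (2 * Real.pi * (-(1 / 2))) (cylPoint (unroll π p j t) t) =
      cylPoint (unroll π' p' (ρ j) (t - 1 / 2)) (t - 1 / 2) := by
    intro j t
    rw [axisRotation_cylPoint, ← key, sub_add_cancel, sub_eq_add_neg]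
  refine ⟨axisRotation (2 * Real.pi * (-(1 / 2))), isAmbient_axisRotation _, fun j => ?_, fun k => ?_⟩
  · exact ⟨⟨ρ j, hρ j.2⟩, OrderIso.subRight (1 / 2), fun t => hr j t⟩
  · have : (ρ ^ (-1 : ℤ)) k.1 ∈ Set.Icc 1 n := mapsTo_zpow hρ _ k.2
    refine ⟨⟨_, this⟩, OrderIso.subRight (1 / 2), fun t => ?_⟩
    refine (hr _ t).trans ?_
    simp [braidFam]

theorem braidFam_congr {n : ℕ} {π : Equiv.Perm ℕ}
    (hπ : Set.MapsTo π (Set.Icc 1 n) (Set.Icc 1 n)) {p p' : ℝ → ℕ → ℝ × ℝ}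
    (h : ∀ u ∈ Set.Ico (0 : ℝ) 1, ∀ j ∈ Set.Icc 1 n, p u j = p' u j) :
    braidFam n π p = braidFam n π p' := by
  funext j t
  rw [braidFam, braidFam, unroll, unroll,
    h _ ⟨Int.fract_nonneg t, Int.fract_lt_one t⟩ _ (mapsTo_zpow hπ _ j.2)]

/-- Whatever their lengths, both words are given half a turn, so that exchanging them is a rotation
by half a turn. -/
theorem closedFam_halves {n : ℕ} (u v : BraidWord n) :
    FamIso (closedFam (u ++ v)) (braidFam n (wordPerm v * wordPerm u) fun t j =>
      if t ≤ 1 / 2 then wordMotion u j (2 * t * u.length) else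
        wordMotion v (wordPerm u j) ((2 * t - 1) * v.length)) := by
  have hu : (0 : ℝ) ≤ u.length := Nat.cast_nonneg _
  have hv : (0 : ℝ) ≤ v.length := Nat.cast_nonneg _
  have h := closedFam_retime (u ++ v)
    (τ := fun t => if t ≤ 1 / 2 then 2 * t * u.length else u.length + (2 * t - 1) * v.length)
    (LocallyLipschitz.if_le (ContDiff.locallyLipschitz (𝕂 := ℝ) (by fun_prop))
      (ContDiff.locallyLipschitz (𝕂 := ℝ) (by fun_prop)) (by norm_num))
    (by norm_num) (by norm_num) (by
      intro t ht
      have := ht.1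
      split_ifs with h
      · positivity
      · have : 0 ≤ 2 * t - 1 := by linarith
        positivity)
  refine h.trans ?_
  rw [wordPerm_append]
  rw [braidFam_congr (by rw [← wordPerm_append]; exact mapsTo_wordPerm _)]
  · exact FamIso.refl _
  intro t ht0 j _
  have f0 := ht0.1
  by_cases ht : t ≤ 1 / 2
  · simp only [ht, if_true]
    rw [wordMotion_append _ _ _ (by positivity), if_pos]
    exact mul_le_of_le_one_left hu (by linarith)
  · simp only [ht, if_false]
    have h1 : 0 ≤ 2 * t - 1 := by linarith
    have h2 : 0 ≤ (2 * t - 1) * v.length := by positivity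
    rw [wordMotion_append _ _ _ (by linarith)]
    split_ifs with h3
    · have h4 : (2 * t - 1) * v.length = 0 := by linarith
      rw [h4, add_zero, wordMotion_of_le u _ le_rfl, wordMotion_zero]
    · rw [add_sub_cancel_left]

/-- This is invariance under conjugation: the two closures differ by half a turn about the axis, and
the strand in position `j` is then read from position `wordPerm u j`. -/
theorem closedFam_append_comm {n : ℕ} (u v : BraidWord n) :
    FamIso (closedFam (u ++ v)) (closedFam (v ++ u)) := by
  refine (closedFam_halves u v).trans (FamIso.trans ?_ (closedFam_halves v u).symm)
  refine braidFam_rotate (ρ := wordPerm u) (mapsTo_wordPerm u) (by group) ?_ ?_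
  · intro t ht j
    have h1 := ht.1
    rw [if_pos ht.2.le]
    by_cases h : t + 1 / 2 ≤ 1 / 2
    · obtain rfl : t = 0 := by linarith
      norm_num [wordMotion_of_le, wordMotion_zero]
    · rw [if_neg h]
      congr 2
      ring
  · intro t ht j
    rw [if_pos (by linarith [ht.2])]
    by_cases h : t ≤ 1 / 2
    · obtain rfl : t = 1 / 2 := le_antisymm h ht.1
      norm_num [wordMotion_of_le, wordMotion_zero]
    · rw [if_neg h, Equiv.Perm.mul_apply]
      congr 2
      ring

/-! ### Changing a part of a braid word -/

/-- The motion `a` during the time `L`, which causes the permutation `ρ`, followed by the motion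
under the word `v`. -/
def concatMotion {n : ℕ} (L : ℝ) (a : ℝ → ℕ → ℝ × ℝ) (ρ : Equiv.Perm ℕ) (v : BraidWord n)
    (x : ℝ) (j : ℕ) : ℝ × ℝ :=
  if x ≤ L then a x j else wordMotion v (ρ j) (x - L)

theorem closedFam_append_eq {n : ℕ} (m v : BraidWord n) :
    FamIso (closedFam (m ++ v)) (braidFam n (wordPerm v * wordPerm m) fun u =>
      concatMotion m.length (fun x j => wordMotion m j x) (wordPerm m) v
        ((m.length + v.length) * u)) := by
  have hu : (0 : ℝ) ≤ m.length := Nat.cast_nonneg _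
  have hv : (0 : ℝ) ≤ v.length := Nat.cast_nonneg _
  have h := closedFam_retime (m ++ v) (τ := fun u => (m.length + v.length) * u)
    (ContDiff.locallyLipschitz (𝕂 := ℝ) (by fun_prop)) (by simp) (by simp)
    (fun u hu => by have := hu.1; positivity)
  rw [wordPerm_append] at h
  rw [braidFam_congr (by rw [← wordPerm_append]; exact mapsTo_wordPerm _) (p' := fun u =>
      concatMotion m.length (fun x j => wordMotion m j x) (wordPerm m) v
        ((m.length + v.length) * u))] at h
  · exact h
  · intro u hu j hj
    have := hu.1
    rw [wordMotion_append _ _ _ (by positivity)]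
    rfl

/-- A homotopy with fixed ends of the first part of the motion leaves the rest untouched. Braid
relations are applied in this form. -/
theorem braidFam_concat_homotopy {n : ℕ} {L : ℝ} (hL : 0 ≤ L) {ρ : Equiv.Perm ℕ}
    (hρ : Set.MapsTo ρ (Set.Icc 1 n) (Set.Icc 1 n)) (v : BraidWord n)
    {K : ℝ → ℝ → ℕ → ℝ × ℝ} (K0 : ∀ s j, K s 0 j = ((j : ℝ), 0))
    (KL : ∀ s j, K s L j = ((ρ j : ℝ), 0))
    (cK : ∀ j, Continuous fun q : ℝ × ℝ => K q.1 q.2 j)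
    (pos : ∀ s ∈ Set.Icc (0 : ℝ) 1, ∀ x ∈ Set.Icc 0 L, ∀ j ∈ Set.Icc 1 n, 0 < (K s x j).1)
    (hne : ∀ s ∈ Set.Icc (0 : ℝ) 1, ∀ x ∈ Set.Icc 0 L, ∀ i ∈ Set.Icc 1 n,
      ∀ j ∈ Set.Icc 1 n, K s x i = K s x j → i = j)
    (l0 : ∀ j, LocallyLipschitz fun x => K 0 x j) (l1 : ∀ j, LocallyLipschitz fun x => K 1 x j) :
    FamIso
      (braidFam n (wordPerm v * ρ) fun u => concatMotion L (K 0) ρ v ((L + v.length) * u))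
      (braidFam n (wordPerm v * ρ) fun u => concatMotion L (K 1) ρ v ((L + v.length) * u)) := by
  have hv : (0 : ℝ) ≤ v.length := Nat.cast_nonneg _
  have hπ : Set.MapsTo (wordPerm v * ρ) (Set.Icc 1 n) (Set.Icc 1 n) := fun j hj =>
    mapsTo_wordPerm v (hρ hj)
  have hmul : LocallyLipschitz fun u : ℝ => (L + v.length) * u :=
    ContDiff.locallyLipschitz (𝕂 := ℝ) (by fun_prop)
  have hlip : ∀ s j, (LocallyLipschitz fun x => K s x j) →
      LocallyLipschitz fun u => concatMotion L (K s) ρ v ((L + v.length) * u) j := by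
    intro s j hK
    have : LocallyLipschitz fun x => concatMotion L (K s) ρ v x j := by
      refine LocallyLipschitz.if_le hK
        ((locallyLipschitz_wordMotion v (ρ j)).comp (locallyLipschitz_sub_const L)) ?_
      simp [KL, wordMotion_zero]
    exact this.comp hmul
  refine braidFam_homotopy hπ (p := fun s u => concatMotion L (K s) ρ v ((L + v.length) * u))
    ?_ ?_ ?_ ?_ (fun j _ => hlip 0 j (l0 j)) (fun j _ => hlip 1 j (l1 j))
  · intro s _ j _
    have e : concatMotion L (K s) ρ v ((L + v.length) * 0) ((wordPerm v * ρ) j) =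
        ((((wordPerm v * ρ) j : ℕ) : ℝ), 0) := by
      rw [concatMotion, mul_zero, if_pos hL, K0]
    rw [e, concatMotion, mul_one, add_sub_cancel_left, wordMotion_of_le v _ le_rfl]
    split_ifs with h
    · have h1 : (v.length : ℝ) = 0 := le_antisymm (by linarith) hv
      have h2 : v = [] := List.length_eq_zero_iff.1 (by exact_mod_cast h1)
      rw [h1, add_zero, KL, h2]
      rfl
    · rfl
  · intro j _
    refine Continuous.if_le ?_ ?_ (by fun_prop) continuous_const ?_
    · exact (cK j).comp (continuous_fst.prodMk (by fun_prop :
        Continuous fun q : ℝ × ℝ => (L + v.length) * q.2))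
    · exact (continuous_wordMotion v (ρ j)).comp (by fun_prop)
    · intro q hq
      simp only [hq, KL, sub_self, wordMotion_zero]
  · intro s hs u hu j hj
    have hu0 := hu.1
    simp only [concatMotion]
    split_ifs with h
    · exact pos s hs _ ⟨by positivity, h⟩ j hj
    · exact wordMotion_pos v (by linarith) (hρ hj)
  · intro s hs u hu i hi j hj h
    have hu0 := hu.1
    simp only [concatMotion] at h
    split_ifs at h with h1
    · exact hne s hs _ ⟨by positivity, h1⟩ i hi j hj h
    · exact ρ.injective (wordMotion_injective v (by linarith) h)

theorem braidFam_concat_linear {n : ℕ} {L : ℝ} (hL : 0 ≤ L) {ρ : Equiv.Perm ℕ}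
    (hρ : Set.MapsTo ρ (Set.Icc 1 n) (Set.Icc 1 n)) (v : BraidWord n)
    {a b : ℝ → ℕ → ℝ × ℝ} (a0 : ∀ j, a 0 j = ((j : ℝ), 0)) (aL : ∀ j, a L j = ((ρ j : ℝ), 0))
    (b0 : ∀ j, b 0 j = ((j : ℝ), 0)) (bL : ∀ j, b L j = ((ρ j : ℝ), 0))
    (la : ∀ j, LocallyLipschitz fun x => a x j) (lb : ∀ j, LocallyLipschitz fun x => b x j)
    (pa : ∀ x ∈ Set.Icc 0 L, ∀ j ∈ Set.Icc 1 n, 0 < (a x j).1)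
    (pb : ∀ x ∈ Set.Icc 0 L, ∀ j ∈ Set.Icc 1 n, 0 < (b x j).1)
    (hne : ∀ s ∈ Set.Icc (0 : ℝ) 1, ∀ x ∈ Set.Icc 0 L, ∀ i ∈ Set.Icc 1 n, ∀ j ∈ Set.Icc 1 n, i < j →
      (1 - s) * ((a x i).1 - (a x j).1) + s * ((b x i).1 - (b x j).1) = 0 →
      (1 - s) * ((a x i).2 - (a x j).2) + s * ((b x i).2 - (b x j).2) = 0 → False) :
    FamIso
      (braidFam n (wordPerm v * ρ) fun u => concatMotion L a ρ v ((L + v.length) * u))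
      (braidFam n (wordPerm v * ρ) fun u => concatMotion L b ρ v ((L + v.length) * u)) := by
  have e0 : (fun x j => (1 - (0 : ℝ)) • a x j + (0 : ℝ) • b x j) = a := by
    funext x j; simp
  have e1 : (fun x j => (1 - (1 : ℝ)) • a x j + (1 : ℝ) • b x j) = b := by
    funext x j; simp
  have := braidFam_concat_homotopy hL hρ v (K := fun s x j => (1 - s) • a x j + s • b x j)
    (fun s j => by rw [a0, b0]; module) (fun s j => by rw [aL, bL]; module)
    (fun j => by
      have h1 := (la j).continuous
      have h2 := (lb j).continuous
      have h3 : Continuous fun q : ℝ × ℝ => a q.2 j := h1.comp continuous_snd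
      have h4 : Continuous fun q : ℝ × ℝ => b q.2 j := h2.comp continuous_snd
      fun_prop)
    (fun s hs x hx j hj => by
      have h1 := pa x hx j hj
      have h2 := pb x hx j hj
      simp only [Prod.fst_add, Prod.smul_fst, smul_eq_mul]
      rcases hs.1.eq_or_lt with rfl | h3
      · simpa using h1
      · have : 0 ≤ 1 - s := by linarith [hs.2]
        positivity)
    (fun s hs x hx i hi j hj h => by
      have h1 := congrArg Prod.fst h
      have h2 := congrArg Prod.snd h
      simp only [Prod.fst_add, Prod.smul_fst, Prod.snd_add, Prod.smul_snd, smul_eq_mul] at h1 h2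
      rcases lt_trichotomy i j with h3 | h3 | h3
      · exact (hne s hs x hx i hi j hj h3 (by linarith) (by linarith)).elim
      · exact h3
      · exact (hne s hs x hx j hj i hi h3 (by linarith) (by linarith)).elim)
    (fun j => by simpa using la j) (fun j => by simpa using lb j)
  rwa [e0, e1] at this

/-! ### The braid relations -/

/-- The strands that start in positions `j` and `k` do not cross with the second one on top. -/
def NoUndercrossing {n : ℕ} : BraidWord n → ℕ → ℕ → Prop
  | [], _, _ => True
  | g :: w, j, k => g.2 = true ∧ ¬ (j = g.1.1 + 1 ∧ k = g.1.1) ∧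
      NoUndercrossing w (letterPerm g j) (letterPerm g k)

/-- Two radii agree only in the middle of the crossing, where the heights are `1/2` and `-1/2`. -/
theorem letterMotion_fst_eq {n : ℕ} (g : BraidLetter n) (hg : g.2 = true) {s : ℝ} (h0 : 0 ≤ s)
    (h1 : s ≤ 1) {j k : ℕ} (hjk : j ≠ k) (hng : ¬ (j = g.1.1 + 1 ∧ k = g.1.1))
    (h : (letterMotion g j s).1 = (letterMotion g k s).1) :
    (letterMotion g k s).2 < (letterMotion g j s).2 := by
  by_contra hlt
  have e : j = k ∨ (j = g.1.1 ∧ k = g.1.1 + 1) := by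
    obtain ⟨⟨i, hi⟩, b⟩ := g
    simp only [letterMotion] at *
    have key : ∀ a b : ℕ, (a : ℝ) + s = b → b = a ∨ b = a + 1 := by
      intro a b hab
      have h2 : a ≤ b := by exact_mod_cast (by linarith : (a : ℝ) ≤ b)
      have h3 : b ≤ a + 1 := by exact_mod_cast (by linarith : (b : ℝ) ≤ a + 1)
      omega
    have key' : ∀ a b : ℕ, (a : ℝ) + 1 - s = b → b = a ∨ b = a + 1 := by
      intro a b hab
      have h2 : a ≤ b := by exact_mod_cast (by linarith : (a : ℝ) ≤ b)
      have h3 : b ≤ a + 1 := by exact_mod_cast (by linarith : (b : ℝ) ≤ a + 1)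
      omega
    split_ifs at h with c1 c2 c3 c4 c5 c6 c7 <;> simp only at h
    all_goals first
      | omega
      | (have := key _ _ h; omega)
      | (have := key' _ _ h; omega)
      | (have := key _ _ h.symm; omega)
      | (have := key' _ _ h.symm; omega)
      | (left; exact_mod_cast h)
  rcases e with e | ⟨rfl, rfl⟩
  · exact hjk e
  · simp only [letterMotion, if_true, Nat.succ_ne_self, if_false, hg] at h hlt
    have hs : s = 1 / 2 := by linarith
    subst hs
    norm_num at hlt

theorem wordMotion_snd_lt {n : ℕ} (w : BraidWord n) {s : ℝ} (h0 : 0 ≤ s) {j k : ℕ} (hjk : j ≠ k)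
    (hw : NoUndercrossing w j k) (h : (wordMotion w j s).1 = (wordMotion w k s).1) :
    (wordMotion w k s).2 < (wordMotion w j s).2 := by
  induction w generalizing j k s with
  | nil =>
    simp only [wordMotion] at h
    exact (hjk (by exact_mod_cast h)).elim
  | cons g w ih =>
    obtain ⟨h1, h2, h3⟩ := hw
    by_cases hs : s ≤ 1
    · simp only [wordMotion, hs, if_true] at h ⊢
      exact letterMotion_fst_eq g h1 h0 hs hjk h2 h
    · simp only [wordMotion, hs, if_false] at h ⊢
      exact ih (by linarith) ((letterPerm g).injective.ne hjk) h3 h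

/-- Two positive words in which any two strands cross at most once, and that cause the same
permutation, represent the same braid. -/
theorem closedFam_eq_of_noUndercrossing {n : ℕ} {m m' : BraidWord n} (v : BraidWord n)
    (hlen : m.length = m'.length) (hperm : wordPerm m = wordPerm m')
    (hm : ∀ j k, j < k → NoUndercrossing m j k) (hm' : ∀ j k, j < k → NoUndercrossing m' j k) :
    FamIso (closedFam (m ++ v)) (closedFam (m' ++ v)) := by
  have F1 := closedFam_append_eq m v
  have F2 := closedFam_append_eq m' v
  rw [← hlen, ← hperm] at F2
  refine F1.trans (FamIso.trans ?_ F2.symm)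
  set L : ℝ := (m.length : ℝ) with hL
  have hL0 : 0 ≤ L := Nat.cast_nonneg _
  set ρ := wordPerm m
  have hρ : Set.MapsTo ρ (Set.Icc 1 n) (Set.Icc 1 n) := mapsTo_wordPerm m
  have mL : ∀ j, wordMotion m j L = ((ρ j : ℝ), 0) := fun j => wordMotion_of_le m j le_rfl
  have mL' : ∀ j, wordMotion m' j L = ((ρ j : ℝ), 0) := fun j => by
    rw [wordMotion_of_le m' j (by rw [hL, hlen]), ← hperm]
  have lh : ∀ j : ℕ, LocallyLipschitz fun x : ℝ => -(x * (L - x)) * j := fun j =>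
    ContDiff.locallyLipschitz (𝕂 := ℝ) (by fun_prop)
  have lfst : ∀ (w : BraidWord n) j, LocallyLipschitz fun x => (wordMotion w j x).1 := fun w j =>
    LipschitzWith.prod_fst.locallyLipschitz.comp (locallyLipschitz_wordMotion w j)
  -- The motion in layers: the radii of `w`, but a height that depends only on the starting position
  -- and puts smaller positions above. By `wordMotion_snd_lt` the original heights are ordered in
  -- the same way wherever radii agree, so linear interpolation causes no collision.
  let b : BraidWord n → ℝ → ℕ → ℝ × ℝ := fun w x j => ((wordMotion w j x).1, -(x * (L - x)) * j)
  have lb : ∀ w j, LocallyLipschitz fun x => b w x j := fun w j =>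
    locallyLipschitz_prodMk' (lfst w j) (lh j)
  have b0 : ∀ w j, b w 0 j = ((j : ℝ), 0) := fun w j => by simp [b, wordMotion_zero]
  have bL : ∀ j, b m L j = ((ρ j : ℝ), 0) := fun j => by simp [b, mL]
  have bL' : ∀ j, b m' L j = ((ρ j : ℝ), 0) := fun j => by simp [b, mL']
  have pb : ∀ w : BraidWord n, ∀ x ∈ Set.Icc 0 L, ∀ j ∈ Set.Icc 1 n, 0 < (b w x j).1 :=
    fun w x hx j hj => wordMotion_pos w hx.1 hj
  -- At both ends of the time interval the layers coincide, but there the radii are distinct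
  -- integers, the same for both words.
  have ends : ∀ x ∈ Set.Icc 0 L, ∀ j k : ℕ, j < k → x * (L - x) = 0 →
      (wordMotion m j x).1 = (wordMotion m' j x).1 ∧
      (wordMotion m j x).1 ≠ (wordMotion m k x).1 := by
    intro x hx j k hjk h0
    rcases mul_eq_zero.1 h0 with h | h
    · rw [h, wordMotion_zero, wordMotion_zero, wordMotion_zero]
      exact ⟨rfl, by simpa using hjk.ne⟩
    · rw [← sub_eq_zero.1 h, mL, mL', mL]
      exact ⟨rfl, by simpa using hjk.ne⟩
  have step : ∀ w : BraidWord n, (∀ j k, j < k → NoUndercrossing w j k) →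
      ∀ s ∈ Set.Icc (0 : ℝ) 1, ∀ x ∈ Set.Icc 0 L, ∀ i ∈ Set.Icc 1 n, ∀ j ∈ Set.Icc 1 n, i < j →
      (x * (L - x) = 0 → (wordMotion w i x).1 ≠ (wordMotion w j x).1) →
      (1 - s) * ((wordMotion w i x).1 - (wordMotion w j x).1) +
        s * ((b w x i).1 - (b w x j).1) = 0 →
      (1 - s) * ((wordMotion w i x).2 - (wordMotion w j x).2) +
        s * ((b w x i).2 - (b w x j).2) = 0 → False := by
    intro w hw s hs x hx i hi j hj hij hends h1 h2
    simp only [b] at h1 h2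
    have e1 : (wordMotion w i x).1 = (wordMotion w j x).1 := by linarith
    have e2 := wordMotion_snd_lt w hx.1 hij.ne (hw i j hij) e1
    have e3 : 0 < x * (L - x) := by
      refine lt_of_le_of_ne (mul_nonneg hx.1 (by linarith [hx.2])) fun h => hends h.symm e1
    have e4 : (i : ℝ) < j := by exact_mod_cast hij
    have e5 : 0 < x * (L - x) * ((j : ℝ) - i) := mul_pos e3 (by linarith)
    have s0 := hs.1
    have s1 : 0 ≤ 1 - s := by linarith [hs.2]
    rcases s0.eq_or_lt with rfl | s0
    · linarith
    · have e6 := mul_pos s0 e5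
      have e7 := mul_nonneg s1 (sub_pos.2 e2).le
      nlinarith
  have ends' : ∀ x ∈ Set.Icc 0 L, ∀ j k : ℕ, j < k → x * (L - x) = 0 →
      (wordMotion m' j x).1 ≠ (wordMotion m' k x).1 := by
    intro x hx j k hjk h0 h
    rcases mul_eq_zero.1 h0 with h3 | h3
    · rw [h3, wordMotion_zero, wordMotion_zero] at h
      exact hjk.ne (by simpa using h)
    · rw [← sub_eq_zero.1 h3, mL', mL'] at h
      exact hjk.ne (by simpa using h)
  have A1 := braidFam_concat_linear hL0 hρ v (a := fun x j => wordMotion m j x) (b := b m)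
    (wordMotion_zero m) mL (b0 m) bL (locallyLipschitz_wordMotion m) (lb m)
    (fun x hx j hj => wordMotion_pos m hx.1 hj) (pb m)
    (fun s hs x hx i hi j hj hij => step m hm s hs x hx i hi j hj hij
      fun h => (ends x hx i j hij h).2)
  have A3 := braidFam_concat_linear hL0 hρ v (a := fun x j => wordMotion m' j x) (b := b m')
    (wordMotion_zero m') mL' (b0 m') bL' (locallyLipschitz_wordMotion m') (lb m')
    (fun x hx j hj => wordMotion_pos m' hx.1 hj) (pb m')
    (fun s hs x hx i hi j hj hij => step m' hm' s hs x hx i hi j hj hij (ends' x hx i j hij))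
  -- Strands in different layers cannot meet, so the radial motion of one word may be deformed into
  -- that of the other.
  have A2 := braidFam_concat_linear hL0 hρ v (a := b m) (b := b m')
    (b0 m) bL (b0 m') bL' (lb m) (lb m') (pb m) (pb m')
    (fun s hs x hx i hi j hj hij h1 h2 => by
      simp only [b] at h1 h2
      have e4 : (i : ℝ) < j := by exact_mod_cast hij
      have e5 : x * (L - x) * ((j : ℝ) - i) = 0 := by linarith
      have e6 : x * (L - x) = 0 := by
        rcases mul_eq_zero.1 e5 with h | h
        · exact h
        · linarith
      have f1 := ends x hx i j hij e6
      have f2 : (wordMotion m j x).1 = (wordMotion m' j x).1 := (ends x hx j (j + 1) (by omega) e6).1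
      rw [← f1.1, ← f2] at h1
      exact f1.2 (by linarith))
  exact (A1.trans A2).trans A3.symm

theorem letterMotion_inv {n : ℕ} (i : BraidGen n) (b : Bool) (j : ℕ) (s : ℝ) :
    letterMotion (n := n) (i, !b) (letterPerm (n := n) (i, b) j) s =
      letterMotion (n := n) (i, b) j (1 - s) := by
  have hmin : min (1 - s) s = min s (1 - s) := min_comm _ _
  by_cases h1 : j = i.1
  · cases b <;> simp [letterMotion, letterPerm, h1, hmin] <;> ring
  · by_cases h2 : j = i.1 + 1
    · cases b <;> simp [letterMotion, letterPerm, h2, hmin] <;> ring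
    · simp [letterMotion, letterPerm, h1, h2, Equiv.swap_apply_of_ne_of_ne]

/-- The second letter retraces the first one backwards (`letterMotion_inv`). Turning back already at
time `s` shrinks this excursion to rest. -/
theorem closedFam_cancel {n : ℕ} (i : BraidGen n) (b : Bool) (v : BraidWord n) :
    FamIso (closedFam ((i, b) :: (i, !b) :: v)) (closedFam v) := by
  have hv : (0 : ℝ) ≤ v.length := Nat.cast_nonneg _
  let g : BraidLetter n := (i, b)
  have hperm : wordPerm [(i, b), (i, !b)] = 1 := by
    simp [wordPerm, letterPerm, Equiv.swap_mul_self]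
  have F1 := closedFam_append_eq [(i, b), (i, !b)] v
  rw [hperm] at F1
  have hid : Set.MapsTo (1 : Equiv.Perm ℕ) (Set.Icc 1 n) (Set.Icc 1 n) := fun _ h => h
  have htent : ∀ s ∈ Set.Icc (0 : ℝ) 1, ∀ x ∈ Set.Icc (0 : ℝ) 2,
      0 ≤ s * min x (2 - x) ∧ s * min x (2 - x) ≤ 1 := by
    intro s hs x hx
    have h1 : 0 ≤ min x (2 - x) := le_min hx.1 (by linarith [hx.2])
    have h2 : min x (2 - x) ≤ 1 := by
      rcases le_total x 1 with h | h
      · exact (min_le_left _ _).trans h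
      · exact (min_le_right _ _).trans (by linarith)
    exact ⟨mul_nonneg hs.1 h1, mul_le_one₀ hs.2 h1 h2⟩
  have lt : LocallyLipschitz fun x : ℝ => min x (2 - x) :=
    LocallyLipschitz.id.real_min (ContDiff.locallyLipschitz (𝕂 := ℝ) (by fun_prop))
  have lr : ∀ s : ℝ, LocallyLipschitz fun x : ℝ => s * min x (2 - x) := fun s =>
    (LocallyLipschitz.const s).real_mul lt
  have F2 := braidFam_concat_homotopy (L := 2) (by norm_num) hid v
    (K := fun s x j => letterMotion g j (s * min x (2 - x)))
    (fun s j => by norm_num [letterMotion_zero]) (fun s j => by norm_num [letterMotion_zero])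
    (fun j => (continuous_letterMotion g j).comp (by fun_prop))
    (fun s hs x hx j hj => by
      have := wordMotion_pos [g] (htent s hs x hx).1 hj
      simpa only [wordMotion, (htent s hs x hx).2, if_true] using this)
    (fun s hs x hx k hk j hj h =>
      letterMotion_injective g (htent s hs x hx).1 (htent s hs x hx).2 h)
    (fun j => (locallyLipschitz_letterMotion g j).comp (lr 0))
    (fun j => (locallyLipschitz_letterMotion g j).comp (lr 1))
  -- The word `v` after two units of rest, the time that the cancelled letters took.
  have F3 := closedFam_retime v (τ := fun u => max 0 ((2 + v.length) * u - 2))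
    (lipschitzWith_max.locallyLipschitz.comp (locallyLipschitz_prodMk' (LocallyLipschitz.const 0)
      (ContDiff.locallyLipschitz (𝕂 := ℝ) (by fun_prop)))) (by norm_num) (by norm_num)
    (fun u _ => le_max_left _ _)
  refine F1.trans (FamIso.trans ?_ (F2.symm.trans (FamIso.trans ?_ F3.symm)))
  · rw [braidFam_congr (p' := fun u => concatMotion 2 (fun x j => letterMotion g j
      (1 * min x (2 - x))) 1 v ((2 + v.length) * u))]
    · exact FamIso.refl _
    · rw [mul_one]; exact mapsTo_wordPerm v
    · intro u hu j hj
      simp only [concatMotion, List.length_cons, List.length_nil]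
      norm_num only
      have h0 : 0 ≤ (2 + (v.length : ℝ)) * u := by have := hu.1; positivity
      set x := (2 + (v.length : ℝ)) * u
      by_cases h2 : x ≤ 2
      · simp only [h2, if_true, wordMotion]
        by_cases h1 : x ≤ 1
        · rw [if_pos h1, min_eq_left (by linarith), one_mul]
        · rw [if_neg h1, if_pos (by linarith), min_eq_right (by linarith), letterMotion_inv]
          congr 1
          ring
      · simp only [h2, if_false]
  · rw [mul_one, braidFam_congr (mapsTo_wordPerm v)]
    · exact FamIso.refl _
    · intro u hu j hj
      simp only [concatMotion, zero_mul, letterMotion_zero]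
      split_ifs with h
      · rw [max_eq_left (by linarith), wordMotion_zero]
      · rw [max_eq_right (by linarith)]
        rfl

/-! ### The closure of a braid -/

/-- Words that may be exchanged in every closed braid. -/
def exchangeCon (n : ℕ) : Con (FreeMonoid (BraidLetter n)) where
  r w w' := ∀ v : BraidWord n, FamIso (closedFam (w.toList ++ v)) (closedFam (w'.toList ++ v))
  iseqv := ⟨fun _ _ => FamIso.refl _, fun h v => (h v).symm, fun h h' v => (h v).trans (h' v)⟩
  -- Cyclic rotation brings each factor in turn to the front, where it may be exchanged.
  mul' := by
    intro w x y z h1 h2 v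
    rw [FreeMonoid.toList_mul, FreeMonoid.toList_mul]
    have e1 := h1 (y.toList ++ v)
    have e2 := closedFam_append_comm x.toList (y.toList ++ v)
    have e3 := h2 (v ++ x.toList)
    have e4 := closedFam_append_comm (z.toList ++ v) x.toList
    simp only [List.append_assoc] at *
    exact ((e1.trans e2).trans e3).trans e4

theorem exchangeCon_apply {n : ℕ} {w w' : BraidWord n}
    (h : ∀ v : BraidWord n, FamIso (closedFam (w ++ v)) (closedFam (w' ++ v))) :
    ((FreeMonoid.ofList w : FreeMonoid (BraidLetter n)) : (exchangeCon n).Quotient) =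
      (FreeMonoid.ofList w' : FreeMonoid (BraidLetter n)) :=
  (Con.eq _).2 h

theorem exchangeCon_ofList_append {n : ℕ} (u v : BraidWord n) :
    ((FreeMonoid.ofList (u ++ v) : FreeMonoid (BraidLetter n)) : (exchangeCon n).Quotient) =
      (FreeMonoid.ofList u : FreeMonoid (BraidLetter n)) *
      (FreeMonoid.ofList v : FreeMonoid (BraidLetter n)) := rfl

/-- The class of the generator `σ_i`, an invertible element. -/
def exchangeUnit {n : ℕ} (i : BraidGen n) : (exchangeCon n).Quotientˣ where
  val := ((FreeMonoid.ofList [(i, true)] : FreeMonoid (BraidLetter n)) : (exchangeCon n).Quotient)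
  inv := ((FreeMonoid.ofList [(i, false)] : FreeMonoid (BraidLetter n)) : (exchangeCon n).Quotient)
  val_inv := exchangeCon_apply (w := [(i, true), (i, false)]) (w' := []) (closedFam_cancel i true)
  inv_val := exchangeCon_apply (w := [(i, false), (i, true)]) (w' := []) (closedFam_cancel i false)

/-- Both sides of an Artin relation are positive words in which two strands cross at most once, so
`closedFam_eq_of_noUndercrossing` applies; the permutations and crossings are finite checks. -/
theorem exchangeUnit_rels {n : ℕ} : ∀ r ∈ artinRels n, FreeGroup.lift exchangeUnit r = 1 := by
  rintro r (⟨i, j, hij, rfl⟩ | ⟨i, j, hij, rfl⟩)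
  · simp only [map_mul, map_inv, FreeGroup.lift_apply_of]
    rw [mul_inv_eq_one]
    ext
    refine exchangeCon_apply (w := [(i, true), (j, true)]) (w' := [(j, true), (i, true)])
      fun v => closedFam_eq_of_noUndercrossing v rfl ?_ ?_ ?_
    · ext k
      simp only [wordPerm, letterPerm, one_mul, Equiv.Perm.mul_apply, Equiv.swap_apply_def]
      split_ifs <;> omega
    all_goals
      intro k l hkl
      simp only [NoUndercrossing, letterPerm, Equiv.swap_apply_def, true_and, and_true]
      split_ifs <;> omega
  · simp only [map_mul, map_inv, FreeGroup.lift_apply_of]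
    rw [mul_inv_eq_one]
    obtain ⟨i, hi⟩ := i
    obtain ⟨j, hj⟩ := j
    obtain rfl : i + 1 = j := hij
    ext
    refine exchangeCon_apply (w := [(⟨i, hi⟩, true), (⟨i + 1, hj⟩, true), (⟨i, hi⟩, true)])
      (w' := [(⟨i + 1, hj⟩, true), (⟨i, hi⟩, true), (⟨i + 1, hj⟩, true)])
      fun v => closedFam_eq_of_noUndercrossing v rfl ?_ ?_ ?_
    · ext k
      simp only [wordPerm, letterPerm, one_mul, Equiv.Perm.mul_apply, Equiv.swap_apply_def]
      split_ifs <;> omega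
    all_goals
      intro k l hkl
      have e1 : ¬ i + 1 + 1 = i := by omega
      have e2 : ¬ i = i + 1 + 1 := by omega
      have hk : k = i ∨ k = i + 1 ∨ k = i + 1 + 1 ∨ (k ≠ i ∧ k ≠ i + 1 ∧ k ≠ i + 1 + 1) := by omega
      have hl : l = i ∨ l = i + 1 ∨ l = i + 1 + 1 ∨ (l ≠ i ∧ l ≠ i + 1 ∧ l ≠ i + 1 + 1) := by omega
      rcases hk with rfl | rfl | rfl | ⟨k1, k2, k3⟩ <;>
      rcases hl with rfl | rfl | rfl | ⟨l1, l2, l3⟩ <;>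
      first
      | omega
      | simp [NoUndercrossing, letterPerm, Equiv.swap_apply_def, *]

/-- The class of a braid. -/
def exchangeHom (n : ℕ) : BraidGroup n →* (exchangeCon n).Quotientˣ :=
  PresentedGroup.toGroup exchangeUnit_rels

theorem toBraid_append {n : ℕ} (u v : BraidWord n) :
    (u ++ v : BraidWord n).toBraid = BraidWord.toBraid u * BraidWord.toBraid v := by
  rw [BraidWord.toBraid, BraidWord.toBraid, BraidWord.toBraid, ← map_mul, FreeGroup.mul_mk]

theorem toBraid_singleton {n : ℕ} (i : BraidGen n) :
    BraidWord.toBraid [(i, true)] = PresentedGroup.of (rels := artinRels n) i := rfl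

theorem toBraid_singleton_inv {n : ℕ} (i : BraidGen n) :
    BraidWord.toBraid [(i, false)] = (PresentedGroup.of (rels := artinRels n) i)⁻¹ := rfl

/-- The universal property of the presentation does the work: the exchange class of a word is a
function of its braid, without any induction along chains of relations. -/
theorem exchangeHom_toBraid {n : ℕ} (w : BraidWord n) :
    (exchangeHom n w.toBraid : (exchangeCon n).Quotient) =
      (FreeMonoid.ofList w : FreeMonoid (BraidLetter n)) := by
  induction w with
  | nil =>
    have : BraidWord.toBraid ([] : BraidWord n) = 1 := rfl
    rw [this, map_one]
    rfl
  | cons g w ih =>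
    have h : (g :: w : BraidWord n) = [g] ++ w := rfl
    rw [h, toBraid_append, map_mul, Units.val_mul, ih, exchangeCon_ofList_append]
    congr 1
    obtain ⟨i, _ | _⟩ := g
    · rw [toBraid_singleton_inv, map_inv, exchangeHom, PresentedGroup.toGroup.of]
      rfl
    · rw [toBraid_singleton, exchangeHom, PresentedGroup.toGroup.of]
      rfl

theorem closedFam_of_toBraid_eq {n : ℕ} {w w' : BraidWord n} (h : w.toBraid = w'.toBraid) :
    FamIso (closedFam w) (closedFam w') := by
  have h1 := exchangeHom_toBraid w
  rw [h, exchangeHom_toBraid] at h1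
  have h2 : ∀ v : BraidWord n, FamIso (closedFam (w' ++ v)) (closedFam (w ++ v)) :=
    (Con.eq _).1 h1
  have := h2 []
  rw [List.append_nil, List.append_nil] at this
  exact this.symm

theorem exists_toBraid_eq {n : ℕ} (β : BraidGroup n) : ∃ w : BraidWord n, w.toBraid = β := by
  obtain ⟨x, rfl⟩ := PresentedGroup.mk_surjective (artinRels n) β
  exact ⟨x.toWord, by rw [BraidWord.toBraid, FreeGroup.mk_toWord]⟩

/-- The closures of two braids are isotopic, through strands. -/
def ClosureIso {n₁ n₂ : ℕ} (β₁ : BraidGroup n₁) (β₂ : BraidGroup n₂) : Prop :=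
  ∀ (w₁ : BraidWord n₁) (w₂ : BraidWord n₂), w₁.toBraid = β₁ → w₂.toBraid = β₂ →
    FamIso (closedFam w₁) (closedFam w₂)

theorem ClosureIso.sameClosure {n₁ n₂ : ℕ} {β₁ : BraidGroup n₁} {β₂ : BraidGroup n₂}
    (h : ClosureIso β₁ β₂) : SameClosure β₁ β₂ :=
  fun w₁ w₂ h₁ h₂ => (h w₁ w₂ h₁ h₂).isotopic

theorem closureIso_of_words {n₁ n₂ : ℕ} {w₁ : BraidWord n₁} {w₂ : BraidWord n₂}
    (h : FamIso (closedFam w₁) (closedFam w₂)) : ClosureIso w₁.toBraid w₂.toBraid :=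
  fun _ _ h₁ h₂ => ((closedFam_of_toBraid_eq h₁).trans h).trans (closedFam_of_toBraid_eq h₂.symm)

theorem ClosureIso.refl {n : ℕ} (β : BraidGroup n) : ClosureIso β β :=
  fun _ _ h₁ h₂ => closedFam_of_toBraid_eq (h₁.trans h₂.symm)

theorem ClosureIso.symm {n₁ n₂ : ℕ} {β₁ : BraidGroup n₁} {β₂ : BraidGroup n₂}
    (h : ClosureIso β₁ β₂) : ClosureIso β₂ β₁ :=
  fun w₂ w₁ h₂ h₁ => (h w₁ w₂ h₁ h₂).symm

theorem ClosureIso.trans {n₁ n₂ n₃ : ℕ} {β₁ : BraidGroup n₁} {β₂ : BraidGroup n₂}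
    {β₃ : BraidGroup n₃} (h : ClosureIso β₁ β₂) (h' : ClosureIso β₂ β₃) : ClosureIso β₁ β₃ := by
  intro w₁ w₃ h₁ h₃
  obtain ⟨w₂, h₂⟩ := exists_toBraid_eq β₂
  exact (h w₁ w₂ h₁ h₂).trans (h' w₂ w₃ h₂ h₃)

theorem closureIso_mul_comm {n : ℕ} (α β : BraidGroup n) : ClosureIso (α * β) (β * α) := by
  obtain ⟨u, rfl⟩ := exists_toBraid_eq α
  obtain ⟨v, rfl⟩ := exists_toBraid_eq β
  rw [← toBraid_append, ← toBraid_append]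
  exact closureIso_of_words (closedFam_append_comm u v)

theorem closureIso_conj {n : ℕ} (α β : BraidGroup n) : ClosureIso (α * β * α⁻¹) β := by
  have := closureIso_mul_comm (α * β) α⁻¹
  rwa [inv_mul_cancel_left] at this

/-! ### Sequences that satisfy the braid relations -/

/-- The elements `s 1, …, s (N - 1)` satisfy the Artin relations. -/
structure IsBraidSeq {G : Type} [Group G] (N : ℕ) (s : ℕ → G) : Prop where
  comm : ∀ i j, 1 ≤ i → i + 2 ≤ j → j < N → Commute (s i) (s j)
  braid : ∀ i, 1 ≤ i → i + 1 < N → s i * s (i + 1) * s i = s (i + 1) * s i * s (i + 1)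

section BraidSeq

variable {G : Type} [Group G]

/-- The product `s 1 * ⋯ * s k`. -/
def ascending (s : ℕ → G) : ℕ → G
  | 0 => 1
  | k + 1 => ascending s k * s (k + 1)

/-- The product `s (b + l) * ⋯ * s (b + 1)`. -/
def descending (s : ℕ → G) (b : ℕ) : ℕ → G
  | 0 => 1
  | l + 1 => s (b + l + 1) * descending s b l

/-- The half twist on the first `k + 1` strands. -/
def halfTwist (s : ℕ → G) : ℕ → G
  | 0 => 1
  | k + 1 => ascending s (k + 1) * halfTwist s k

theorem descending_succ' (s : ℕ → G) (b l : ℕ) :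
    descending s b (l + 1) = descending s (b + 1) l * s (b + 1) := by
  induction l with
  | zero => simp [descending]
  | succ l ih =>
    rw [descending, ih, descending, mul_assoc]
    congr 2
    omega

variable {N : ℕ} {s : ℕ → G}

theorem IsBraidSeq.commute_ascending (h : IsBraidSeq N s) {k j : ℕ} (hk : k + 2 ≤ j) (hj : j < N) :
    Commute (ascending s k) (s j) := by
  induction k with
  | zero => exact Commute.one_left _
  | succ k ih => exact (ih (by omega)).mul_left (h.comm _ _ (by omega) (by omega) hj)

theorem IsBraidSeq.commute_descending (h : IsBraidSeq N s) {b l j : ℕ} (hl : b + l + 2 ≤ j)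
    (hj : j < N) : Commute (descending s b l) (s j) := by
  induction l with
  | zero => exact Commute.one_left _
  | succ l ih => exact (h.comm _ _ (by omega) (by omega) hj).mul_left (ih (by omega))

/-- Only the factors `s i` and `s (i + 1)` of the product matter: the later ones commute with `s i`,
the earlier ones with `s (i + 1)`, and the braid relation does the rest. -/
theorem IsBraidSeq.ascending_mul (h : IsBraidSeq N s) {k i : ℕ} (hi : 1 ≤ i) (hik : i + 1 ≤ k)
    (hk : k < N) : ascending s k * s i = s (i + 1) * ascending s k := by
  induction k with
  | zero => omega
  | succ k ih =>
    rcases Nat.lt_or_ge (i + 1) (k + 1) with hlt | hge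
    · rw [ascending, mul_assoc, ← (h.comm i (k + 1) hi (by omega) hk).eq, ← mul_assoc,
        ih (by omega) (by omega), mul_assoc]
    · obtain ⟨k, rfl⟩ : ∃ c, k = c + 1 := ⟨k - 1, by omega⟩
      obtain rfl : i = k + 1 := by omega
      have hc := h.commute_ascending (k := k) (j := k + 1 + 1) (by omega) hk
      have hb := h.braid (k + 1) hi hk
      calc ascending s (k + 1 + 1) * s (k + 1)
          = ascending s k * (s (k + 1) * s (k + 1 + 1) * s (k + 1)) := by
            simp only [ascending, mul_assoc]
        _ = ascending s k * s (k + 1 + 1) * (s (k + 1) * s (k + 1 + 1)) := by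
            rw [hb]; simp only [mul_assoc]
        _ = s (k + 1 + 1) * ascending s (k + 1 + 1) := by
            rw [hc.eq]; simp only [ascending, mul_assoc]

theorem IsBraidSeq.descending_mul (h : IsBraidSeq N s) {b l j : ℕ} (hj : b + 1 ≤ j)
    (hjl : j + 1 ≤ b + l) (hl : b + l < N) :
    descending s b l * s (j + 1) = s j * descending s b l := by
  induction l with
  | zero => omega
  | succ l ih =>
    rcases Nat.lt_or_ge j (b + l) with hlt | hge
    · rw [descending, mul_assoc, ih (by omega) (by omega), ← mul_assoc, ← mul_assoc,
        (h.comm j (b + l + 1) (by omega) (by omega) (by omega)).eq]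
    · obtain ⟨l, rfl⟩ : ∃ c, l = c + 1 := ⟨l - 1, by omega⟩
      obtain rfl : j = b + l + 1 := by omega
      have hc := h.commute_descending (b := b) (l := l) (j := b + l + 1 + 1) (by omega) (by omega)
      have hb := h.braid (b + l + 1) (by omega) (by omega)
      calc descending s b (l + 1 + 1) * s (b + l + 1 + 1)
          = s (b + l + 1 + 1) * s (b + l + 1) * (descending s b l * s (b + l + 1 + 1)) := by
            simp only [descending, mul_assoc, ← add_assoc]
        _ = (s (b + l + 1 + 1) * s (b + l + 1) * s (b + l + 1 + 1)) * descending s b l := by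
            rw [hc.eq]; simp only [mul_assoc]
        _ = s (b + l + 1) * descending s b (l + 1 + 1) := by
            rw [← hb]; simp only [descending, mul_assoc, ← add_assoc]

theorem IsBraidSeq.semiconjBy_descending (h : IsBraidSeq N s) {b l a c : ℕ} (hb : b ≤ a)
    (hc : a + c + 1 ≤ b + l) (hl : b + l < N) :
    SemiconjBy (descending s b l) (descending s (a + 1) c) (descending s a c) := by
  induction c with
  | zero => exact SemiconjBy.one_right _
  | succ c ih =>
    refine SemiconjBy.mul_right ?_ (ih (by omega))
    have := h.descending_mul (b := b) (l := l) (j := a + c + 1) (by omega) (by omega) hl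
    rw [SemiconjBy, show a + 1 + c + 1 = a + c + 1 + 1 by omega]
    exact this

theorem IsBraidSeq.descending_mul_ascending (h : IsBraidSeq N s) {b l k : ℕ} (hl : b + l + 1 ≤ k)
    (hk : k < N) : descending s (b + 1) l * ascending s k = ascending s k * descending s b l := by
  induction l with
  | zero => simp [descending]
  | succ l ih =>
    have := h.ascending_mul (k := k) (i := b + l + 1) (by omega) (by omega) hk
    rw [descending, mul_assoc, ih (by omega), descending, ← mul_assoc, ← mul_assoc, this,
      show b + 1 + l + 1 = b + l + 1 + 1 by omega]

/-- The last strand can be taken out of the `j`-th power. -/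
theorem IsBraidSeq.ascending_pow (h : IsBraidSeq N s) (j : ℕ) {b k : ℕ} (hk : k + 1 = b + j)
    (hN : k + 1 < N) : ascending s (k + 1) ^ j = ascending s k ^ j * descending s b j := by
  induction j generalizing b with
  | zero => simp [descending]
  | succ j ih =>
    rw [pow_succ, ih (b := b + 1) (by omega), ascending]
    rcases j with _ | l
    · obtain rfl : k = b := by omega
      simp [descending]
    · obtain rfl : k = b + l + 1 := by omega
      have hd := h.descending_mul_ascending (b := b) (l := l) (k := b + l + 1) le_rfl (by omega)
      have hc := h.commute_descending (b := b) (l := l) (j := b + l + 1 + 1) (by omega) hN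
      have hcu := h.commute_ascending (k := b + l) (j := b + l + 1 + 1) (by omega) hN
      have hb := h.braid (b + l + 1) (by omega) hN
      -- Crossing the ascending product lowers the indices of all factors of the descending one but
      -- the top factor `s (b + l + 1 + 1)`, which the braid relation absorbs.
      have key : descending s (b + 1) (l + 1) * (ascending s (b + l + 1) * s (b + l + 1 + 1)) =
          ascending s (b + l + 1) * descending s b (l + 1 + 1) := by
        calc descending s (b + 1) (l + 1) * (ascending s (b + l + 1) * s (b + l + 1 + 1))
            = s (b + l + 1 + 1) * (descending s (b + 1) l * ascending s (b + l + 1)) *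
                s (b + l + 1 + 1) := by
              rw [descending, show b + 1 + l + 1 = b + l + 1 + 1 by omega]
              simp only [mul_assoc]
          _ = s (b + l + 1 + 1) * ascending s (b + l + 1) *
                (descending s b l * s (b + l + 1 + 1)) := by rw [hd]; simp only [mul_assoc]
          _ = s (b + l + 1 + 1) * ascending s (b + l) * (s (b + l + 1) * s (b + l + 1 + 1) *
                descending s b l) := by rw [hc.eq]; simp only [ascending, mul_assoc]
          _ = ascending s (b + l) * (s (b + l + 1 + 1) * s (b + l + 1) * s (b + l + 1 + 1)) *
                descending s b l := by rw [← hcu.eq]; simp only [mul_assoc]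
          _ = ascending s (b + l + 1) * descending s b (l + 1 + 1) := by
              rw [← hb]; simp only [ascending, descending, mul_assoc, ← add_assoc]
      rw [mul_assoc, key, ← mul_assoc, ← pow_succ]

/-- The definition splits off an ascending product on the left. This second splitting, on the right,
serves `halfTwist_mul` for indices `i ≥ 2` and the square of the half twist. -/
theorem IsBraidSeq.halfTwist_succ' (h : IsBraidSeq N s) {k : ℕ} (hk : k + 1 < N) :
    halfTwist s (k + 1) = halfTwist s k * descending s 0 (k + 1) := by
  have comm : ∀ k j, k + 2 ≤ j → j < N → Commute (halfTwist s k) (s j) := by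
    intro k j hk hj
    induction k with
    | zero => exact Commute.one_left _
    | succ k ih => exact (h.commute_ascending hk hj).mul_left (ih (by omega))
  induction k with
  | zero => simp [halfTwist, ascending, descending]
  | succ k ih =>
    have hc := comm k (k + 1 + 1) le_rfl hk
    calc halfTwist s (k + 1 + 1)
        = ascending s (k + 1) * s (k + 1 + 1) * halfTwist s (k + 1) := rfl
      _ = ascending s (k + 1) * (s (k + 1 + 1) * halfTwist s k) * descending s 0 (k + 1) := by
          rw [ih (by omega)]; simp only [mul_assoc]
      _ = (ascending s (k + 1) * halfTwist s k) * (s (k + 1 + 1) * descending s 0 (k + 1)) := by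
          rw [← hc.eq]; simp only [mul_assoc]
      _ = halfTwist s (k + 1) * descending s 0 (k + 1 + 1) := by
          conv_rhs => rw [descending, zero_add]
          rfl

/-- The half twist reverses the order of the strands. For `i = 1` the left splitting raises the
index reached by induction; for `i ≥ 2` the right splitting lowers `i` first. -/
theorem IsBraidSeq.halfTwist_mul (h : IsBraidSeq N s) {k i j : ℕ} (hi : 1 ≤ i) (hj : 1 ≤ j)
    (hij : i + j = k + 1) (hk : k < N) : halfTwist s k * s i = s j * halfTwist s k := by
  induction k generalizing i j with
  | zero => omega
  | succ k ih =>
    rcases Nat.eq_or_lt_of_le hi with rfl | hi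
    · obtain rfl : j = k + 1 := by omega
      rcases k with _ | k
      · simp [halfTwist, ascending]
      · rw [halfTwist, mul_assoc, ih (i := 1) (j := k + 1) le_rfl (by omega) (by omega) (by omega),
          ← mul_assoc, h.ascending_mul (by omega) le_rfl hk, mul_assoc]
    · obtain ⟨i, rfl⟩ : ∃ c, i = c + 1 := ⟨i - 1, by omega⟩
      rw [h.halfTwist_succ' hk, mul_assoc, h.descending_mul (by omega) (by omega) (by omega),
        ← mul_assoc, ih (i := i) (j := j) (by omega) hj (by omega) (by omega), mul_assoc]

theorem IsBraidSeq.halfTwist_mul_ascending (h : IsBraidSeq N s) {k : ℕ} (hk : k < N) :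
    halfTwist s k * ascending s k = descending s 0 k * halfTwist s k := by
  have key : ∀ l b, b + l = k →
      halfTwist s k * ascending s l = descending s b l * halfTwist s k := by
    intro l
    induction l with
    | zero => simp [ascending, descending]
    | succ l ih =>
      intro b hb
      rw [ascending, ← mul_assoc, ih (b + 1) (by omega), mul_assoc,
        h.halfTwist_mul (i := l + 1) (j := b + 1) (by omega) (by omega) (by omega) hk,
        descending_succ', mul_assoc]
  exact key k 0 (by omega)

theorem IsBraidSeq.commute_halfTwist_sq (h : IsBraidSeq N s) {k l : ℕ} (hl : l ≤ k) (hk : k < N) :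
    Commute (halfTwist s k * halfTwist s k) (ascending s l) := by
  induction l with
  | zero => exact Commute.one_right _
  | succ l ih =>
    refine (ih (by omega)).mul_right ?_
    have h1 := h.halfTwist_mul (i := l + 1) (j := k - l) (by omega) (by omega) (by omega) hk
    have h2 := h.halfTwist_mul (i := k - l) (j := l + 1) (by omega) (by omega) (by omega) hk
    rw [Commute, SemiconjBy, mul_assoc, h1, ← mul_assoc, h2, mul_assoc]

theorem IsBraidSeq.halfTwist_mul_descending (h : IsBraidSeq N s) {k : ℕ} (hk : k < N) :
    halfTwist s k * descending s 0 k = ascending s k * halfTwist s k := by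
  have h1 := h.halfTwist_mul_ascending hk
  have h2 := (h.commute_halfTwist_sq le_rfl hk).eq
  rw [mul_assoc, h1, ← mul_assoc, ← mul_assoc] at h2
  exact mul_right_cancel h2

/-- Splitting one half twist on the left and the other on the right leaves the square of the smaller
half twist in the middle; `ascending_pow` is the same recursion for the power. -/
theorem IsBraidSeq.halfTwist_sq (h : IsBraidSeq N s) {k : ℕ} (hk : k < N) :
    halfTwist s k * halfTwist s k = ascending s k ^ (k + 1) := by
  induction k with
  | zero => simp [halfTwist, ascending]
  | succ k ih =>
    rw [pow_succ', h.ascending_pow (k + 1) (b := 0) (by omega) hk, ← ih (by omega)]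
    conv_lhs => enter [2]; rw [h.halfTwist_succ' hk]
    rw [halfTwist]
    simp only [mul_assoc]

/-- Conjugation by the half twist carries `ascending s k ^ (k + 1)` to the power on the left, yet
fixes it, since it is the square of the half twist. -/
theorem IsBraidSeq.descending_pow_eq (h : IsBraidSeq N s) {k : ℕ} (hk : k < N) :
    descending s 0 k ^ (k + 1) = ascending s k ^ (k + 1) := by
  have h1 : SemiconjBy (halfTwist s k) (ascending s k) (descending s 0 k) :=
    h.halfTwist_mul_ascending hk
  have h2 := h1.pow_right (k + 1)
  rw [SemiconjBy, ← h.halfTwist_sq hk, ← mul_assoc] at h2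
  rw [← h.halfTwist_sq hk]
  exact (mul_right_cancel h2).symm

/-- Conjugation by the half twist exchanges the ascending and the descending product. -/
theorem IsBraidSeq.halfTwist_conj (h : IsBraidSeq N s) {k : ℕ} (hk : k < N) (x : ℤ) (y : ℕ) :
    halfTwist s k * (ascending s k ^ x * descending s 0 k ^ y) * (halfTwist s k)⁻¹ =
      descending s 0 k ^ x * ascending s k ^ y := by
  have h1 : SemiconjBy (halfTwist s k) (ascending s k) (descending s 0 k) :=
    h.halfTwist_mul_ascending hk
  have h2 : SemiconjBy (halfTwist s k) (descending s 0 k) (ascending s k) :=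
    h.halfTwist_mul_descending hk
  rw [mul_inv_eq_iff_eq_mul]
  exact (h1.zpow_right x).mul_right (h2.pow_right y)

end BraidSeq

/-! ### Braids on fewer strands -/

/-- A word on `n` strands as a word on `N ≥ n` strands. -/
def BraidWord.lift {n N : ℕ} (h : n ≤ N) (w : BraidWord n) : BraidWord N :=
  w.map fun g => (⟨g.1.1, g.1.2.1, g.1.2.2.trans_le h⟩, g.2)

theorem BraidWord.lift_cons {n N : ℕ} (h : n ≤ N) (g : BraidLetter n) (w : BraidWord n) :
    BraidWord.lift h (g :: w) =
      ((⟨g.1.1, g.1.2.1, g.1.2.2.trans_le h⟩, g.2) : BraidLetter N) :: BraidWord.lift h w := rfl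

theorem braidIncl_of {n N : ℕ} (h : n ≤ N) (i : BraidGen n) :
    braidIncl h (PresentedGroup.of (rels := artinRels n) i) =
      PresentedGroup.of (rels := artinRels N) ⟨i.1, i.2.1, i.2.2.trans_le h⟩ :=
  PresentedGroup.toGroup.of (braidIncl_aux h)

theorem toBraid_lift {n N : ℕ} (h : n ≤ N) (w : BraidWord n) :
    (w.lift h).toBraid = braidIncl h w.toBraid := by
  induction w with
  | nil => exact (map_one (braidIncl h)).symm
  | cons g w ih =>
    have e : (g :: w : BraidWord n) = [g] ++ w := rfl
    rw [BraidWord.lift_cons, ← List.singleton_append, toBraid_append, ih, e, toBraid_append,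
      map_mul]
    congr 1
    obtain ⟨i, _ | _⟩ := g
    · rw [toBraid_singleton_inv, toBraid_singleton_inv, map_inv, braidIncl_of]
    · rw [toBraid_singleton, toBraid_singleton, braidIncl_of]

theorem braidSigma_of {n i : ℕ} (h : 1 ≤ i ∧ i < n) :
    braidSigma n i = PresentedGroup.of (rels := artinRels n) ⟨i, h⟩ := dif_pos h

theorem braidIncl_braidSigma {n N i : ℕ} (h : n ≤ N) (hi : i < n) :
    braidIncl h (braidSigma n i) = braidSigma N i := by
  by_cases h1 : 1 ≤ i
  · rw [braidSigma_of ⟨h1, hi⟩, braidSigma_of ⟨h1, hi.trans_le h⟩, braidIncl_of]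
  · rw [braidSigma, dif_neg (by tauto), braidSigma, dif_neg (by tauto), map_one]

theorem braidIncl_trans {a n N : ℕ} (h : a ≤ n) (h' : n ≤ N) (β : BraidGroup a) :
    braidIncl h' (braidIncl h β) = braidIncl (h.trans h') β := by
  have : (braidIncl h').comp (braidIncl h) = braidIncl (h.trans h') := by
    refine PresentedGroup.ext fun i => ?_
    rw [MonoidHom.comp_apply, braidIncl_of, braidIncl_of, braidIncl_of]
  exact DFunLike.congr_fun this β

theorem braidIncl_self {n : ℕ} (h : n ≤ n) (β : BraidGroup n) : braidIncl h β = β := by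
  have : braidIncl h = MonoidHom.id _ := by
    refine PresentedGroup.ext fun i => ?_
    rw [braidIncl_of]
    rfl
  exact DFunLike.congr_fun this β

theorem isBraidSeq_braidSigma (n : ℕ) : IsBraidSeq n (braidSigma n) where
  comm i j hi hij hj := by
    rw [braidSigma_of ⟨hi, by omega⟩, braidSigma_of ⟨by omega, hj⟩]
    have := PresentedGroup.one_of_mem (rels := artinRels n)
      (Or.inl ⟨⟨i, hi, by omega⟩, ⟨j, by omega, hj⟩, hij, rfl⟩)
    rw [map_mul, map_inv, mul_inv_eq_one, map_mul, map_mul] at this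
    exact this
  braid i hi hij := by
    rw [braidSigma_of ⟨hi, by omega⟩, braidSigma_of ⟨by omega, hij⟩]
    have := PresentedGroup.one_of_mem (rels := artinRels n)
      (Or.inr ⟨⟨i, hi, by omega⟩, ⟨i + 1, by omega, hij⟩, rfl, rfl⟩)
    rw [map_mul, map_inv, mul_inv_eq_one, map_mul, map_mul, map_mul, map_mul] at this
    exact this

theorem braidRun_succ (n k : ℕ) : braidRun n (k + 1) = ascending (braidSigma n) k := by
  induction k with
  | zero => rfl
  | succ k ih =>
    rw [ascending, ← ih, braidRun, braidRun, Nat.add_sub_cancel, Nat.add_sub_cancel,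
      List.range'_concat, List.map_append, List.prod_append]
    simp [add_comm]

theorem braidIncl_ascending {n N k : ℕ} (h : n ≤ N) (hk : k < n) :
    braidIncl h (ascending (braidSigma n) k) = ascending (braidSigma N) k := by
  induction k with
  | zero => exact map_one _
  | succ k ih => rw [ascending, map_mul, ih (by omega), braidIncl_braidSigma h hk]; rfl

theorem braidIncl_descending {n N b l : ℕ} (h : n ≤ N) (hl : b + l < n) :
    braidIncl h (descending (braidSigma n) b l) = descending (braidSigma N) b l := by
  induction l with
  | zero => exact map_one _
  | succ l ih =>
    rw [descending, map_mul, ih (by omega), braidIncl_braidSigma h (by omega)]; rfl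

theorem braidIncl_braidRun {n N r : ℕ} (h : n ≤ N) (hr : 1 ≤ r) (hrn : r ≤ n) :
    braidIncl h (braidRun n r) = braidRun N r := by
  obtain ⟨k, rfl⟩ : ∃ k, r = k + 1 := ⟨r - 1, by omega⟩
  rw [braidRun_succ, braidRun_succ, braidIncl_ascending h (by omega)]

/-! ### Reparametrizations of the line -/

theorem exists_int_partialSum (c : ℤ → ℤ) : ∃ D : ℤ → ℤ, D 0 = 0 ∧ ∀ m, D (m + 1) = D m + c m := by
  refine ⟨fun m => match m with
    | Int.ofNat a => ∑ i ∈ Finset.range a, c i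
    | Int.negSucc a => -∑ i ∈ Finset.range (a + 1), c (Int.negSucc i), rfl, fun m => ?_⟩
  rcases m with a | a
  · exact Finset.sum_range_succ (fun i : ℕ => c i) a
  · rcases a with _ | a
    · simp
    · have : Int.negSucc (a + 1) + 1 = Int.negSucc a := by omega
      simp only [this]
      rw [Finset.sum_range_succ _ (a + 1)]
      ring

theorem monotone_of_monotoneOn_Icc_int {h : ℝ → ℝ}
    (H : ∀ m : ℤ, MonotoneOn h (Set.Icc (m : ℝ) (m + 1))) : Monotone h := by
  have hi : Monotone fun m : ℤ => h m := monotone_int_of_le_succ fun m => by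
    have := H m ⟨le_rfl, by linarith⟩ ⟨by linarith, le_rfl⟩ (show (m : ℝ) ≤ m + 1 by linarith)
    simpa using this
  have mem : ∀ t : ℝ, t ∈ Set.Icc (⌊t⌋ : ℝ) (⌊t⌋ + 1) := fun t =>
    ⟨Int.floor_le t, (Int.lt_floor_add_one t).le⟩
  intro t u htu
  rcases (Int.floor_le_floor htu).eq_or_lt with he | hlt
  · exact H ⌊t⌋ (mem t) (he ▸ mem u) htu
  · have h1 := H ⌊t⌋ (mem t) ⟨by linarith, le_rfl⟩ (mem t).2
    have h2 : h ((⌊t⌋ + 1 : ℤ) : ℝ) ≤ h ⌊u⌋ := hi hlt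
    have h3 := H ⌊u⌋ ⟨le_rfl, by linarith⟩ (mem u) (mem u).1
    push_cast at h2
    linarith

/-- A clock for a strand that makes `c m` extra turns during its turn `m`: in the last quarter of
that turn it runs at speed `1 + 4 * c m`. Its speed lies between `1` and `5`, which makes it
bijective and Lipschitz. `D` counts the extra turns. -/
theorem exists_reparametrization {c : ℤ → ℤ} (hc : ∀ m, 0 ≤ c m ∧ c m ≤ 1) :
    ∃ (D : ℤ → ℤ) (Φ : ℝ ≃o ℝ), D 0 = 0 ∧ (∀ m, D (m + 1) = D m + c m) ∧
      (∀ (m : ℤ), ∀ t ∈ Set.Icc (m : ℝ) (m + 1),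
        Φ t = t + D m + c m * max 0 (4 * (t - m) - 3)) ∧
      LocallyLipschitz Φ ∧ ∀ u t, u ≤ t → t - u ≤ Φ t - Φ u := by
  obtain ⟨D, D0, hD⟩ := exists_int_partialSum c
  let F : ℝ → ℝ := fun t => t + D ⌊t⌋ + c ⌊t⌋ * max 0 (4 * (t - ⌊t⌋) - 3)
  have hF : ∀ (m : ℤ), ∀ t ∈ Set.Icc (m : ℝ) (m + 1),
      F t = t + D m + c m * max 0 (4 * (t - m) - 3) := by
    intro m t ht
    rcases ht.2.eq_or_lt with h | h
    · obtain rfl : t = ((m + 1 : ℤ) : ℝ) := by push_cast; exact h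
      simp only [F, Int.floor_intCast, hD]
      have e1 : max (0 : ℝ) (4 * (((m + 1 : ℤ) : ℝ) - ((m + 1 : ℤ) : ℝ)) - 3) = 0 :=
        max_eq_left (by linarith)
      have e2 : max (0 : ℝ) (4 * (((m + 1 : ℤ) : ℝ) - m) - 3) = 1 := by
        rw [max_eq_right] <;> push_cast <;> linarith
      rw [e1, e2]
      push_cast
      ring
    · have : ⌊t⌋ = m := Int.floor_eq_iff.2 ⟨ht.1, h⟩
      simp only [F, this]
  have cb : ∀ m, (0 : ℝ) ≤ c m ∧ (c m : ℝ) ≤ 1 := fun m =>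
    ⟨by exact_mod_cast (hc m).1, by exact_mod_cast (hc m).2⟩
  have step : ∀ (m : ℤ) {t u : ℝ}, t ≤ u → max 0 (4 * (t - m) - 3) ≤ max 0 (4 * (u - m) - 3) ∧
      max 0 (4 * (u - m) - 3) ≤ max 0 (4 * (t - m) - 3) + 4 * (u - t) := by
    intro m t u h
    refine ⟨max_le_max le_rfl (by linarith), max_le ?_ ?_⟩
    · have := le_max_left 0 (4 * (t - m) - 3)
      linarith
    · have := le_max_right 0 (4 * (t - m) - 3)
      linarith
  have m1 : Monotone fun t => F t - t := by
    refine monotone_of_monotoneOn_Icc_int fun m t ht u hu htu => ?_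
    have h1 := mul_le_mul_of_nonneg_left (step m htu).1 (cb m).1
    simp only [hF m t ht, hF m u hu]
    linarith
  have m2 : Monotone fun t => 5 * t - F t := by
    refine monotone_of_monotoneOn_Icc_int fun m t ht u hu htu => ?_
    have h1 := mul_le_mul_of_nonneg_left (step m htu).2 (cb m).1
    have h2 := mul_le_mul_of_nonneg_right (cb m).2 (show 0 ≤ 4 * (u - t) by linarith)
    simp only [hF m t ht, hF m u hu]
    linarith
  have low : ∀ u t, u ≤ t → t - u ≤ F t - F u := fun u t h => by
    have := m1 h; simp only at this; linarith
  have up : ∀ u t, u ≤ t → F t - F u ≤ 5 * (t - u) := fun u t h => by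
    have := m2 h; simp only at this; linarith
  have lip : LipschitzWith 5 F := by
    refine LipschitzWith.of_dist_le_mul fun t u => ?_
    rw [Real.dist_eq, Real.dist_eq, NNReal.coe_ofNat]
    rcases le_total u t with h | h
    · rw [abs_of_nonneg (by linarith [low u t h]), abs_of_nonneg (by linarith)]
      exact up u t h
    · rw [abs_sub_comm, abs_sub_comm t, abs_of_nonneg (by linarith [low t u h]),
        abs_of_nonneg (by linarith)]
      exact up t u h
  have smono : StrictMono F := fun t u h => by linarith [low t u h.le]
  have surj : Function.Surjective F := by
    refine lip.continuous.surjective ?_ ?_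
    · refine Filter.tendsto_atTop_mono' _ ?_
        (Filter.tendsto_atTop_add_const_right _ (F 0) Filter.tendsto_id)
      filter_upwards [Filter.eventually_ge_atTop 0] with t ht
      have := low 0 t ht
      simp only [id]
      linarith
    · refine Filter.tendsto_atBot_mono' _ ?_
        (Filter.tendsto_atBot_add_const_right _ (F 0) Filter.tendsto_id)
      filter_upwards [Filter.eventually_le_atBot 0] with t ht
      have := low t 0 ht
      simp only [id]
      linarith
  exact ⟨D, smono.orderIsoOfSurjective F surj, D0, hD, hF, lip.locallyLipschitz, low⟩

/-! ### Bounds for the motion of a braid word -/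

theorem letterMotion_bounds {n : ℕ} (g : BraidLetter n) {s : ℝ} (h0 : 0 ≤ s) (h1 : s ≤ 1) {j : ℕ}
    (hj : j ∈ Set.Icc 1 n) : (letterMotion g j s).1 ≤ n ∧ |(letterMotion g j s).2| ≤ 1 / 2 := by
  have hi : (g.1.1 : ℝ) + 1 ≤ n := by exact_mod_cast g.1.2.2
  have hm : min s (1 - s) ≤ 1 / 2 := by
    rcases le_total s (1 / 2) with h | h
    · exact (min_le_left _ _).trans h
    · exact (min_le_right _ _).trans (by linarith)
  have hm0 : 0 ≤ min s (1 - s) := le_min h0 (by linarith)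
  unfold letterMotion
  split_ifs
  all_goals
    first
    | exact ⟨by simp only; linarith, by
        simp only [one_mul, neg_one_mul, abs_neg]
        rwa [abs_of_nonneg hm0]⟩
    | exact ⟨Nat.cast_le.2 hj.2, by simp⟩

theorem wordMotion_bounds {n : ℕ} (w : BraidWord n) {s : ℝ} (h0 : 0 ≤ s) {j : ℕ}
    (hj : j ∈ Set.Icc 1 n) : (wordMotion w j s).1 ≤ n ∧ |(wordMotion w j s).2| ≤ 1 / 2 := by
  induction w generalizing j s with
  | nil => exact ⟨Nat.cast_le.2 hj.2, by simp [wordMotion]⟩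
  | cons g w ih =>
    by_cases hs : s ≤ 1
    · simp only [wordMotion, hs, if_true]
      exact letterMotion_bounds g h0 hs hj
    · simp only [wordMotion, hs, if_false]
      exact ih (by linarith) (letterPerm_mem g hj)

theorem letterPerm_of_lt {n : ℕ} (g : BraidLetter n) {j : ℕ} (hj : n < j) : letterPerm g j = j := by
  have := g.1.2.2
  exact Equiv.swap_apply_of_ne_of_ne (by omega) (by omega)

theorem wordPerm_of_lt {n : ℕ} (w : BraidWord n) {j : ℕ} (hj : n < j) : wordPerm w j = j := by
  induction w with
  | nil => rfl
  | cons g w ih => rw [wordPerm, Equiv.Perm.mul_apply, letterPerm_of_lt g hj, ih]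

theorem wordMotion_of_lt {n : ℕ} (w : BraidWord n) {j : ℕ} (hj : n < j) (s : ℝ) :
    wordMotion w j s = ((j : ℝ), 0) := by
  induction w generalizing s with
  | nil => rfl
  | cons g w ih =>
    have := g.1.2.2
    simp only [wordMotion, letterPerm_of_lt g hj, ih, letterMotion]
    rw [if_neg (show ¬ j = g.1.1 by omega), if_neg (show ¬ j = g.1.1 + 1 by omega), ite_self]

theorem wordPerm_lift {n N : ℕ} (h : n ≤ N) (w : BraidWord n) : wordPerm (w.lift h) = wordPerm w := by
  induction w with
  | nil => rfl
  | cons g w ih => rw [BraidWord.lift_cons, wordPerm, wordPerm, ih]; rfl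

theorem wordMotion_lift {n N : ℕ} (h : n ≤ N) (w : BraidWord n) :
    wordMotion (w.lift h) = wordMotion w := by
  induction w with
  | nil => rfl
  | cons g w ih =>
    funext j s
    rw [BraidWord.lift_cons, wordMotion, wordMotion, ih]
    rfl

theorem length_lift {n N : ℕ} (h : n ≤ N) (w : BraidWord n) : (w.lift h).length = w.length :=
  List.length_map _

/-! ### Coordinates of points on a closed braid -/

theorem cylPoint_add_int (p : ℝ × ℝ) (t : ℝ) (m : ℤ) : cylPoint p (t + m) = cylPoint p t := by
  have : Complex.exp (2 * Real.pi * ((t + (m : ℝ) : ℝ) : ℂ) * Complex.I) =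
      Complex.exp (2 * Real.pi * t * Complex.I) := by
    rw [Complex.exp_eq_exp_iff_exists_int]
    exact ⟨m, by push_cast; ring⟩
  rw [cylPoint, cylPoint, this]

theorem cylPoint_re (p : ℝ × ℝ) (t : ℝ) :
    (cylPoint p t).1.re = p.1 * Real.cos (2 * Real.pi * t) := by
  have : (2 * Real.pi * t * Complex.I : ℂ) = ((2 * Real.pi * t : ℝ) : ℂ) * Complex.I := by push_cast; ring
  rw [cylPoint, this, Complex.re_ofReal_mul, Complex.exp_ofReal_mul_I_re]

theorem cylPoint_im (p : ℝ × ℝ) (t : ℝ) :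
    (cylPoint p t).1.im = p.1 * Real.sin (2 * Real.pi * t) := by
  have : (2 * Real.pi * t * Complex.I : ℂ) = ((2 * Real.pi * t : ℝ) : ℂ) * Complex.I := by push_cast; ring
  rw [cylPoint, this, Complex.im_ofReal_mul, Complex.exp_ofReal_mul_I_im]

theorem norm_cylPoint_fst {p : ℝ × ℝ} (hp : 0 ≤ p.1) (t : ℝ) : ‖(cylPoint p t).1‖ = p.1 := by
  have : (2 * Real.pi * t * Complex.I : ℂ) = ((2 * Real.pi * t : ℝ) : ℂ) * Complex.I := by push_cast; ring
  rw [cylPoint, this, norm_mul, Complex.norm_exp_ofReal_mul_I, mul_one, Complex.norm_real,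
    Real.norm_of_nonneg hp]

/-! ### Stabilization: the additional strand becomes a descending loop -/

/-- The motion under a word, carried out during the first half of the turn. -/
def firstHalf {n : ℕ} (w : BraidWord n) (k : ℕ) (u : ℝ) : ℝ × ℝ := wordMotion w k (2 * w.length * u)

section FirstHalf

variable {n : ℕ} (w : BraidWord n)

theorem firstHalf_zero (k : ℕ) : firstHalf w k 0 = ((k : ℝ), 0) := by
  rw [firstHalf, mul_zero, wordMotion_zero]

theorem firstHalf_of_ge (k : ℕ) {u : ℝ} (hu : 1 / 2 ≤ u) :
    firstHalf w k u = ((wordPerm w k : ℝ), 0) := by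
  refine wordMotion_of_le w k ?_
  have : (0 : ℝ) ≤ w.length := Nat.cast_nonneg _
  nlinarith

theorem firstHalf_of_lt {k : ℕ} (hk : n < k) (u : ℝ) : firstHalf w k u = ((k : ℝ), 0) :=
  wordMotion_of_lt w hk _

theorem firstHalf_time {u : ℝ} (hu : 0 ≤ u) : (0 : ℝ) ≤ 2 * w.length * u := by positivity

theorem firstHalf_bounds {k : ℕ} (hk : k ∈ Set.Icc 1 n) {u : ℝ} (hu : 0 ≤ u) :
    0 < (firstHalf w k u).1 ∧ (firstHalf w k u).1 ≤ n ∧ |(firstHalf w k u).2| ≤ 1 / 2 :=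
  ⟨wordMotion_pos w (firstHalf_time w hu) hk, wordMotion_bounds w (firstHalf_time w hu) hk⟩

theorem firstHalf_injective {u : ℝ} (hu : 0 ≤ u) {j k : ℕ} (h : firstHalf w j u = firstHalf w k u) :
    j = k := wordMotion_injective w (firstHalf_time w hu) h

theorem locallyLipschitz_firstHalf (k : ℕ) : LocallyLipschitz (firstHalf w k) :=
  (locallyLipschitz_wordMotion w k).comp (ContDiff.locallyLipschitz (𝕂 := ℝ) (by fun_prop))

theorem continuous_firstHalf (k : ℕ) : Continuous (firstHalf w k) :=
  (locallyLipschitz_firstHalf w k).continuous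

end FirstHalf

/-- The progress of the last crossing. -/
def crossTime (u : ℝ) : ℝ := max 0 (min 1 (8 * u - 4))

theorem crossTime_of_le {u : ℝ} (hu : u ≤ 1 / 2) : crossTime u = 0 :=
  max_eq_left ((min_le_right _ _).trans (by linarith))

theorem crossTime_of_mem {u : ℝ} (h0 : 1 / 2 ≤ u) (h1 : u ≤ 5 / 8) : crossTime u = 8 * u - 4 := by
  rw [crossTime, min_eq_right (by linarith), max_eq_right (by linarith)]

theorem crossTime_of_ge {u : ℝ} (hu : 5 / 8 ≤ u) : crossTime u = 1 := by
  rw [crossTime, min_eq_left (by linarith), max_eq_right (by linarith)]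

/-- The displacement, at the stage `s` of the homotopy, of the strand that ends in position `n`. -/
def outerOffset (s u : ℝ) : ℝ × ℝ :=
  -- For `s = 1` the strand drops with slope `16` from time `1/2` to depth `4` at time `3/4`. Then
  -- it ascends for `5/4` turns: at the total time `v` from `3/4` to `2` its height is `16/5 * (v -
  -- 2)` and its radius `n - 16/25 * (v - 3/4) * (2 - v)`. The times `v ≥ 1` belong to
  -- `innerOffset`, with `u = v - 1`.
  ((1 - s) * crossTime u + s * (-(16 / 25) * (max 0 (u - 3 / 4) * (2 - u))),
    (1 - s) * min (crossTime u) (1 - crossTime u) +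
      s * max (-16 * max 0 (u - 1 / 2)) (16 / 5 * (u - 2)))

/-- The displacement, at the stage `s` of the homotopy, of the strand that starts in position
`n + 1`. -/
def innerOffset (s u : ℝ) : ℝ × ℝ :=
  (-((1 - s) * crossTime u) - s * (1 + 16 / 25 * ((u + 1 / 4) * (1 - u))),
    -((1 - s) * min (crossTime u) (1 - crossTime u)) + s * (16 / 5 * (u - 1)))

/-- For `s = 0` the motion under `w` and one more crossing of the last two strands; for `s = 1` these
strands form a loop of two turns. -/
def loopMotion {n : ℕ} (w : BraidWord n) (s u : ℝ) (k : ℕ) : ℝ × ℝ :=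
  firstHalf w k u + if wordPerm w k = n then outerOffset s u else
    if k = n + 1 then innerOffset s u else 0

theorem outerOffset_of_le {s u : ℝ} (hu : u ≤ 1 / 2) : outerOffset s u = 0 := by
  rw [outerOffset, crossTime_of_le hu, max_eq_left (by linarith : u - 3 / 4 ≤ 0),
    max_eq_left (by linarith : u - 1 / 2 ≤ 0), max_eq_left (by linarith : 16 / 5 * (u - 2) ≤ -16 * 0)]
  simp

/-- The product `(u - 3/4) * (2 - u)` is largest at `u = 11/8`, with value `25/64`; so the ascent
bends inwards by at most `1/4`, which keeps it away from the axis and from positions up to `n - 1`.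
-/
theorem outerOffset_fst_ge {s u : ℝ} (hs : s ∈ Set.Icc (0 : ℝ) 1) :
    -(1 / 4) ≤ (outerOffset s u).1 := by
  have hx : 0 ≤ crossTime u := le_max_left _ _
  have h2 : max 0 (u - 3 / 4) * (2 - u) ≤ 25 / 64 := by
    rcases le_total (u - 3 / 4) 0 with h | h
    · rw [max_eq_left h]; norm_num
    · rw [max_eq_right h]; nlinarith [sq_nonneg (u - 11 / 8)]
  have h3 := mul_nonneg (sub_nonneg.2 hs.2) hx
  simp only [outerOffset]
  nlinarith [mul_le_mul_of_nonneg_left h2 hs.1, hs.2]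

theorem innerOffset_fst_ge {s u : ℝ} (hs : s ∈ Set.Icc (0 : ℝ) 1) :
    -(5 / 4) ≤ (innerOffset s u).1 := by
  have hx : crossTime u ≤ 1 := max_le (by norm_num) (min_le_left _ _)
  have h2 : (u + 1 / 4) * (1 - u) ≤ 25 / 64 := by nlinarith [sq_nonneg (u - 3 / 8)]
  have h3 := mul_le_mul_of_nonneg_left hx (sub_nonneg.2 hs.2)
  simp only [innerOffset]
  nlinarith [mul_le_mul_of_nonneg_left h2 hs.1, hs.2]

theorem loopMotion_inner {n : ℕ} (w : BraidWord n) (s u : ℝ) :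
    loopMotion w s u (n + 1) = (((n + 1 : ℕ) : ℝ), 0) + innerOffset s u := by
  rw [loopMotion, firstHalf_of_lt w (Nat.lt_succ_self n), wordPerm_of_lt w (Nat.lt_succ_self n),
    if_neg (Nat.succ_ne_self n), if_pos rfl]

theorem loopMotion_outer {n : ℕ} (w : BraidWord n) (s u : ℝ) {k : ℕ} (hk : wordPerm w k = n) :
    loopMotion w s u k = firstHalf w k u + outerOffset s u := by
  rw [loopMotion, if_pos hk]

theorem loopMotion_other {n : ℕ} (w : BraidWord n) (s u : ℝ) {k : ℕ} (hk : wordPerm w k ≠ n)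
    (hk' : k ≠ n + 1) : loopMotion w s u k = firstHalf w k u := by
  rw [loopMotion, if_neg hk, if_neg hk', add_zero]

theorem mem_Icc_succ_cases {n : ℕ} (w : BraidWord n) {k : ℕ} (hk : k ∈ Set.Icc 1 (n + 1)) :
    k = n + 1 ∨ (k ∈ Set.Icc 1 n ∧ wordPerm w k = n) ∨
      (k ∈ Set.Icc 1 n ∧ k ≠ n + 1 ∧ wordPerm w k ≠ n ∧ (wordPerm w k : ℝ) ≤ n - 1) := by
  rcases eq_or_ne k (n + 1) with h | h
  · exact Or.inl h
  · have hk' : k ∈ Set.Icc 1 n := ⟨hk.1, by have := hk.2; omega⟩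
    by_cases hn : wordPerm w k = n
    · exact Or.inr (Or.inl ⟨hk', hn⟩)
    · refine Or.inr (Or.inr ⟨hk', h, hn, ?_⟩)
      have h1 := (wordPerm_mem w hk').2
      have h2 : wordPerm w k + 1 ≤ n := by omega
      have h3 : ((wordPerm w k : ℕ) : ℝ) + 1 ≤ n := by exact_mod_cast h2
      linarith

theorem loopMotion_pos {n : ℕ} (w : BraidWord n) (hn : 1 ≤ n) {s u : ℝ}
    (hs : s ∈ Set.Icc (0 : ℝ) 1) (hu : u ∈ Set.Icc (0 : ℝ) 1) {k : ℕ}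
    (hk : k ∈ Set.Icc 1 (n + 1)) : 0 < (loopMotion w s u k).1 := by
  have hn' : (1 : ℝ) ≤ n := by exact_mod_cast hn
  rcases mem_Icc_succ_cases w hk with rfl | ⟨hk, h⟩ | ⟨hk, h1, h2, h3⟩
  · rw [loopMotion_inner, Prod.fst_add]
    have := innerOffset_fst_ge (u := u) hs
    push_cast
    linarith
  · rw [loopMotion_outer w s u h, Prod.fst_add]
    rcases le_total u (1 / 2) with hu' | hu'
    · rw [outerOffset_of_le hu', Prod.fst_zero, add_zero]
      exact (firstHalf_bounds w hk hu.1).1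
    · rw [firstHalf_of_ge w k hu', h]
      have := outerOffset_fst_ge (u := u) hs
      simp only
      linarith
  · rw [loopMotion_other w s u h2 h1]
    exact (firstHalf_bounds w hk hu.1).1

/-- In the first half, the strand that starts in position `n + 1` avoids the others. -/
theorem loopMotion_ne_inner {n : ℕ} {s u : ℝ} (hs : s ∈ Set.Icc (0 : ℝ) 1)
    (hu : u ≤ 1 / 2) {p : ℝ × ℝ} (h1 : p.1 ≤ n) (h2 : |p.2| ≤ 1 / 2) :
    p ≠ (((n + 1 : ℕ) : ℝ), 0) + innerOffset s u := by
  intro h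
  have e1 : p.1 = _ := congrArg Prod.fst h
  have e2 : p.2 = _ := congrArg Prod.snd h
  simp only [innerOffset, crossTime_of_le hu, Prod.fst_add, Prod.snd_add] at e1 e2
  rw [min_eq_left (by norm_num)] at e2
  push_cast at e1
  have h3 : (u + 1 / 4) * (1 - u) ≤ 25 / 64 := by nlinarith [sq_nonneg (u - 3 / 8)]
  have h4 := mul_le_mul_of_nonneg_left h3 hs.1
  -- To reach position `n` the strand needs `s * (5/4) ≥ 1`. It then lies at depth at least `4/5 *
  -- (8/5)`, below everything of height at least `-1/2`.
  have h5 : 4 / 5 ≤ s := by linarith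
  have h6 := neg_le_of_abs_le h2
  nlinarith [mul_nonneg hs.1 (sub_nonneg.2 hu)]

/-- Up to time `9/16` the outer strand is higher, except at `s = 0` before the crossing, when radii
differ. From then to `3/4` its radius is larger, except at `s = 0` in the middle of the crossing,
when heights differ. After `3/4` the heights differ by `16/5 * s`, and for `s = 0` the radii differ.
-/
theorem outer_ne_inner {n : ℕ} {s u : ℝ} (hs : s ∈ Set.Icc (0 : ℝ) 1) (h0 : 1 / 2 ≤ u) :
    ((n : ℝ), (0 : ℝ)) + outerOffset s u ≠ (((n + 1 : ℕ) : ℝ), 0) + innerOffset s u := by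
  intro h
  have e1 := congrArg Prod.fst h
  have e2 := congrArg Prod.snd h
  simp only [innerOffset, outerOffset, Prod.fst_add, Prod.snd_add, zero_add] at e1 e2
  push_cast at e1
  obtain ⟨s0, s1⟩ := hs
  have s1' := sub_nonneg.2 s1
  rcases le_total u (3 / 4) with h34 | h34
  · rw [max_eq_left (by linarith : u - 3 / 4 ≤ 0)] at e1
    rw [max_eq_right (by linarith : 0 ≤ u - 1 / 2), max_eq_left (by linarith)] at e2
    have hB : 0 < (u + 1 / 4) * (1 - u) := mul_pos (by linarith) (by linarith)
    have hB' := mul_nonneg s0 hB.le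
    rcases le_total u (9 / 16) with h9 | h9
    · rw [crossTime_of_mem h0 (by linarith)] at e1 e2
      rw [min_eq_left (by linarith)] at e2
      have h1 : 0 ≤ (1 - s) * (8 * u - 4) := mul_nonneg s1' (by linarith)
      have h2 : s * (2 / 5) ≤ s * (-16 * (u - 1 / 2) - 16 / 5 * (u - 1)) :=
        mul_le_mul_of_nonneg_left (by linarith) s0
      obtain rfl : s = 0 := by linarith
      linarith
    · have hx : 1 / 2 ≤ crossTime u := by
        rcases le_total u (5 / 8) with h | h
        · rw [crossTime_of_mem h0 h]; linarith
        · rw [crossTime_of_ge h]; norm_num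
      have h1 : 0 ≤ (1 - s) * (crossTime u - 1 / 2) := mul_nonneg s1' (by linarith)
      have h2 : s * ((u + 1 / 4) * (1 - u)) = 0 := by nlinarith
      obtain rfl : s = 0 := by
        rcases mul_eq_zero.1 h2 with h | h
        · exact h
        · linarith
      have h3 : crossTime u = 1 / 2 := by linarith
      rw [h3] at e2
      norm_num at e2
  · rw [max_eq_right (by linarith : 0 ≤ u - 1 / 2), max_eq_right (by linarith),
      crossTime_of_ge (by linarith)] at e2
    rw [crossTime_of_ge (by linarith)] at e1
    rw [min_eq_right (by norm_num)] at e2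
    obtain rfl : s = 0 := by linarith
    linarith

theorem loopMotion_injective {n : ℕ} (w : BraidWord n) {s u : ℝ}
    (hs : s ∈ Set.Icc (0 : ℝ) 1) (hu : u ∈ Set.Icc (0 : ℝ) 1) {j k : ℕ}
    (hj : j ∈ Set.Icc 1 (n + 1)) (hk : k ∈ Set.Icc 1 (n + 1))
    (h : loopMotion w s u j = loopMotion w s u k) : j = k := by
  wlog hjk : j ≤ k generalizing j k
  · exact (this hk hj h.symm (by omega)).symm
  rcases le_total u (1 / 2) with hu' | hu'
  · have first : ∀ i ∈ Set.Icc 1 n, loopMotion w s u i = firstHalf w i u := fun i hi => by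
      have : i ≠ n + 1 := by have := hi.2; omega
      rw [loopMotion, outerOffset_of_le hu', if_neg this, ite_self, add_zero]
    rcases eq_or_ne k (n + 1) with rfl | hk'
    · by_contra hne
      have hj' : j ∈ Set.Icc 1 n := ⟨hj.1, by omega⟩
      rw [first j hj', loopMotion_inner] at h
      obtain ⟨-, h1, h2⟩ := firstHalf_bounds w hj' hu.1
      exact loopMotion_ne_inner hs hu' h1 h2 h
    · have hk2 := hk.2
      rw [first j ⟨hj.1, by omega⟩, first k ⟨hk.1, by omega⟩] at h
      exact firstHalf_injective w hu.1 h
  · have a1 := outerOffset_fst_ge (u := u) hs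
    have a2 := innerOffset_fst_ge (u := u) hs
    rcases mem_Icc_succ_cases w hj with rfl | ⟨hj, j1⟩ | ⟨hj, j1, j2, j3⟩ <;>
      rcases mem_Icc_succ_cases w hk with rfl | ⟨hk, k1⟩ | ⟨hk, k1, k2, k3⟩
    · rfl
    · have := hk.2; omega
    · have := hk.2; omega
    · rw [loopMotion_outer w s u j1, loopMotion_inner, firstHalf_of_ge w j hu', j1] at h
      exact (outer_ne_inner hs hu' h).elim
    · exact (wordPerm w).injective (j1.trans k1.symm)
    · rw [loopMotion_outer w s u j1, loopMotion_other w s u k2 k1, firstHalf_of_ge w j hu',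
        firstHalf_of_ge w k hu', j1] at h
      have := congrArg Prod.fst h
      simp only [Prod.fst_add] at this
      linarith
    · rw [loopMotion_other w s u j2 j1, loopMotion_inner, firstHalf_of_ge w j hu'] at h
      have := congrArg Prod.fst h
      simp only [Prod.fst_add] at this
      push_cast at this
      linarith
    · rw [loopMotion_outer w s u k1, loopMotion_other w s u j2 j1, firstHalf_of_ge w j hu',
        firstHalf_of_ge w k hu', k1] at h
      have := congrArg Prod.fst h
      simp only [Prod.fst_add] at this
      linarith
    · rw [loopMotion_other w s u j2 j1, loopMotion_other w s u k2 k1] at h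
      exact firstHalf_injective w hu.1 h

/-- The permutation of the positions caused by `w` and one more crossing of the last two strands. -/
def stabPerm {n : ℕ} (w : BraidWord n) : Equiv.Perm ℕ := Equiv.swap n (n + 1) * wordPerm w

theorem stabPerm_inner {n : ℕ} (w : BraidWord n) : stabPerm w (n + 1) = n := by
  rw [stabPerm, Equiv.Perm.mul_apply, wordPerm_of_lt w (Nat.lt_succ_self n), Equiv.swap_apply_right]

theorem stabPerm_outer {n : ℕ} (w : BraidWord n) {k : ℕ} (hk : wordPerm w k = n) :
    stabPerm w k = n + 1 := by
  rw [stabPerm, Equiv.Perm.mul_apply, hk, Equiv.swap_apply_left]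

theorem stabPerm_other {n : ℕ} (w : BraidWord n) {k : ℕ} (hk : wordPerm w k ≠ n)
    (hk' : k ≠ n + 1) : stabPerm w k = wordPerm w k := by
  rw [stabPerm, Equiv.Perm.mul_apply]
  refine Equiv.swap_apply_of_ne_of_ne hk fun h => hk' ?_
  exact (wordPerm w).injective (h.trans (wordPerm_of_lt w (Nat.lt_succ_self n)).symm)

theorem mapsTo_stabPerm {n : ℕ} (w : BraidWord n) (hn : 1 ≤ n) :
    Set.MapsTo (stabPerm w) (Set.Icc 1 (n + 1)) (Set.Icc 1 (n + 1)) := by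
  intro k hk
  rcases mem_Icc_succ_cases w hk with rfl | ⟨hk, h⟩ | ⟨hk, h1, h2, -⟩
  · rw [stabPerm_inner]; exact ⟨hn, by omega⟩
  · rw [stabPerm_outer w h]; exact ⟨by omega, le_rfl⟩
  · rw [stabPerm_other w h2 h1]
    have := wordPerm_mem w hk
    exact ⟨this.1, this.2.trans (Nat.le_succ n)⟩

theorem loopMotion_closing {n : ℕ} (w : BraidWord n) (s : ℝ) {k : ℕ}
    (hk : k ∈ Set.Icc 1 (n + 1)) : loopMotion w s 1 k = loopMotion w s 0 (stabPerm w k) := by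
  have base : ∀ i, i ≠ n + 1 → loopMotion w s 0 i = ((i : ℝ), 0) := fun i hi => by
    rw [loopMotion, outerOffset_of_le (by norm_num), if_neg hi, ite_self, add_zero, firstHalf_zero]
  rcases mem_Icc_succ_cases w hk with rfl | ⟨hk, h⟩ | ⟨hk, h1, h2, -⟩
  · rw [stabPerm_inner, loopMotion_inner, base n (by omega), innerOffset,
      crossTime_of_ge (by norm_num), min_eq_right (by norm_num)]
    ext
    · push_cast [Prod.fst_add]; ring
    · simp
  · rw [stabPerm_outer w h, loopMotion_inner, loopMotion_outer w s 1 h,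
      firstHalf_of_ge w k (by norm_num), h, outerOffset, innerOffset, crossTime_of_ge (by norm_num),
      crossTime_of_le (by norm_num), min_eq_right (by norm_num), min_eq_left (by norm_num),
      max_eq_right (by norm_num : (0 : ℝ) ≤ 1 - 3 / 4),
      max_eq_right (by norm_num : (0 : ℝ) ≤ 1 - 1 / 2), max_eq_right (by norm_num)]
    ext
    · push_cast [Prod.fst_add]; ring
    · simp only [Prod.snd_add]; ring
  · have := (wordPerm_mem w hk).2
    rw [stabPerm_other w h2 h1, loopMotion_other w s 1 h2 h1, base _ (by omega),
      firstHalf_of_ge w k (by norm_num)]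

theorem continuous_crossTime : Continuous crossTime := by unfold crossTime; fun_prop

theorem locallyLipschitz_crossTime : LocallyLipschitz crossTime :=
  ((LocallyLipschitz.const 1).real_min
    (ContDiff.locallyLipschitz (𝕂 := ℝ) (by fun_prop))).const_max 0

theorem locallyLipschitz_loopMotion {n : ℕ} (w : BraidWord n) (s : ℝ) (k : ℕ) :
    LocallyLipschitz fun u => loopMotion w s u k := by
  have hx := locallyLipschitz_crossTime
  have hx' : LocallyLipschitz fun u => (1 - s) * crossTime u := (LocallyLipschitz.const _).real_mul hx
  have hl : ∀ a b : ℝ, LocallyLipschitz fun u : ℝ => a * u + b := fun a b =>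
    ContDiff.locallyLipschitz (𝕂 := ℝ) (by fun_prop)
  have hc : LocallyLipschitz fun u => (1 - s) * min (crossTime u) (1 - crossTime u) := by
    refine (LocallyLipschitz.const _).real_mul (hx.real_min ?_)
    have := (LocallyLipschitz.const 1).add ((LocallyLipschitz.const (-1)).real_mul hx)
    simpa [sub_eq_add_neg] using this
  have ho : LocallyLipschitz (outerOffset s) := by
    refine locallyLipschitz_prodMk' (hx'.add ((LocallyLipschitz.const s).real_mul
      ((LocallyLipschitz.const _).real_mul (LocallyLipschitz.real_mul (LocallyLipschitz.const_max ?_ 0) ?_))))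
      (hc.add ((LocallyLipschitz.const s).real_mul (LocallyLipschitz.max
        ((LocallyLipschitz.const (-16)).real_mul (LocallyLipschitz.const_max ?_ 0)) ?_)))
    all_goals exact ContDiff.locallyLipschitz (𝕂 := ℝ) (by fun_prop)
  have hi : LocallyLipschitz (innerOffset s) := by
    have h1 : LocallyLipschitz fun u => -1 * ((1 - s) * crossTime u) +
        -(s * (1 + 16 / 25 * ((u + 1 / 4) * (1 - u)))) :=
      ((LocallyLipschitz.const _).real_mul hx').add
        (ContDiff.locallyLipschitz (𝕂 := ℝ) (by fun_prop))
    have h2 : LocallyLipschitz fun u => -1 * ((1 - s) * min (crossTime u) (1 - crossTime u)) +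
        s * (16 / 5 * (u - 1)) :=
      ((LocallyLipschitz.const _).real_mul hc).add
        (ContDiff.locallyLipschitz (𝕂 := ℝ) (by fun_prop))
    have := locallyLipschitz_prodMk' h1 h2
    simp only [neg_one_mul, ← sub_eq_add_neg] at this
    exact this
  refine (locallyLipschitz_firstHalf w k).add ?_
  split_ifs
  · exact ho
  · exact hi
  · exact LocallyLipschitz.const 0

theorem braidFam_loopMotion {n : ℕ} (w : BraidWord n) (hn : 1 ≤ n) :
    FamIso (braidFam (n + 1) (stabPerm w) (loopMotion w 0))
      (braidFam (n + 1) (stabPerm w) (loopMotion w 1)) := by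
  refine braidFam_homotopy (mapsTo_stabPerm w hn) (fun s _ k hk => loopMotion_closing w s hk)
    (fun k _ => ?_) (fun s hs u hu k hk => loopMotion_pos w hn hs hu hk)
    (fun s hs u hu i hi j hj => loopMotion_injective w hs hu hi hj)
    (fun k _ => locallyLipschitz_loopMotion w 0 k) (fun k _ => locallyLipschitz_loopMotion w 1 k)
  have h1 := continuous_firstHalf w k
  have h2 := continuous_crossTime
  unfold loopMotion outerOffset innerOffset
  split_ifs <;> fun_prop

/-- The word that represents the stabilization of a braid. -/
def stabWord {n : ℕ} (w : BraidWord n) (hn : 1 ≤ n) : BraidWord (n + 1) :=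
  w.lift (Nat.le_succ n) ++ [(⟨n, hn, Nat.lt_succ_self n⟩, true)]

theorem wordPerm_stabWord {n : ℕ} (w : BraidWord n) (hn : 1 ≤ n) :
    wordPerm (stabWord w hn) = stabPerm w := by
  rw [stabWord, wordPerm_append, wordPerm_lift]
  rfl

theorem outerOffset_zero {u : ℝ} :
    outerOffset 0 u = (crossTime u, min (crossTime u) (1 - crossTime u)) := by
  simp [outerOffset]

theorem innerOffset_zero {u : ℝ} :
    innerOffset 0 u = (-crossTime u, -min (crossTime u) (1 - crossTime u)) := by
  simp [innerOffset]

theorem letterMotion_crossTime {n : ℕ} (w : BraidWord n) (hn : 1 ≤ n) {u : ℝ} (hu : 1 / 2 ≤ u)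
    {k : ℕ} (hk : k ∈ Set.Icc 1 (n + 1)) :
    letterMotion (n := n + 1) (⟨n, hn, Nat.lt_succ_self n⟩, true) (wordPerm w k) (crossTime u) =
      loopMotion w 0 u k := by
  rcases mem_Icc_succ_cases w hk with rfl | ⟨hk, h⟩ | ⟨hk, h1, h2, -⟩
  · rw [loopMotion_inner, wordPerm_of_lt w (Nat.lt_succ_self n), innerOffset_zero, letterMotion,
      if_neg (Nat.succ_ne_self n), if_pos rfl]
    ext
    · push_cast [Prod.fst_add]; ring
    · simp
  · rw [loopMotion_outer w 0 u h, firstHalf_of_ge w k hu, h, outerOffset_zero, letterMotion,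
      if_pos rfl]
    simp
  · have := (wordPerm_mem w hk).2
    rw [loopMotion_other w 0 u h2 h1, firstHalf_of_ge w k hu, letterMotion, if_neg h2,
      if_neg (show wordPerm w k ≠ n + 1 by omega)]

theorem closedFam_stabWord {n : ℕ} (w : BraidWord n) (hn : 1 ≤ n) :
    FamIso (closedFam (stabWord w hn)) (braidFam (n + 1) (stabPerm w) (loopMotion w 0)) := by
  set L : ℝ := (w.length : ℝ) with hL
  have hL0 : 0 ≤ L := Nat.cast_nonneg _
  -- The word `w` takes the first half of the turn and the last crossing the times from `1/2` to
  -- `5/8`, as in `crossTime`.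
  let τ : ℝ → ℝ := fun u => L * min (2 * u) 1 + 8 * max 0 (u - 1 / 2)
  have hτ : LocallyLipschitz τ := by
    refine ((LocallyLipschitz.const L).real_mul (LocallyLipschitz.real_min ?_
      (LocallyLipschitz.const 1))).add
      ((LocallyLipschitz.const 8).real_mul (LocallyLipschitz.const_max ?_ 0)) <;>
    exact ContDiff.locallyLipschitz (𝕂 := ℝ) (by fun_prop)
  have hlen : ((stabWord w hn).length : ℝ) = L + 1 := by
    rw [stabWord, List.length_append, length_lift, hL]; simp
  have H := closedFam_retime (stabWord w hn) hτ
    (by simp only [τ]; rw [max_eq_left (by norm_num), min_eq_left (by norm_num)]; ring)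
    (by
      simp only [τ]
      rw [max_eq_right (by norm_num), min_eq_right (by norm_num), hlen]
      linarith)
    (fun u hu => add_nonneg (mul_nonneg hL0 (le_min (by linarith [hu.1]) zero_le_one))
      (mul_nonneg (by norm_num) (le_max_left _ _)))
  rw [wordPerm_stabWord] at H
  rwa [braidFam_congr (mapsTo_stabPerm w hn) (p' := loopMotion w 0)] at H
  intro u hu k hk
  have hτ0 : 0 ≤ τ u := add_nonneg (mul_nonneg hL0 (le_min (by linarith [hu.1]) zero_le_one))
      (mul_nonneg (by norm_num) (le_max_left _ _))
  rw [stabWord, wordMotion_append _ _ _ hτ0, length_lift, wordMotion_lift, wordPerm_lift]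
  rcases le_or_gt u (1 / 2) with h | h
  · have e : τ u = 2 * L * u := by
      simp only [τ]
      rw [max_eq_left (by linarith), min_eq_left (by linarith)]
      ring
    rw [e, if_pos (by nlinarith), loopMotion, outerOffset_zero, innerOffset_zero,
      crossTime_of_le h, min_eq_left (by norm_num)]
    simp [firstHalf, hL, ← Prod.zero_eq_mk]
  · have e : τ u = L + (8 * u - 4) := by
      simp only [τ]
      rw [max_eq_right (by linarith), min_eq_right (by linarith)]
      ring
    rw [e, if_neg (by linarith), hL, add_sub_cancel_left, ← letterMotion_crossTime w hn h.le hk]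
    rcases le_or_gt u (5 / 8) with h' | h'
    · rw [crossTime_of_mem h.le h', wordMotion, if_pos (by linarith)]
    · rw [crossTime_of_ge h'.le, wordMotion, if_neg (by linarith), letterMotion_one, wordMotion]

/-! ### The loop on one strand less -/

/-- The depth of the loop after the second turn has been removed. -/
def dipDepth (u : ℝ) : ℝ := max 0 (min (u - 1 / 2) (1 - u))

/-- The motion under `w`, where the strand that ends in position `n` also goes down and up again, at
the stage `s` of a homotopy. -/
def dipMotion {n : ℕ} (w : BraidWord n) (s u : ℝ) (k : ℕ) : ℝ × ℝ :=
  firstHalf w k u + if wordPerm w k = n then (0, -16 * (s * dipDepth u)) else 0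

theorem dipDepth_of_le {u : ℝ} (hu : u ≤ 1 / 2) : dipDepth u = 0 :=
  max_eq_left ((min_le_left _ _).trans (by linarith))

theorem dipDepth_of_mem {u : ℝ} (h0 : 1 / 2 ≤ u) (hu : u ≤ 3 / 4) : dipDepth u = u - 1 / 2 := by
  rw [dipDepth, min_eq_left (by linarith), max_eq_right (by linarith)]

theorem dipDepth_of_ge {u : ℝ} (h0 : 3 / 4 ≤ u) (hu : u ≤ 1) : dipDepth u = 1 - u := by
  rw [dipDepth, min_eq_right (by linarith), max_eq_right (by linarith)]

theorem dipMotion_of_le {n : ℕ} (w : BraidWord n) (s : ℝ) {u : ℝ} (hu : u ≤ 1 / 2) (k : ℕ) :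
    dipMotion w s u k = firstHalf w k u := by
  rw [dipMotion, dipDepth_of_le hu]
  simp

theorem dipMotion_of_ge {n : ℕ} (w : BraidWord n) (s : ℝ) {u : ℝ} (hu : 1 / 2 ≤ u) {k : ℕ}
    (hk : wordPerm w k = n) : dipMotion w s u k = ((n : ℝ), -16 * (s * dipDepth u)) := by
  rw [dipMotion, firstHalf_of_ge w k hu, if_pos hk, hk]
  simp

theorem dipMotion_other {n : ℕ} (w : BraidWord n) (s u : ℝ) {k : ℕ} (hk : wordPerm w k ≠ n) :
    dipMotion w s u k = firstHalf w k u := by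
  rw [dipMotion, if_neg hk, add_zero]

theorem dipMotion_fst {n : ℕ} (w : BraidWord n) (s u : ℝ) (k : ℕ) :
    (dipMotion w s u k).1 = (firstHalf w k u).1 := by
  rw [dipMotion]
  split_ifs <;> simp

theorem dipMotion_closing {n : ℕ} (w : BraidWord n) (s : ℝ) (k : ℕ) :
    dipMotion w s 1 k = dipMotion w s 0 (wordPerm w k) := by
  rw [dipMotion_of_le w s (u := 0) (by norm_num), firstHalf_zero, dipMotion,
    dipDepth_of_ge (by norm_num) le_rfl, firstHalf_of_ge w k (by norm_num)]
  simp

/-- The dip takes place in the second half of the turn, while all strands rest at distinct radii. -/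
theorem dipMotion_injective {n : ℕ} (w : BraidWord n) {s u : ℝ} (hu : 0 ≤ u) {j k : ℕ}
    (h : dipMotion w s u j = dipMotion w s u k) : j = k := by
  rcases le_total u (1 / 2) with h' | h'
  · rw [dipMotion_of_le w s h', dipMotion_of_le w s h'] at h
    exact firstHalf_injective w hu h
  · have := congrArg Prod.fst h
    rw [dipMotion_fst, dipMotion_fst, firstHalf_of_ge w j h', firstHalf_of_ge w k h'] at this
    exact (wordPerm w).injective (Nat.cast_injective this)

theorem dipMotion_pos {n : ℕ} (w : BraidWord n) {s u : ℝ} (hu : 0 ≤ u) {k : ℕ}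
    (hk : k ∈ Set.Icc 1 n) : 0 < (dipMotion w s u k).1 := by
  rw [dipMotion_fst]
  exact (firstHalf_bounds w hk hu).1

theorem locallyLipschitz_dipMotion {n : ℕ} (w : BraidWord n) (s : ℝ) (k : ℕ) :
    LocallyLipschitz fun u => dipMotion w s u k := by
  have hd : LocallyLipschitz dipDepth := by
    refine LocallyLipschitz.const_max (LocallyLipschitz.real_min ?_ ?_) 0 <;>
    exact ContDiff.locallyLipschitz (𝕂 := ℝ) (by fun_prop)
  refine (locallyLipschitz_firstHalf w k).add ?_
  split_ifs
  · exact locallyLipschitz_prodMk' (LocallyLipschitz.const 0)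
      ((LocallyLipschitz.const _).real_mul ((LocallyLipschitz.const _).real_mul hd))
  · exact LocallyLipschitz.const 0

theorem braidFam_dipMotion {n : ℕ} (w : BraidWord n) :
    FamIso (braidFam n (wordPerm w) (dipMotion w 1)) (closedFam w) := by
  have H : FamIso (braidFam n (wordPerm w) (dipMotion w 0))
      (braidFam n (wordPerm w) (dipMotion w 1)) := by
    refine braidFam_homotopy (mapsTo_wordPerm w) (fun s _ k _ => dipMotion_closing w s k)
      (fun k _ => ?_) (fun s _ u hu k hk => dipMotion_pos w hu.1 hk)
      (fun s _ u hu i _ j _ => dipMotion_injective w hu.1)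
      (fun k _ => locallyLipschitz_dipMotion w 0 k) (fun k _ => locallyLipschitz_dipMotion w 1 k)
    have h1 := continuous_firstHalf w k
    unfold dipMotion dipDepth
    split_ifs <;> fun_prop
  have H' := closedFam_retime w (τ := fun u => 2 * w.length * u)
    (ContDiff.locallyLipschitz (𝕂 := ℝ) (by fun_prop)) (mul_zero _)
    (by have : (0 : ℝ) ≤ w.length := Nat.cast_nonneg _
        linarith)
    (fun u hu => firstHalf_time w hu.1)
  refine H.symm.trans ?_
  rw [braidFam_congr (mapsTo_wordPerm w) (p' := fun u k => wordMotion w k (2 * w.length * u))]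
  · exact H'.symm
  · intro u _ k _
    rw [dipMotion]
    simp [firstHalf]

/-- One turn of the closed braid whose last strand goes down and up again. -/
def flatArc {n : ℕ} (w : BraidWord n) (u : ℝ) (k : ℕ) : Space3 := cylPoint (dipMotion w 1 u k) u

/-- The ascending part of the loop, a spiral. -/
def spiralPoint (n : ℕ) (u : ℝ) : Space3 :=
  cylPoint ((n : ℝ) - 16 * ((u - 3 / 4) * (1 - u)), 16 * (u - 1)) (5 * u - 3)

/-- One or, for the strand that ends in position `n`, two turns of the loop. -/
def spiralArc {n : ℕ} (w : BraidWord n) (u : ℝ) (k : ℕ) : Space3 :=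
  if wordPerm w k = n then if u ≤ 3 / 4 then flatArc w u k else spiralPoint n u else flatArc w u k

theorem spiralArc_of_le {n : ℕ} (w : BraidWord n) {u : ℝ} (hu : u ≤ 3 / 4) (k : ℕ) :
    spiralArc w u k = flatArc w u k := by
  rw [spiralArc, if_pos hu, ite_self]

theorem spiralArc_other {n : ℕ} (w : BraidWord n) (u : ℝ) {k : ℕ} (hk : wordPerm w k ≠ n) :
    spiralArc w u k = flatArc w u k := if_neg hk

theorem spiralArc_of_gt {n : ℕ} (w : BraidWord n) {u : ℝ} (hu : 3 / 4 < u) {k : ℕ}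
    (hk : wordPerm w k = n) : spiralArc w u k = spiralPoint n u := by
  rw [spiralArc, if_pos hk, if_neg hu.not_ge]

theorem flatArc_of_ge {n : ℕ} (w : BraidWord n) {u : ℝ} (h0 : 3 / 4 ≤ u) (h1 : u ≤ 1) {k : ℕ}
    (hk : wordPerm w k = n) : flatArc w u k = cylPoint ((n : ℝ), 16 * (u - 1)) u := by
  rw [flatArc, dipMotion_of_ge w 1 (by linarith) hk, dipDepth_of_ge h0 h1]
  congr 2
  ring

theorem flatArc_closing {n : ℕ} (w : BraidWord n) (k : ℕ) :
    flatArc w 1 k = flatArc w 0 (wordPerm w k) := by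
  have := cylPoint_add_int (dipMotion w 1 1 k) 0 1
  rw [Int.cast_one, zero_add] at this
  rw [flatArc, flatArc, this, dipMotion_closing]

theorem spiralArc_closing {n : ℕ} (w : BraidWord n) (k : ℕ) :
    spiralArc w 1 k = spiralArc w 0 (wordPerm w k) := by
  rw [spiralArc_of_le w (by norm_num : (0 : ℝ) ≤ 3 / 4), ← flatArc_closing]
  by_cases hk : wordPerm w k = n
  · rw [spiralArc_of_gt w (by norm_num) hk, flatArc_of_ge w (by norm_num) le_rfl hk, spiralPoint]
    have := cylPoint_add_int ((n : ℝ), 16 * (1 - 1)) 1 1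
    rw [Int.cast_one] at this
    rw [← this]
    norm_num
  · exact spiralArc_other w 1 hk

theorem locallyLipschitz_flatArc {n : ℕ} (w : BraidWord n) (k : ℕ) :
    LocallyLipschitz fun u => flatArc w u k :=
  locallyLipschitz_cylPoint (locallyLipschitz_dipMotion w 1 k)
    (ContDiff.locallyLipschitz (𝕂 := ℝ) contDiff_id)

theorem locallyLipschitz_spiralArc {n : ℕ} (w : BraidWord n) (k : ℕ) :
    LocallyLipschitz fun u => spiralArc w u k := by
  by_cases hk : wordPerm w k = n
  · have hp : LocallyLipschitz fun u : ℝ => ((n : ℝ) - 16 * ((u - 3 / 4) * (1 - u)), 16 * (u - 1)) :=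
      ContDiff.locallyLipschitz (𝕂 := ℝ) (by fun_prop)
    have hθ : LocallyLipschitz fun u : ℝ => 5 * u - 3 :=
      ContDiff.locallyLipschitz (𝕂 := ℝ) (by fun_prop)
    have h := (locallyLipschitz_flatArc w k).if_le (locallyLipschitz_cylPoint hp hθ) (a := 3 / 4) (by
      rw [flatArc_of_ge w le_rfl (by norm_num) hk]; norm_num)
    simp only [spiralArc, hk, if_true, spiralPoint]
    exact h
  · simp only [spiralArc, hk, if_false]
    exact locallyLipschitz_flatArc w k

/-- The closed braid with the loop of two turns. -/
def loopCurve {n : ℕ} (w : BraidWord n) (k : ℕ) (t : ℝ) : Space3 :=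
  cylPoint (unroll (stabPerm w) (loopMotion w 1) k t) t

theorem loopCurve_add_int {n : ℕ} (w : BraidWord n) (k : ℕ) (t : ℝ) (q : ℤ) :
    loopCurve w k (t + q) = loopCurve w ((stabPerm w ^ q) k) t := by
  rw [loopCurve, cylPoint_add_int, (equivariant_unroll _ _).add_int, loopCurve]

theorem loopCurve_of_mem {n : ℕ} (w : BraidWord n) (hn : 1 ≤ n) {k : ℕ}
    (hk : k ∈ Set.Icc 1 (n + 1)) {u : ℝ} (h0 : 0 ≤ u) (h1 : u ≤ 1) :
    loopCurve w k u = cylPoint (loopMotion w 1 u k) u := by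
  rw [loopCurve, unroll_of_mem (mapsTo_stabPerm w hn) (fun j hj => loopMotion_closing w 1 hj) hk
    (k := 0) (by simpa using h0) (by simpa using h1)]
  simp

/-- With its last quarter run five times as fast, the strand that ends in position `n` also passes
through the whole following turn, which starts in position `n + 1`. The two turns count as one, and
position `n + 1` disappears. -/
theorem loopCurve_eq_spiralArc {n : ℕ} (w : BraidWord n) (hn : 1 ≤ n) {k : ℕ}
    (hk : k ∈ Set.Icc 1 n) {u : ℝ} (h0 : 0 ≤ u) (h1 : u ≤ 1) :
    loopCurve w k (u + ((if wordPerm w k = n then 1 else 0 : ℤ) : ℝ) * max 0 (4 * u - 3)) =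
      spiralArc w u k := by
  have hk' : k ∈ Set.Icc 1 (n + 1) := ⟨hk.1, hk.2.trans (Nat.le_succ n)⟩
  have hk1 : k ≠ n + 1 := by have := hk.2; omega
  by_cases h : wordPerm w k = n
  · rw [if_pos h, Int.cast_one, one_mul]
    rcases le_or_gt u (3 / 4) with h34 | h34
    · rw [max_eq_left (by linarith), add_zero, spiralArc_of_le w h34, flatArc,
        loopCurve_of_mem w hn hk' h0 h1, loopMotion_outer w 1 u h]
      rcases le_total u (1 / 2) with h12 | h12
      · rw [outerOffset_of_le h12, add_zero, dipMotion_of_le w 1 h12]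
      · rw [dipMotion_of_ge w 1 h12 h, firstHalf_of_ge w k h12, h, outerOffset,
          max_eq_left (by linarith : u - 3 / 4 ≤ 0), max_eq_right (by linarith : 0 ≤ u - 1 / 2),
          max_eq_left (by linarith), dipDepth_of_mem h12 h34]
        simp
    · rw [max_eq_right (by linarith), spiralArc_of_gt w h34 h, spiralPoint,
        show u + (4 * u - 3) = 5 * u - 3 by ring]
      rcases le_total (5 * u - 3) 1 with h45 | h45
      · rw [loopCurve_of_mem w hn hk' (by linarith) h45, loopMotion_outer w 1 _ h,
          firstHalf_of_ge w k (by linarith), h, outerOffset,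
          max_eq_right (by linarith : 0 ≤ 5 * u - 3 - 3 / 4),
          max_eq_right (by linarith : 0 ≤ 5 * u - 3 - 1 / 2), max_eq_right (by linarith)]
        congr 1
        ext
        · simp only [Prod.fst_add]; ring
        · simp only [Prod.snd_add]; ring
      · have e := loopCurve_add_int w k (5 * u - 4) 1
        have e' := cylPoint_add_int ((n : ℝ) - 16 * ((u - 3 / 4) * (1 - u)), 16 * (u - 1))
          (5 * u - 4) 1
        rw [Int.cast_one, show 5 * u - 4 + 1 = 5 * u - 3 by ring] at e e'
        rw [e, e', zpow_one, stabPerm_outer w h,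
          loopCurve_of_mem w hn ⟨by omega, le_rfl⟩ (by linarith) (by linarith), loopMotion_inner,
          innerOffset]
        congr 1
        ext
        · push_cast [Prod.fst_add]; ring
        · simp only [Prod.snd_add]; ring
  · rw [if_neg h, Int.cast_zero, zero_mul, add_zero, spiralArc_other w u h, flatArc,
      loopCurve_of_mem w hn hk' h0 h1, loopMotion_other w 1 u h hk1, dipMotion_other w 1 u h]

/-- Each passage to position `n` takes one extra turn through `n + 1`; `D` counts these turns. -/
theorem stabPerm_zpow {n : ℕ} (w : BraidWord n) {k : ℕ} (hk : k ∈ Set.Icc 1 n) {D : ℤ → ℤ}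
    (D0 : D 0 = 0)
    (hD : ∀ m, D (m + 1) = D m + if wordPerm w ((wordPerm w ^ m) k) = n then 1 else 0) (m : ℤ) :
    (stabPerm w ^ (m + D m)) k = (wordPerm w ^ m) k := by
  have step : ∀ m : ℤ, (stabPerm w ^ (1 + if wordPerm w ((wordPerm w ^ m) k) = n then 1 else 0 : ℤ))
      ((wordPerm w ^ m) k) = (wordPerm w ^ (m + 1)) k := by
    intro m
    have hx := (wordPerm_zpow_mem w hk m).2
    rw [add_comm m, zpow_one_add (wordPerm w), Equiv.Perm.mul_apply]
    by_cases h : wordPerm w ((wordPerm w ^ m) k) = n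
    · rw [if_pos h, zpow_one_add, zpow_one, Equiv.Perm.mul_apply, stabPerm_outer w h,
        stabPerm_inner, h]
    · rw [if_neg h, add_zero, zpow_one, stabPerm_other w h (by omega)]
  have shift : ∀ m : ℤ, m + 1 + D (m + 1) =
      (1 + if wordPerm w ((wordPerm w ^ m) k) = n then 1 else 0) + (m + D m) := fun m => by
    rw [hD]; ring
  induction m using Int.induction_on with
  | zero => rw [D0, add_zero]; rfl
  | succ m ih => rw [shift, zpow_add, Equiv.Perm.mul_apply, ih, step]
  | pred m ih =>
    have h1 := shift (-m - 1)
    have h2 := step (-m - 1)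
    rw [sub_add_cancel] at h1 h2
    rw [h1, zpow_add, Equiv.Perm.mul_apply, ← h2] at ih
    exact (stabPerm w ^ _).injective ih

/-- The last clause is used for tangents: outside the fast quarter the angle of the loop agrees with
`t` up to whole turns. -/
theorem exists_loopCurve_reparametrization {n : ℕ} (w : BraidWord n) (hn : 1 ≤ n) {k : ℕ}
    (hk : k ∈ Set.Icc 1 n) : ∃ Φ : ℝ ≃o ℝ, LocallyLipschitz Φ ∧ (∀ u t, u ≤ t → t - u ≤ Φ t - Φ u) ∧
      (∀ t, loopCurve w k (Φ t) = unroll (wordPerm w) (spiralArc w) k t) ∧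
      ∀ t, (wordPerm w ((wordPerm w ^ ⌊t⌋) k) = n → Int.fract t ≤ 3 / 4) → ∃ a : ℤ, Φ t = t + a := by
  obtain ⟨D, Φ, D0, hD, hΦ, lΦ, iΦ⟩ := exists_reparametrization
    (c := fun m => if wordPerm w ((wordPerm w ^ m) k) = n then 1 else 0)
    (fun m => by split_ifs <;> simp)
  have mem : ∀ t : ℝ, t ∈ Set.Icc (⌊t⌋ : ℝ) (⌊t⌋ + 1) := fun t =>
    ⟨Int.floor_le t, (Int.lt_floor_add_one t).le⟩
  refine ⟨Φ, lΦ, iΦ, fun t => ?_, fun t ht => ⟨D ⌊t⌋, ?_⟩⟩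
  · have e := loopCurve_eq_spiralArc w hn (wordPerm_zpow_mem w hk ⌊t⌋) (Int.fract_nonneg t)
      (Int.fract_lt_one t).le
    rw [unroll, ← e, ← stabPerm_zpow w hk D0 hD, ← loopCurve_add_int, stabPerm_zpow w hk D0 hD,
      hΦ ⌊t⌋ t (mem t)]
    congr 1
    push_cast [Int.fract]
    ring
  · rw [hΦ ⌊t⌋ t (mem t)]
    split_ifs with h
    · have := ht h
      rw [Int.fract] at this
      rw [max_eq_left (by linarith)]
      simp
    · simp

/-- Both families trace the same curves, so nothing moves. The strand in position `n + 1` is the one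
in position `n`, one turn earlier in its parameter. -/
theorem loopCurve_famIso {n : ℕ} (w : BraidWord n) (hn : 1 ≤ n) :
    FamIso (braidFam (n + 1) (stabPerm w) (loopMotion w 1))
      fun (k : Set.Icc 1 n) t => unroll (wordPerm w) (spiralArc w) k t := by
  refine ⟨Homeomorph.refl _, isAmbient_refl, fun k => ?_, fun k => ?_⟩
  · have key : ∀ j ∈ Set.Icc 1 n, ∃ i : Set.Icc 1 n, ∃ φ : ℝ ≃o ℝ, ∀ t,
        loopCurve w j t = unroll (wordPerm w) (spiralArc w) i (φ t) := fun j hj => by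
      obtain ⟨Φ, -, -, h, -⟩ := exists_loopCurve_reparametrization w hn hj
      exact ⟨⟨j, hj⟩, Φ.symm, fun t => by rw [← h, OrderIso.apply_symm_apply]⟩
    by_cases hk : (k : ℕ) ≤ n
    · exact key k ⟨k.2.1, hk⟩
    · have hk' : (k : ℕ) = n + 1 := by have := k.2.2; omega
      obtain ⟨i, φ, h⟩ := key n ⟨hn, le_rfl⟩
      refine ⟨i, (OrderIso.subRight (1 : ℝ)).trans φ, fun t => ?_⟩
      have e := loopCurve_add_int w k (t - 1) 1
      rw [Int.cast_one, sub_add_cancel, zpow_one, hk', stabPerm_inner, h] at e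
      rw [← hk'] at e
      exact e
  · obtain ⟨Φ, -, -, h, -⟩ := exists_loopCurve_reparametrization w hn k.2
    refine ⟨⟨k, k.2.1, k.2.2.trans (Nat.le_succ n)⟩, Φ.symm, fun t => ?_⟩
    have e := h (Φ.symm t)
    rw [OrderIso.apply_symm_apply] at e
    exact e

/-! ### Contraction of the spiral -/

theorem spiralArc_snd {n : ℕ} (w : BraidWord n) {u : ℝ} (h0 : 3 / 4 < u) (h1 : u ≤ 1) {k : ℕ}
    (hk : wordPerm w k = n) :
    (spiralArc w u k).2 = 16 * (u - 1) ∧ (flatArc w u k).2 = 16 * (u - 1) := by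
  rw [spiralArc_of_gt w h0 hk, flatArc_of_ge w h0.le h1 hk]
  exact ⟨rfl, rfl⟩

/-- The spiral avoids the rest of the closed braid while it is contracted. -/
theorem spiral_ne_flatArc {n : ℕ} (w : BraidWord n) (hn : 1 ≤ n) {x y : ℕ} {t u s : ℝ}
    (hx : wordPerm w x = n) (hy : y ∈ Set.Icc 1 n) (t0 : 3 / 4 < t) (t1 : t < 1) (u0 : 0 ≤ u)
    (hyu : wordPerm w y = n → u ≤ 3 / 4) (hs : s ∈ Set.Icc (0 : ℝ) 1) :
    (1 - s) • spiralPoint n t + s • flatArc w t x ≠ flatArc w u y := by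
  intro h
  have hπ := Real.pi_pos
  have hn' : (1 : ℝ) ≤ n := by exact_mod_cast hn
  have hs' := sub_nonneg.2 hs.2
  rw [flatArc_of_ge w t0.le t1.le hx] at h
  have ρn : 0 < (t - 3 / 4) * (1 - t) := mul_pos (by linarith) (by linarith)
  have ρ0 : (t - 3 / 4) * (1 - t) ≤ 1 / 64 := by nlinarith [sq_nonneg (t - 7 / 8)]
  have hz : 16 * (t - 1) = (dipMotion w 1 u y).2 := by
    have := congrArg Prod.snd h
    simp only [spiralPoint, cylPoint, flatArc, Prod.snd_add, Prod.smul_snd, smul_eq_mul] at this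
    linarith
  rcases le_or_gt u (1 / 2) with hu | hu
  -- While `w` is carried out, the angle lies in the first half turn and the height is at least
  -- `-1/2`. At such a height `t ≥ 31/32`, so the angles `t` and `5 * t - 3` lie in the second half
  -- turn and the imaginary parts have different signs.
  · have him := congrArg (fun q : Space3 => q.1.im) h
    simp only [Prod.fst_add, Prod.smul_fst, Complex.add_im, Complex.smul_im, smul_eq_mul,
      spiralPoint, flatArc, cylPoint_im] at him
    rw [dipMotion_of_le w 1 hu] at hz him
    obtain ⟨b1, -, b3⟩ := firstHalf_bounds w hy u0
    have b4 := neg_le_of_abs_le b3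
    have ht : 31 / 32 ≤ t := by linarith
    have s1 : 0 ≤ Real.sin (2 * Real.pi * u) :=
      Real.sin_nonneg_of_nonneg_of_le_pi (by positivity) (by nlinarith)
    have s2 : Real.sin (2 * Real.pi * t) < 0 := by
      rw [← Real.sin_sub_two_pi]
      exact Real.sin_neg_of_neg_of_neg_pi_lt (by nlinarith) (by nlinarith)
    have s3 : Real.sin (2 * Real.pi * (5 * t - 3)) < 0 := by
      rw [← Real.sin_sub_two_pi, ← Real.sin_sub_two_pi]
      exact Real.sin_neg_of_neg_of_neg_pi_lt (by nlinarith) (by nlinarith)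
    have s1' := mul_nonneg b1.le s1
    have s2' : (n : ℝ) * Real.sin (2 * Real.pi * t) < 0 := mul_neg_of_pos_of_neg (by linarith) s2
    have s3' : ((n : ℝ) - 16 * ((t - 3 / 4) * (1 - t))) * Real.sin (2 * Real.pi * (5 * t - 3)) < 0 :=
      mul_neg_of_pos_of_neg (by linarith) s3
    rcases hs.1.eq_or_lt with rfl | hs0
    · linarith
    · have h1 := mul_nonneg hs' (neg_nonneg.2 s3'.le)
      have h2 := mul_pos hs0 (neg_pos.2 s2')
      linarith
  · by_cases hk : wordPerm w y = n
    · have hu' := hyu hk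
      rw [flatArc, dipMotion_of_ge w 1 hu.le hk] at h
      -- The descending strand stays on the cylinder of radius `n`. The spiral runs strictly inside,
      -- hence so do the combinations with `s < 1`; for `s = 1` the real parts tell the two arcs
      -- apart.
      have hnorm := congrArg (fun q : Space3 => ‖q.1‖) h
      simp only [Prod.fst_add, Prod.smul_fst] at hnorm
      rw [norm_cylPoint_fst (by positivity)] at hnorm
      have hle := norm_add_le ((1 - s) • (spiralPoint n t).1)
        (s • (cylPoint ((n : ℝ), 16 * (t - 1)) t).1)
      rw [hnorm, norm_smul, norm_smul, spiralPoint, norm_cylPoint_fst (by simp only; linarith),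
        norm_cylPoint_fst (by positivity), Real.norm_of_nonneg hs', Real.norm_of_nonneg hs.1] at hle
      simp only at hle
      have e : (1 - s) * ((t - 3 / 4) * (1 - t)) ≤ 0 := by nlinarith
      have e' : s = 1 := by
        by_contra hne
        have : 0 < 1 - s := lt_of_le_of_ne hs' fun h => hne (by linarith)
        linarith [mul_pos this ρn]
      subst e'
      have hre := congrArg (fun q : Space3 => q.1.re) h
      simp only [Prod.fst_add, Prod.smul_fst, Complex.add_re, Complex.smul_re, smul_eq_mul,
        spiralPoint, cylPoint_re, sub_self, zero_mul, zero_add, one_mul] at hre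
      have c1 : 0 < Real.cos (2 * Real.pi * t) := by
        rw [← Real.cos_sub_two_pi]
        exact Real.cos_pos_of_mem_Ioo ⟨by nlinarith, by nlinarith⟩
      have c2 : Real.cos (2 * Real.pi * u) ≤ 0 :=
        Real.cos_nonpos_of_pi_div_two_le_of_le (by nlinarith) (by nlinarith)
      have c3 := mul_le_mul_of_nonneg_left c2 (show (0 : ℝ) ≤ n by linarith)
      have c4 := mul_pos (show (0 : ℝ) < n by linarith) c1
      linarith
    -- The other strands rest at height `0`, above the spiral.
    · rw [dipMotion_other w 1 u hk, firstHalf_of_ge w y hu.le] at hz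
      simp only at hz
      linarith

theorem arcs_injective {n : ℕ} (w : BraidWord n) (hn : 1 ≤ n) {x y : ℕ} {t u s : ℝ}
    (hx : x ∈ Set.Icc 1 n) (hy : y ∈ Set.Icc 1 n) (ht : t ∈ Set.Ico (0 : ℝ) 1)
    (hu : u ∈ Set.Ico (0 : ℝ) 1) (hs : s ∈ Set.Icc (0 : ℝ) 1)
    (h : (1 - s) • (spiralArc w t x - spiralArc w u y) + s • (flatArc w t x - flatArc w u y) = 0) :
    t = u ∧ x = y := by
  have key : (1 - s) • spiralArc w t x + s • flatArc w t x =
      (1 - s) • spiralArc w u y + s • flatArc w u y := by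
    rw [← sub_eq_zero, ← h]
    module
  have flat : ∀ {v : ℝ} {z : ℕ}, (wordPerm w z = n → v ≤ 3 / 4) →
      spiralArc w v z = flatArc w v z := fun {v z} hz => by
    by_cases hk : wordPerm w z = n
    · exact spiralArc_of_le w (hz hk) z
    · exact spiralArc_other w v hk
  have comb : ∀ p : Space3, (1 - s) • p + s • p = p := fun p => by module
  by_cases h1 : wordPerm w x = n ∧ 3 / 4 < t
  · by_cases h2 : wordPerm w y = n ∧ 3 / 4 < u
    -- On the ascents the contraction does not change the height `16 * (t - 1)`, which determines
    -- the time.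
    · have hz := congrArg Prod.snd key
      obtain ⟨a1, a2⟩ := spiralArc_snd w h1.2 ht.2.le h1.1
      obtain ⟨b1, b2⟩ := spiralArc_snd w h2.2 hu.2.le h2.1
      simp only [Prod.snd_add, Prod.smul_snd, smul_eq_mul, a1, a2, b1, b2] at hz
      exact ⟨by linarith, (wordPerm w).injective (h1.1.trans h2.1.symm)⟩
    · have h2' : wordPerm w y = n → u ≤ 3 / 4 := fun e => le_of_not_gt fun e' => h2 ⟨e, e'⟩
      rw [flat h2', comb, spiralArc_of_gt w h1.2 h1.1] at key
      exact (spiral_ne_flatArc w hn h1.1 hy h1.2 ht.2 hu.1 h2' hs key).elim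
  · have h1' : wordPerm w x = n → t ≤ 3 / 4 := fun e => le_of_not_gt fun e' => h1 ⟨e, e'⟩
    rw [flat h1', comb] at key
    by_cases h2 : wordPerm w y = n ∧ 3 / 4 < u
    · rw [spiralArc_of_gt w h2.2 h2.1] at key
      exact (spiral_ne_flatArc w hn h2.1 hx h2.2 hu.2 ht.1 h1' hs key.symm).elim
    · have h2' : wordPerm w y = n → u ≤ 3 / 4 := fun e => le_of_not_gt fun e' => h2 ⟨e, e'⟩
      rw [flat h2', comb] at key
      obtain ⟨e1, m, e2⟩ := cylPoint_eq (dipMotion_pos w ht.1 hx) (dipMotion_pos w hu.1 hy) key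
      have hm : m = 0 := by
        have c1 : (m : ℝ) < 1 := by linarith [hu.2, ht.1]
        have c2 : (-1 : ℝ) < m := by linarith [hu.1, ht.2]
        have c3 : m < 1 := by exact_mod_cast c1
        have c4 : -1 < m := by exact_mod_cast c2
        omega
      subst hm
      rw [Int.cast_zero, add_zero] at e2
      subst e2
      exact ⟨rfl, dipMotion_injective w ht.1 e1⟩

-- On the ascent the spiral and its contraction climb with the same slope `16`, and height is the
-- functional. Elsewhere both turn forwards at the same angle up to whole turns, and the tangential
-- coordinate serves.
open Filter Topology in
theorem exists_functional_spiralArc {n : ℕ} (w : BraidWord n) (hn : 1 ≤ n) {i : ℕ} (hi : i ∈ Set.Icc 1 n) (t₀ : ℝ) :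
    ∃ (ℓ : Space3 →L[ℝ] ℝ) (c : ℝ), 0 < c ∧
      ∀ᶠ p : ℝ × ℝ in 𝓝 (t₀, t₀), p.2 ≤ p.1 →
        c * (p.1 - p.2) ≤ ℓ (unroll (wordPerm w) (spiralArc w) i p.1 -
          unroll (wordPerm w) (spiralArc w) i p.2) ∧
        c * (p.1 - p.2) ≤ ℓ (unroll (wordPerm w) (flatArc w) i p.1 -
          unroll (wordPerm w) (flatArc w) i p.2) := by
  by_cases hz : wordPerm w ((wordPerm w ^ ⌊t₀⌋) i) = n ∧ 3 / 4 < Int.fract t₀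
  · obtain ⟨hk, hf⟩ := hz
    refine ⟨ContinuousLinearMap.snd ℝ ℂ ℝ, 16, by norm_num, ?_⟩
    have hmem : t₀ ∈ Set.Ioo ((⌊t₀⌋ : ℝ) + 3 / 4) (⌊t₀⌋ + 1) :=
      ⟨by rw [Int.fract] at hf; linarith, Int.lt_floor_add_one t₀⟩
    have hsnd : ∀ t ∈ Set.Ioo ((⌊t₀⌋ : ℝ) + 3 / 4) (⌊t₀⌋ + 1),
        (unroll (wordPerm w) (spiralArc w) i t).2 = 16 * (t - ⌊t₀⌋ - 1) ∧
        (unroll (wordPerm w) (flatArc w) i t).2 = 16 * (t - ⌊t₀⌋ - 1) := fun t ht => by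
      have hfl : ⌊t⌋ = ⌊t₀⌋ := Int.floor_eq_iff.2 ⟨by linarith [ht.1], ht.2⟩
      simp only [unroll, Int.fract, hfl]
      exact spiralArc_snd w (by linarith [ht.1]) (by linarith [ht.2]) hk
    filter_upwards [prod_mem_nhds (Ioo_mem_nhds hmem.1 hmem.2) (Ioo_mem_nhds hmem.1 hmem.2)]
      with p hp _
    obtain ⟨a1, a2⟩ := hsnd _ hp.1
    obtain ⟨b1, b2⟩ := hsnd _ hp.2
    rw [ContinuousLinearMap.coe_snd', Prod.snd_sub, Prod.snd_sub, a1, a2, b1, b2]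
    constructor <;> linarith
  · obtain ⟨Φ, lΦ, iΦ, hΦ, aΦ⟩ := exists_loopCurve_reparametrization w hn hi
    obtain ⟨a, ha⟩ := aΦ t₀ fun e => le_of_not_gt fun e' => hz ⟨e, e'⟩
    have hi' : i ∈ Set.Icc 1 (n + 1) := ⟨hi.1, hi.2.trans (Nat.le_succ n)⟩
    have lP : LocallyLipschitz fun t => unroll (stabPerm w) (loopMotion w 1) i (Φ t) :=
      (locallyLipschitz_unroll (mapsTo_stabPerm w hn) (fun j hj => loopMotion_closing w 1 hj)
        (fun j _ => locallyLipschitz_loopMotion w 1 j) hi').comp lΦ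
    have pP : 0 < (unroll (stabPerm w) (loopMotion w 1) i (Φ t₀)).1 :=
      loopMotion_pos w hn ⟨zero_le_one, le_rfl⟩ ⟨Int.fract_nonneg _, (Int.fract_lt_one _).le⟩
        (mapsTo_zpow (mapsTo_stabPerm w hn) _ hi')
    obtain ⟨c₁, hc₁, h₁⟩ := eventually_tangentForm (t₀ := t₀) (θ := Φ) lP
      lΦ.continuous.continuousAt pP ha (Eventually.of_forall fun q hq => iΦ _ _ hq)
    have lQ : LocallyLipschitz (unroll (wordPerm w) (dipMotion w 1) i) :=
      locallyLipschitz_unroll (mapsTo_wordPerm w) (fun j _ => dipMotion_closing w 1 j)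
        (fun j _ => locallyLipschitz_dipMotion w 1 j) hi
    have pQ : 0 < (unroll (wordPerm w) (dipMotion w 1) i t₀).1 :=
      dipMotion_pos w (Int.fract_nonneg _) (mapsTo_zpow (mapsTo_wordPerm w) _ hi)
    obtain ⟨c₂, hc₂, h₂⟩ := eventually_tangentForm (t₀ := t₀) (θ := id) (φ := t₀) (k := 0) lQ
      continuousAt_id pQ (by simp) (Eventually.of_forall fun q _ => le_rfl)
    have eQ : ∀ t, cylPoint (unroll (wordPerm w) (dipMotion w 1) i t) t =
        unroll (wordPerm w) (flatArc w) i t := fun t => by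
      have := cylPoint_add_int (unroll (wordPerm w) (dipMotion w 1) i t) (Int.fract t) ⌊t⌋
      rw [Int.fract_add_floor] at this
      rw [this]
      rfl
    refine ⟨tangentForm t₀, min c₁ c₂, lt_min hc₁ hc₂, ?_⟩
    filter_upwards [h₁, h₂] with q q₁ q₂ hq
    have e₁ := q₁ hq
    have e₂ := q₂ hq
    rw [id, id, eQ, eQ] at e₂
    change _ ≤ tangentForm t₀ (loopCurve w i (Φ q.1) - loopCurve w i (Φ q.2)) at e₁
    rw [hΦ, hΦ] at e₁
    exact ⟨(mul_le_mul_of_nonneg_right (min_le_left _ _) (sub_nonneg.2 hq)).trans e₁,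
      (mul_le_mul_of_nonneg_right (min_le_right _ _) (sub_nonneg.2 hq)).trans e₂⟩

/-- The contraction does not keep angles, so the version for closed braids is not enough and
`exists_isAmbient_of_linear` is applied directly. -/
theorem spiralArc_famIso {n : ℕ} (w : BraidWord n) (hn : 1 ≤ n) :
    FamIso (fun (k : Set.Icc 1 n) t => unroll (wordPerm w) (spiralArc w) k t)
      (braidFam n (wordPerm w) (dipMotion w 1)) := by
  have hπ := mapsTo_wordPerm w
  obtain ⟨h, hh, H⟩ := exists_isAmbient_of_linear hπ (f := unroll (wordPerm w) (spiralArc w))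
    (g := unroll (wordPerm w) (flatArc w)) (equivariant_unroll _ _) (equivariant_unroll _ _)
    (fun j hj => locallyLipschitz_unroll hπ (fun k _ => spiralArc_closing w k)
      (fun k _ => locallyLipschitz_spiralArc w k) hj)
    (fun j hj => locallyLipschitz_unroll hπ (fun k _ => flatArc_closing w k)
      (fun k _ => locallyLipschitz_flatArc w k) hj)
    (fun i hi j hj t u s hs h0 => by
      obtain ⟨e1, e2⟩ := arcs_injective w hn (mapsTo_zpow hπ ⌊t⌋ hi) (mapsTo_zpow hπ ⌊u⌋ hj)
        ⟨Int.fract_nonneg t, Int.fract_lt_one t⟩ ⟨Int.fract_nonneg u, Int.fract_lt_one u⟩ hs h0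
      refine ⟨⌊u⌋ - ⌊t⌋, ?_, ?_⟩
      · rw [Int.fract, Int.fract] at e1
        push_cast
        linarith
      · rw [sub_eq_neg_add, zpow_add, Equiv.Perm.mul_apply, ← e2, ← Equiv.Perm.mul_apply, ← zpow_add,
          neg_add_cancel, zpow_zero, Equiv.Perm.one_apply])
    (fun i hi t₀ => exists_functional_spiralArc w hn hi t₀)
  refine FamIso.of_eq hh fun k t => (H k k.2 t).trans ?_
  have := cylPoint_add_int (unroll (wordPerm w) (dipMotion w 1) k t) (Int.fract t) ⌊t⌋
  rw [Int.fract_add_floor] at this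
  rw [braidFam, this]
  rfl

/-- The positive Markov move, the only step that changes the number of strands: crossing, loop of
two turns, spiral, dip and the plain closed braid are joined in this order. -/
theorem closureIso_stabilize {n : ℕ} (hn : 1 ≤ n) (α : BraidGroup n) :
    ClosureIso (braidIncl (Nat.le_succ n) α * braidSigma (n + 1) n) α := by
  obtain ⟨w, rfl⟩ := exists_toBraid_eq α
  have e : (stabWord w hn).toBraid =
      braidIncl (Nat.le_succ n) w.toBraid * braidSigma (n + 1) n := by
    rw [stabWord, toBraid_append, toBraid_lift, toBraid_singleton,
      braidSigma_of ⟨hn, Nat.lt_succ_self n⟩]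
  rw [← e]
  exact closureIso_of_words (((((closedFam_stabWord w hn).trans (braidFam_loopMotion w hn)).trans
    (loopCurve_famIso w hn)).trans (spiralArc_famIso w hn)).trans (braidFam_dipMotion w))

/-! ### Closures of twisted braids -/

/-- One strand is traded for one more descending factor: the new descending product has one
generator more than wanted, its top one, and the Markov move removes it. -/
theorem closureIso_twist_step {l i : ℕ} (γ : BraidGroup (l + 1)) (k : ℕ) :
    ClosureIso
      (braidIncl (show l + 1 ≤ l + 1 + i + 1 by omega) γ *
        ascending (braidSigma (l + 1 + i + 1)) (l + i + 1) ^ (l + 1) *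
        descending (braidSigma (l + 1 + i + 1)) (i + 1) l ^ k)
      (braidIncl (show l + 1 ≤ l + 1 + i by omega) γ *
        ascending (braidSigma (l + 1 + i)) (l + i) ^ (l + 1) *
        descending (braidSigma (l + 1 + i)) i l ^ (k + 1)) := by
  have hs := isBraidSeq_braidSigma (l + 1 + i + 1)
  set s := braidSigma (l + 1 + i + 1)
  set c := braidIncl (show l + 1 ≤ l + 1 + i + 1 by omega) γ
  have h1 := hs.ascending_pow (l + 1) (b := i) (k := l + i) (by omega) (by omega)
  have h2 := (hs.semiconjBy_descending (b := i) (l := l + 1) (a := i) (c := l) le_rfl (by omega)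
    (by omega)).pow_right k
  -- The old power crosses the new product, which lowers its indices by one; then the top generator
  -- `s (l + 1 + i)` occurs exactly once.
  have e1 : c * ascending s (l + i + 1) ^ (l + 1) * descending s (i + 1) l ^ k =
      (c * ascending s (l + i) ^ (l + 1) * descending s i l ^ k * s (l + 1 + i)) *
        descending s i l := by
    rw [h1, mul_assoc, mul_assoc (ascending s (l + i) ^ (l + 1)), h2.eq, descending,
      show i + l + 1 = l + 1 + i by omega]
    simp only [mul_assoc]
  rw [e1]
  refine (closureIso_mul_comm _ _).trans ?_
  have e2 : descending s i l *
      (c * ascending s (l + i) ^ (l + 1) * descending s i l ^ k * s (l + 1 + i)) =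
      braidIncl (Nat.le_succ (l + 1 + i)) (descending (braidSigma (l + 1 + i)) i l *
        (braidIncl (show l + 1 ≤ l + 1 + i by omega) γ *
        ascending (braidSigma (l + 1 + i)) (l + i) ^ (l + 1) *
        descending (braidSigma (l + 1 + i)) i l ^ k)) * s (l + 1 + i) := by
    simp only [map_mul, map_pow]
    rw [braidIncl_descending _ (by omega), braidIncl_ascending _ (by omega), braidIncl_trans]
    simp only [mul_assoc]
    rfl
  rw [e2]
  refine (closureIso_stabilize (by omega) _).trans ((closureIso_mul_comm _ _).trans ?_)
  rw [pow_succ (descending _ _ _) k, ← mul_assoc]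
  exact ClosureIso.refl _

theorem closureIso_twist {l : ℕ} (γ : BraidGroup (l + 1)) (i k : ℕ) :
    ClosureIso
      (braidIncl (show l + 1 ≤ l + 1 + i by omega) γ *
        ascending (braidSigma (l + 1 + i)) (l + i) ^ (l + 1) *
        descending (braidSigma (l + 1 + i)) i l ^ k)
      (γ * ascending (braidSigma (l + 1)) l ^ (l + 1) *
        descending (braidSigma (l + 1)) 0 l ^ (i + k)) := by
  induction i generalizing k with
  | zero =>
    rw [Nat.zero_add]
    have := ClosureIso.refl (γ * ascending (braidSigma (l + 1)) l ^ (l + 1) *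
        descending (braidSigma (l + 1)) 0 l ^ k)
    conv at this => enter [1]; rw [← braidIncl_self (le_refl (l + 1)) γ]
    exact this
  | succ i ih =>
    have := (closureIso_twist_step (i := i) γ k).trans (ih (k + 1))
    rw [show i + (k + 1) = i + 1 + k by omega] at this
    exact this

/-- This is `closureIso_twist` for `γ [1,m]^y` in place of `γ`, starting without descending factors.
-/
theorem closureIso_run {m n a : ℕ} (hm : 1 ≤ m) (ha : a ≤ m) (hn : m ≤ n) (γ : BraidGroup a)
    (y : ℤ) :
    ClosureIso (braidIncl (ha.trans hn) γ * braidRun n m ^ y * braidRun n n ^ m)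
      (braidIncl ha γ * (ascending (braidSigma m) (m - 1) ^ (y + m) *
        descending (braidSigma m) 0 (m - 1) ^ (n - m))) := by
  obtain ⟨l, rfl⟩ : ∃ l, m = l + 1 := ⟨m - 1, by omega⟩
  obtain ⟨i, rfl⟩ : ∃ i, n = l + 1 + i := ⟨n - (l + 1), by omega⟩
  have h := closureIso_twist (braidIncl ha γ * braidRun (l + 1) (l + 1) ^ y) i 0
  rw [pow_zero, mul_one, map_mul, map_zpow, braidIncl_trans,
    braidIncl_braidRun _ (by omega) le_rfl, braidRun_succ (l + 1) l, add_zero] at h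
  rw [Nat.add_sub_cancel, Nat.add_sub_cancel_left, zpow_add, zpow_natCast]
  simp only [mul_assoc] at h ⊢
  rw [show braidRun (l + 1 + i) (l + 1 + i) = ascending (braidSigma (l + 1 + i)) (l + i) by
    rw [← braidRun_succ]; congr 1; omega]
  exact h

/-- Descending powers with exponent a multiple of `k + 1` are full twists and may be rewritten as
ascending ones. -/
theorem IsBraidSeq.zpow_mul_pow_eq {G : Type} [Group G] {N : ℕ} {s : ℕ → G} (h : IsBraidSeq N s)
    {k : ℕ} (hk : k < N) {x x' : ℤ} {y y' : ℕ} (hxy : x + y = x' + y')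
    (hy : y ≡ y' [MOD k + 1]) :
    ascending s k ^ x * descending s 0 k ^ y = ascending s k ^ x' * descending s 0 k ^ y' := by
  wlog hle : y ≤ y' generalizing x x' y y'
  · exact (this hxy.symm hy.symm (by omega)).symm
  obtain ⟨t, ht⟩ := (Nat.modEq_iff_dvd' hle).1 hy
  obtain rfl : y' = (k + 1) * t + y := by omega
  obtain rfl : x = x' + ((k + 1) * t : ℕ) := by push_cast at hxy ⊢; linarith
  rw [pow_add, pow_mul, h.descending_pow_eq hk, zpow_add, zpow_natCast, pow_mul]
  simp only [mul_assoc]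

/-- Conjugation by the half twist exchanges the two products; a cyclic rotation restores their
order. -/
theorem closureIso_zpow_mul_pow {m : ℕ} (hm : 1 ≤ m) (x y : ℕ) :
    ClosureIso
      (ascending (braidSigma m) (m - 1) ^ (x : ℤ) * descending (braidSigma m) 0 (m - 1) ^ y)
      (ascending (braidSigma m) (m - 1) ^ (y : ℤ) * descending (braidSigma m) 0 (m - 1) ^ x) := by
  have h := (isBraidSeq_braidSigma m).halfTwist_conj (k := m - 1) (by omega) x y
  have h1 := (closureIso_conj (halfTwist (braidSigma m) (m - 1))
    (ascending (braidSigma m) (m - 1) ^ (x : ℤ) * descending (braidSigma m) 0 (m - 1) ^ y)).symm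
  rw [h] at h1
  have h2 := h1.trans (closureIso_mul_comm _ _)
  rwa [zpow_natCast, zpow_natCast, ← zpow_natCast (ascending _ _) x,
    ← zpow_natCast (ascending _ _) y] at h2

theorem sameClosure_twisted {a m n₁ n₂ : ℕ} {y₁ y₂ : ℤ} (γ : BraidGroup a) (hm : 1 ≤ m)
    (ha : a ≤ m) (h₁ : m ≤ n₁) (h₂ : m ≤ n₂) (h : (n₁ : ℤ) + y₁ = n₂ + y₂)
    (hmod : n₁ ≡ n₂ [MOD m]) :
    SameClosure (braidIncl (ha.trans h₁) γ * braidRun n₁ m ^ y₁ * braidRun n₁ n₁ ^ m)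
      (braidIncl (ha.trans h₂) γ * braidRun n₂ m ^ y₂ * braidRun n₂ n₂ ^ m) := by
  have e := (isBraidSeq_braidSigma m).zpow_mul_pow_eq (k := m - 1) (by omega)
    (x := y₁ + m) (x' := y₂ + m) (y := n₁ - m) (y' := n₂ - m) (by omega) (by
      rw [Nat.sub_add_cancel hm]
      exact Nat.ModEq.add_right_cancel' m (by rwa [Nat.sub_add_cancel h₁, Nat.sub_add_cancel h₂]))
  have h1 := closureIso_run hm ha h₁ γ y₁
  rw [e] at h1
  exact (h1.trans (closureIso_run hm ha h₂ γ y₂).symm).sameClosure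

theorem sameClosure_exchanged {m n₁ n₂ y₁ y₂ : ℕ} (hm : 1 ≤ m) (h₁ : m ≤ n₁) (h₂ : m ≤ n₂)
    (h : n₁ + y₁ = n₂ + y₂) (hmod : n₁ ≡ y₂ [MOD m]) :
    SameClosure (braidRun n₁ m ^ y₁ * braidRun n₁ n₁ ^ m)
      (braidRun n₂ m ^ y₂ * braidRun n₂ n₂ ^ m) := by
  have h1 := closureIso_run hm le_rfl h₁ 1 y₁
  have h2 := closureIso_run hm le_rfl h₂ 1 y₂
  simp only [map_one, one_mul, zpow_natCast] at h1 h2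
  have h3 := closureIso_zpow_mul_pow hm (y₂ + m) (n₂ - m)
  -- The exponents aimed at are those of the second braid in exchanged order; `n₁ - m` and `y₂ + m`
  -- are congruent because `n₁` and `y₂` are.
  have e := (isBraidSeq_braidSigma m).zpow_mul_pow_eq (k := m - 1) (by omega)
    (x := y₁ + m) (x' := (n₂ - m : ℕ)) (y := n₁ - m) (y' := y₂ + m) (by omega) (by
      rw [Nat.sub_add_cancel hm]
      refine Nat.ModEq.add_right_cancel' m ?_
      rw [Nat.sub_add_cancel h₁]
      exact hmod.trans (by simp [Nat.ModEq]))
  rw [e] at h1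
  push_cast at h3
  exact ((h1.trans h3.symm).trans h2.symm).sameClosure

/-! ### From braids to T-links -/

theorem tStrands_append {l : List (ℕ × ℕ)} {m y n s : ℕ}
    (h : IsTLinkParam (l ++ [(m, y), (n, s)])) : tStrands (l ++ [(m, y), (n, s)]) = n := by
  obtain ⟨-, h⟩ := h
  rw [List.pairwise_append] at h
  obtain ⟨-, h1, h2⟩ := h
  have hmn : m ≤ n := by simpa using h1
  have key : ∀ l' : List (ℕ × ℕ), (∀ p ∈ l', p.1 ≤ n) →
      tStrands (l' ++ [(m, y), (n, s)]) = n := by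
    intro l' hl'
    induction l' with
    | nil => simp [tStrands, hmn]
    | cons p l' ih =>
      have := ih fun q hq => hl' q (List.mem_cons_of_mem _ hq)
      have hp := hl' p List.mem_cons_self
      simp only [tStrands, List.cons_append, List.map_cons, List.foldr_cons] at this ⊢
      rw [this]
      exact max_eq_right hp
  exact key l fun p hp => h2 p hp (n, s) (by simp)

/-- The number of strands occurs in the type of `tBraid`; naming it allows a rewriting without
casts. -/
theorem sameTLink_of_sameClosure {l l' : List (ℕ × ℕ)} {n n' : ℕ} (h : tStrands l = n)
    (h' : tStrands l' = n')
    (H : SameClosure (l.map fun p => braidRun n p.1 ^ p.2).prod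
      (l'.map fun p => braidRun n' p.1 ^ p.2).prod) : SameTLink l l' := by
  subst h h'
  exact H

theorem sameTLink_append {l : List (ℕ × ℕ)} {m n₁ n₂ y₁ y₂ : ℕ}
    (h₁ : IsTLinkParam (l ++ [(m, y₁), (n₁, m)])) (h₂ : IsTLinkParam (l ++ [(m, y₂), (n₂, m)]))
    (h : n₁ + y₁ = n₂ + y₂) (hmod : n₁ ≡ n₂ [MOD m]) :
    SameTLink (l ++ [(m, y₁), (n₁, m)]) (l ++ [(m, y₂), (n₂, m)]) := by
  refine sameTLink_of_sameClosure (tStrands_append h₁) (tStrands_append h₂) ?_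
  have hm : 2 ≤ m := (h₁.1 (m, y₁) (by simp)).1
  have hl : ∀ p ∈ l, 1 ≤ p.1 ∧ p.1 ≤ m := fun p hp =>
    ⟨by have := (h₁.1 p (by simp [hp])).1; omega,
      (List.pairwise_append.1 h₁.2).2.2 p hp (m, y₁) (by simp)⟩
  have hmn : ∀ {n y : ℕ}, IsTLinkParam (l ++ [(m, y), (n, m)]) → m ≤ n := fun h => by
    simpa using (List.pairwise_append.1 h.2).2.1
  -- The tiers in `l` use only the first `m` strands, so their product serves as `γ`, with `a = m`.
  have incl : ∀ {n : ℕ} (hn : m ≤ n), (l.map fun p => braidRun n p.1 ^ p.2).prod =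
      braidIncl hn (l.map fun p => braidRun m p.1 ^ p.2).prod := by
    intro n hn
    rw [map_list_prod, List.map_map]
    congr 1
    refine List.map_congr_left fun p hp => ?_
    rw [Function.comp_apply, map_pow, braidIncl_braidRun hn (hl p hp).1 (hl p hp).2]
  have := sameClosure_twisted (y₁ := y₁) (y₂ := y₂) (l.map fun p => braidRun m p.1 ^ p.2).prod
    (by omega) le_rfl (hmn h₁) (hmn h₂) (by exact_mod_cast h) hmod
  rw [← incl, ← incl] at this
  simpa [mul_assoc] using this

theorem isTLinkParam_pair {m n y : ℕ} (hm : 2 ≤ m) (hn : m ≤ n) (hy : 0 < y) :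
    IsTLinkParam ([] ++ [(m, y), (n, m)]) := by
  refine ⟨?_, by simpa using hn⟩
  simp only [List.nil_append, List.mem_cons, List.not_mem_nil, or_false]
  rintro p (rfl | rfl)
  · exact ⟨hm, hy⟩
  · exact ⟨hm.trans hn, by show 0 < m; omega⟩

theorem sameTLink_pair {m n₁ n₂ y₁ y₂ : ℕ} (hm : 2 ≤ m) (h₁ : m ≤ n₁) (h₂ : m ≤ n₂) (hy₁ : 0 < y₁)
    (hy₂ : 0 < y₂) (h : n₁ + y₁ = n₂ + y₂) (hmod : n₁ ≡ n₂ [MOD m] ∨ n₁ ≡ y₂ [MOD m]) :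
    SameTLink [(m, y₁), (n₁, m)] [(m, y₂), (n₂, m)] := by
  have p₁ := isTLinkParam_pair hm h₁ hy₁
  have p₂ := isTLinkParam_pair hm h₂ hy₂
  rcases hmod with hmod | hmod
  · exact sameTLink_append p₁ p₂ h hmod
  · refine sameTLink_of_sameClosure (tStrands_append p₁) (tStrands_append p₂) ?_
    simpa using sameClosure_exchanged (by omega) h₁ h₂ h hmod

end

theorem mainTheorem9 :
    -- closures of twisted braids
    (∀ (a m n₁ n₂ : ℕ) (y₁ y₂ : ℤ) (γ : BraidGroup a) (_ : 1 ≤ m) (ha : a ≤ m)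
      (h₁ : m ≤ n₁) (h₂ : m ≤ n₂),
      (n₁ : ℤ) + y₁ = n₂ + y₂ → n₁ ≡ n₂ [MOD m] →
      SameClosure
        (braidIncl (ha.trans h₁) γ * braidRun n₁ m ^ y₁ * braidRun n₁ n₁ ^ m)
        (braidIncl (ha.trans h₂) γ * braidRun n₂ m ^ y₂ * braidRun n₂ n₂ ^ m)) ∧
    -- T-links with any number of tiers
    (∀ (l : List (ℕ × ℕ)) (m n₁ n₂ y₁ y₂ : ℕ),
      IsTLinkParam (l ++ [(m, y₁), (n₁, m)]) → IsTLinkParam (l ++ [(m, y₂), (n₂, m)]) →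
      n₁ + y₁ = n₂ + y₂ → n₁ ≡ n₂ [MOD m] →
      SameTLink (l ++ [(m, y₁), (n₁, m)]) (l ++ [(m, y₂), (n₂, m)])) ∧
    -- T-links with two tiers
    (∀ m n₁ n₂ y₁ y₂ : ℕ, 2 ≤ m → m ≤ n₁ → m ≤ n₂ → 0 < y₁ → 0 < y₂ →
      n₁ + y₁ = n₂ + y₂ → (n₁ ≡ n₂ [MOD m] ∨ n₁ ≡ y₂ [MOD m]) →
      SameTLink [(m, y₁), (n₁, m)] [(m, y₂), (n₂, m)]) ∧
    (∀ m n y : ℕ, 2 ≤ m → m ≤ n → m ≤ y →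
      SameTLink [(m, y), (n, m)] [(m, n), (y, m)]) := by
  refine ⟨?_, ?_, ?_, ?_⟩
  · intro a m n₁ n₂ y₁ y₂ γ hm ha h₁ h₂ h hmod
    exact sameClosure_twisted γ hm ha h₁ h₂ h hmod
  · intro l m n₁ n₂ y₁ y₂ h₁ h₂ h hmod
    exact sameTLink_append h₁ h₂ h hmod
  · intro m n₁ n₂ y₁ y₂ hm h₁ h₂ hy₁ hy₂ h hmod
    exact sameTLink_pair hm h₁ h₂ hy₁ hy₂ h hmod
  · intro m n y hm hn hy
    -- With `n₂ = y` and `y₂ = n` the second congruence is `n ≡ n`.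
    exact sameTLink_pair hm hn hy (by omega) (by omega) (Nat.add_comm n y) (Or.inr rfl)
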